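/- Let $R$ be an integral domain, $n\ge 1$, and let $f\in R[x_1,\dots,x_n]$ have at most $T$ terms and total degree less than $D$. For integers $d\ge1$ and $p\ge 1$ put $w_i=d^{\,i-1}\bmod p$ and $$f_{(d,p)}=f(x^{w_1},\dots,x^{w_n}),\qquad f_{(d,p,k)}=f(x^{w_1},\dots,x^{w_k+p},\dots,x^{w_n})\quad(1\le k\le n),$$ and for $g\in R[x_1,\dots,x_n]$ let $g^{\rm mod}_{(d,p)}$ be the remainder of $g_{(d,p)}$ modulo $x^p-1$. Let $\#g$ denote the number of terms of $g$. Differences in $\mathbb N$ are truncated at $0$. Algorithm MIPolyBase. Its input is a black box that evaluates $f$ (on an $R$-algebra $A$, e.g. $A=R$), the bounds $T$ and $D$, and a prime $p$; it uses a univariate interpolation algorithm as a subroutine. 1. Put $\delta_1=(n-1)(T-1)$, $\delta_2=(n-1)T$, $N=\max\{4\delta_1+1,\delta_1+\delta_2+1\}$. The prime $p$ has to satisfy $p\ge\max\{n,N,D\}$. 2. For $d=1,\dots,N$ find $f_d=f_{(d,p)}$ by univariate interpolation and compute $f_d^{\rm mod}=f_d \bmod (x^p-1)$. 3. Let $h=0$,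 $\alpha=\max_{1\le d\le N}\#f_d^{\rm mod}$, and choose $d_0$ with $\#f^{\rm mod}_{d_0}=\alpha$. 4. While $\alpha\ne0$: (a) for $k=1,\dots,n$ find $f_{(d_0,p,k)}$ by univariate interpolation and put $g_k=f_{(d_0,p,k)}-h_{(d_0,p,k)}$; (b) let $S$ be the set of all $a\,x_1^{e_1}\cdots x_n^{e_n}$ such that, for some $r$ with $0\le r<p$, $a$ is the nonzero coefficient of $x^r$ in $f_{d_0}^{\rm mod}$; the part of $f_{d_0}$, respectively of $g_k$, with exponents congruent to $r$ modulo $p$ is a single term $a x^{\gamma}$, respectively $a x^{\beta_k}$ ($1\le k\le n$); $e_k=(\beta_k-\gamma)/p\in\mathbb N$ for all $k$; $\gamma=\sum_k e_k\,(d_0^{\,k-1}\bmod p)$; and $\sum_k e_k<D$; (c) let $s$ be the sum of those $u\in S$ for which $\#(f_d^{\rm mod}-u^{\rm mod}_{(d,p)})<\#f_d^{\rm mod}$ holds for at least $\delta_2+1$ integers $d\in[1,\delta_1+\delta_2+1]$; (d) replace $h$ by $h+s$ and $T$ by $T-\#s$, and recompute $\delta_1,\delta_2,N$; (e) for $d=1,\dots,N$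 replace $f_d$ by $f_d-s_{(d,p)}$ and $f_d^{\rm mod}$ by $f_d^{\rm mod}-s^{\rm mod}_{(d,p)}$; (f) recompute $\alpha$ and $d_0$ as in Step 3. 5. Return $h$. Cost model. The sparse univariate polynomials are stored as dictionaries (binary tries) indexed by the exponent. One ring operation is one addition, negation or equality test in $R$. Bit operations count everything else: an addition, subtraction or comparison of integers of total binary length $L$ (plus one) costs $L$, a multiplication or division costs $L(1+\lfloor\log_2L\rfloor)^2$ (which dominates the Schönhage–Strassen bound), and each step through a list or a trie costs $1$. The work done inside the univariate interpolation subroutine is not counted, nor is finding the prime $p$ of Step 1. $O^\sim(g)$ means $O\big(g\,\log_2(3+g)^k\big)$ for some constant $k$. Theorem. Fix a constant $\kappa\in\mathbb N$. Let $p$ be any prime with $\max\{n,N,D\}\le p\le\kappa\max\{n,N,D\}$, $N$ being computed from the input $T$ as in Step 1, and suppose that the univariate interpolation algorithm recovers every $g\in R[x]$ with $\deg g<2Dp$ and at most $T$ terms from its values on $A$, as the list of its terms. Then MIPolyBase terminates and returns $f$ exactly, as the list of its terms. Every univariate polynomial that it interpolates has at most $T$ terms and degree less than the degree bound handed to the subroutine.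 If moreover $T\ge1$, then, with implied constants (and exponents $k$) depending only on $\kappa$, it interpolates $O(nT)$ univariate polynomials, with degree bounds in $O(D\max\{nT,D\})$, and besides this it uses $O^\sim(nT^2)$ ring operations in $R$ and, if $D\ge2$, $O^\sim(n^2T^2\log D)$ bit operations. -/

import Mathlib

/-! Sparse interpolation with base-changing Kronecker substitutions: the cost model, the data
structures, and the algorithm MIPolyBase written as a program in that cost model. -/

namespace SparseInterp

/-! ### The cost model

A computation carries its result together with
* the number of ring operations (addition, negation, equality test of two ring elements),
* the number of bit operations spent on everything else (integer arithmetic on exponents,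
  indices and counters; walking through lists and trees),
* the list of the univariate interpolations it has asked for. -/

/-- A call of the univariate interpolation algorithm: it concerns the univariate polynomial
`f(x ^ w₁, …, x ^ wₙ)`, where `w` is the list `weights`, and it is made with a strict degree bound
`degBound` and a bound `termBound` on the number of terms. -/
structure Query where
  weights : List ℕ
  degBound : ℕ
  termBound : ℕ

/-- A result with the cost of computing it. -/
structure Run (α : Type*) where
  val : α
  ringOps : ℕ
  bitOps : ℕ
  queries : List Query

namespace Run

/-- The computation that returns `a` at no cost. -/
def pure {α : Type*} (a : α) : Run α := ⟨a, 0, 0, []⟩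

/-- Sequential composition: costs add up. -/
def bind {α β : Type*} (x : Run α) (g : α → Run β) : Run β :=
  ⟨(g x.val).val, x.ringOps + (g x.val).ringOps, x.bitOps + (g x.val).bitOps,
    x.queries ++ (g x.val).queries⟩

/-- Spend one bit operation, then continue with `x`. -/
def tick {α : Type*} (x : Run α) : Run α := ⟨x.val, x.ringOps, x.bitOps + 1, x.queries⟩

end Run

section Primitives

/-- Total length of two integers in binary, plus one. -/
def bitLen (a b : ℕ) : ℕ := a.size + b.size + 1

/-- The number of bit operations charged for a multiplication or a division of integers of total
length `L`: it dominates the Schönhage–Strassen bound `O(L log L log log L)`. -/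
def mulCost (L : ℕ) : ℕ := L * (Nat.log 2 L + 1) ^ 2

def natAdd (a b : ℕ) : Run ℕ := ⟨a + b, 0, bitLen a b, []⟩
def natSub (a b : ℕ) : Run ℕ := ⟨a - b, 0, bitLen a b, []⟩
def natLe (a b : ℕ) : Run Bool := ⟨decide (a ≤ b), 0, bitLen a b, []⟩
def natLt (a b : ℕ) : Run Bool := ⟨decide (a < b), 0, bitLen a b, []⟩
def natEq (a b : ℕ) : Run Bool := ⟨decide (a = b), 0, bitLen a b, []⟩
def natMul (a b : ℕ) : Run ℕ := ⟨a * b, 0, mulCost (bitLen a b), []⟩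
def natDiv (a b : ℕ) : Run ℕ := ⟨a / b, 0, mulCost (bitLen a b), []⟩
def natMod (a b : ℕ) : Run ℕ := ⟨a % b, 0, mulCost (bitLen a b), []⟩

variable {R : Type*} [CommRing R] [DecidableEq R]

def ringAdd (a b : R) : Run R := ⟨a + b, 1, 0, []⟩
def ringNeg (a : R) : Run R := ⟨-a, 1, 0, []⟩
def ringEq (a b : R) : Run Bool := ⟨decide (a = b), 1, 0, []⟩

/-- Call the univariate interpolation procedure `ask` and record the call. -/
def interpolate {R : Type*} (ask : List ℕ → ℕ → ℕ → List (ℕ × R)) (w : List ℕ) (Δ τ : ℕ) :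
    Run (List (ℕ × R)) :=
  ⟨ask w Δ τ, 0, 0, [⟨w, Δ, τ⟩]⟩

end Primitives

section Lists

/-- Left fold; every step costs one bit operation besides the cost of its body. -/
def foldRun {α β : Type*} (g : β → α → Run β) : β → List α → Run β
  | b, [] => Run.pure b
  | b, a :: l => ((g b a).bind fun b' => foldRun g b' l).tick

/-- Apply `g` to all entries of a list, with the same convention on the cost. -/
def mapRun {α β : Type*} (g : α → Run β) : List α → Run (List β)
  | [] => Run.pure []
  | a :: l => ((g a).bind fun b => (mapRun g l).bind fun bs => Run.pure (b :: bs)).tick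

/-- The list `i, i + 1, …, i + m - 1`. -/
def rangeRun : ℕ → ℕ → Run (List ℕ)
  | 0, _ => Run.pure []
  | m + 1, i => (natAdd i 1).bind fun j => (rangeRun m j).bind fun l => Run.pure (i :: l)

/-- The sum of a list. -/
def sumRun (l : List ℕ) : Run ℕ := foldRun natAdd 0 l

/-- The length of a list. -/
def lengthRun {α : Type*} (l : List α) : Run ℕ := foldRun (fun c _ => natAdd c 1) 0 l

/-- The inner product of two lists. -/
def dotRun : List ℕ → List ℕ → Run ℕ
  | a :: e, b :: w => (natMul a b).bind fun x => (dotRun e w).bind fun y => natAdd x y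
  | _, _ => (Run.pure 0).tick

end Lists

/-! ### Dictionaries

Binary tries. The key `k : ℕ` is stored at the end of the path `k.bits`, so that an access takes
one step per binary digit of the key. -/

inductive Trie (α : Type*) where
  | empty : Trie α
  | node : Option α → Trie α → Trie α → Trie α

namespace Trie

/-- The entry at a path. -/
def get {α : Type*} : Trie α → List Bool → Run (Option α)
  | empty, _ => (Run.pure none).tick
  | node v _ _, [] => (Run.pure v).tick
  | node _ l _, false :: bs => (l.get bs).tick
  | node _ _ r, true :: bs => (r.get bs).tick

/-- Overwrite the entry at a path. -/
def set {α : Type*} (x : Option α) : Trie α → List Bool → Run (Trie α)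
  | empty, [] => (Run.pure (node x empty empty)).tick
  | node _ l r, [] => (Run.pure (node x l r)).tick
  | empty, false :: bs => ((set x empty bs).bind fun t => Run.pure (node none t empty)).tick
  | empty, true :: bs => ((set x empty bs).bind fun t => Run.pure (node none empty t)).tick
  | node v l r, false :: bs => ((set x l bs).bind fun t => Run.pure (node v t r)).tick
  | node v l r, true :: bs => ((set x r bs).bind fun t => Run.pure (node v l t)).tick

/-- All entries, put in front of `acc`. -/
def entries {α : Type*} : Trie α → List α → Run (List α)
  | empty, acc => (Run.pure acc).tick
  | node none l r, acc => ((r.entries acc).bind fun acc' => l.entries acc').tick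
  | node (some v) l r, acc =>
      ((r.entries acc).bind fun acc' => (l.entries acc').bind fun acc'' =>
        Run.pure (v :: acc'')).tick

end Trie

section Algorithm

/-- A sparse univariate polynomial: the terms `a x ^ k` with `a ≠ 0`, stored as the pairs `(k, a)`
under the keys `k`, and their number. -/
structure Sparse (R : Type*) where
  tree : Trie (ℕ × R)
  count : ℕ

/-- A term `coeff * x₁ ^ e₁ ⋯ xₙ ^ eₙ`, where `e` is the list `exps`. -/
structure Term (R : Type*) where
  coeff : R
  exps : List ℕ

variable {R : Type*} [CommRing R] [DecidableEq R]

namespace Sparse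

def zero : Sparse R := ⟨Trie.empty, 0⟩

/-- `F + a x ^ k`. -/
def plusTerm (F : Sparse R) (k : ℕ) (a : R) : Run (Sparse R) :=
  (F.tree.get k.bits).bind fun
    | none => (ringEq a 0).bind fun z =>
        if z then Run.pure F
        else (F.tree.set (some (k, a)) k.bits).bind fun t =>
          (natAdd F.count 1).bind fun c => Run.pure ⟨t, c⟩
    | some (_, b) => (ringAdd b a).bind fun s => (ringEq s 0).bind fun z =>
        if z then (F.tree.set none k.bits).bind fun t =>
          (natSub F.count 1).bind fun c => Run.pure ⟨t, c⟩
        else (F.tree.set (some (k, s)) k.bits).bind fun t => Run.pure ⟨t, F.count⟩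

/-- `F - a x ^ k`. -/
def minusTerm (F : Sparse R) (k : ℕ) (a : R) : Run (Sparse R) :=
  (ringNeg a).bind fun b => F.plusTerm k b

/-- The polynomial with a given list of terms. -/
def ofList (l : List (ℕ × R)) : Run (Sparse R) :=
  foldRun (fun F t => F.plusTerm t.1 t.2) zero l

/-- The polynomial with a given list of terms, modulo `x ^ p - 1`. -/
def ofListMod (p : ℕ) (l : List (ℕ × R)) : Run (Sparse R) :=
  foldRun (fun F t => (natMod t.1 p).bind fun r => F.plusTerm r t.2) zero l

end Sparse

/-- Auxiliary loop for `kroneckerWeights`: `v, v d mod p, v d² mod p, …` (`m` entries). -/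
def weightsFrom (d p : ℕ) : ℕ → ℕ → Run (List ℕ)
  | 0, _ => Run.pure []
  | m + 1, v => (natMul v d).bind fun x => (natMod x p).bind fun v' =>
      (weightsFrom d p m v').bind fun l => Run.pure (v :: l)

/-- The weights `d⁰ mod p, d¹ mod p, …, dⁿ⁻¹ mod p` of the substitution that defines `f_(d,p)`. -/
def kroneckerWeights (n d p : ℕ) : Run (List ℕ) :=
  (natMod 1 p).bind fun v => weightsFrom d p n v

/-- Add `p` to the entry number `k` (counted from `0`); this turns the weights of `f_(d,p)` into
those of `f_(d,p,k+1)`. -/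
def bump (p : ℕ) : ℕ → List ℕ → Run (List ℕ)
  | _, [] => Run.pure []
  | 0, v :: l => (natAdd v p).bind fun x => Run.pure (x :: l)
  | k + 1, v :: l => ((bump p k l).bind fun l' => Run.pure (v :: l')).tick

/-! #### The algorithm TSTerms -/

/-- For every residue class modulo `p`, record whether `F` has no term (no entry), exactly one
term (the entry `some` of that term) or several terms (the entry `none`) with exponent in it. -/
def classTable (p : ℕ) (F : Sparse R) : Run (Trie (Option (ℕ × R))) :=
  (F.tree.entries []).bind fun l =>
    foldRun (fun C t => (natMod t.1 p).bind fun r => (C.get r.bits).bind fun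
      | none => C.set (some (some t)) r.bits
      | some _ => C.set (some none) r.bits) Trie.empty l

/-- If the part of the polynomial in the residue class `r` is a single term `a x ^ γ` with the
given `a`, return `γ`. -/
def singleTerm (C : Trie (Option (ℕ × R))) (r : ℕ) (a : R) : Run (Option ℕ) :=
  (C.get r.bits).bind fun
    | some (some (γ, b)) => (ringEq a b).bind fun z => Run.pure (if z then some γ else none)
    | _ => Run.pure none

/-- The exponents `e_k = (β_k - γ) / p`, one for each table in the list, provided that all of them
exist and are natural numbers. -/
def exponents (p r : ℕ) (a : R) (γ : ℕ) : List (Trie (Option (ℕ × R))) → Run (Option (List ℕ))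
  | [] => Run.pure (some [])
  | C :: Cs => (singleTerm C r a).bind fun
      | none => Run.pure none
      | some β => (natLe γ β).bind fun ok =>
          if ok then
            (natSub β γ).bind fun x => (natMod x p).bind fun y => (natEq y 0).bind fun z =>
              if z then
                (natDiv x p).bind fun q => (exponents p r a γ Cs).bind fun
                  | none => Run.pure none
                  | some es => Run.pure (some (q :: es))
              else Run.pure none
          else Run.pure none

/-- The algorithm TSTerms. `M` is `f_(d,p)` modulo `x ^ p - 1`, `F` is `f_(d,p)`, `gs` is the list
of the `f_(d,p,k)`, and `w` is the list of the `d ^ (k-1) mod p`. -/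
def tsTerms (M F : Sparse R) (gs : List (Sparse R)) (w : List ℕ) (p D : ℕ) : Run (List (Term R)) :=
  (classTable p F).bind fun C₀ => (mapRun (classTable p) gs).bind fun Cs =>
    (M.tree.entries []).bind fun l =>
      foldRun (fun S t => (singleTerm C₀ t.1 t.2).bind fun
        | none => Run.pure S
        | some γ => (exponents p t.1 t.2 γ Cs).bind fun
          | none => Run.pure S
          | some e => (dotRun e w).bind fun v => (natEq v γ).bind fun ok =>
              if ok then
                (sumRun e).bind fun s => (natLt s D).bind fun small =>
                  Run.pure (if small then ⟨t.2, e⟩ :: S else S)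
              else Run.pure S) [] l

/-! #### The algorithm MIPolyBase -/

/-- What is kept for a base `d`: the weights `d ^ (k-1) mod p`, the polynomial `f_(d,p)` and its
remainder modulo `x ^ p - 1`. -/
structure Base (R : Type*) where
  d : ℕ
  weights : List ℕ
  F : Sparse R
  M : Sparse R

/-- `δ₁ = (n-1)(T-1)`. -/
def delta₁ (n T : ℕ) : ℕ := (n - 1) * (T - 1)

/-- `δ₂ = (n-1)T`. -/
def delta₂ (n T : ℕ) : ℕ := (n - 1) * T

/-- `N = max {4δ₁ + 1, δ₁ + δ₂ + 1}`. -/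
def numBases (n T : ℕ) : ℕ :=
  max (4 * delta₁ n T + 1) (delta₁ n T + delta₂ n T + 1)

/-- Compute `(δ₂ + 1, δ₁ + δ₂ + 1, N)`. -/
def bounds (n T : ℕ) : Run (ℕ × ℕ × ℕ) :=
  (natSub n 1).bind fun m => (natSub T 1).bind fun t => (natMul m t).bind fun δ₁ =>
    (natMul m T).bind fun δ₂ => (natMul 4 δ₁).bind fun x => (natAdd x 1).bind fun x₁ =>
      (natAdd δ₂ 1).bind fun y => (natAdd δ₁ y).bind fun y₁ => (natLe x₁ y₁).bind fun z =>
        Run.pure (y, y₁, if z then y₁ else x₁)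

/-- Step 2 for a single base `d`. -/
def initBase (ask : List ℕ → ℕ → ℕ → List (ℕ × R)) (n p Δ τ d : ℕ) : Run (Base R) :=
  (kroneckerWeights n d p).bind fun w => (interpolate ask w Δ τ).bind fun l =>
    (Sparse.ofList l).bind fun F => (Sparse.ofListMod p l).bind fun M => Run.pure ⟨d, w, F, M⟩

/-- Steps 3 and 4f: a base whose remainder has the largest number of terms. -/
def bestBase (bs : List (Base R)) : Run (Option (Base R)) :=
  foldRun (fun best b => match best with
    | none => Run.pure (some b)
    | some c => (natLe b.M.count c.M.count).bind fun z =>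
        Run.pure (if z then some c else some b)) none bs

/-- Subtract from `G` the image of `u` under the substitution with weights `w`. -/
def minusImage (w : List ℕ) (G : Sparse R) (u : Term R) : Run (Sparse R) :=
  (dotRun u.exps w).bind fun γ => G.minusTerm γ u.coeff

/-- The same modulo `x ^ p - 1`. -/
def minusImageMod (p : ℕ) (w : List ℕ) (G : Sparse R) (u : Term R) : Run (Sparse R) :=
  (dotRun u.exps w).bind fun γ => (natMod γ p).bind fun r => G.minusTerm r u.coeff

/-- Step 4a: the polynomials `g_k = f_(d,p,k) - h_(d,p,k)`. -/
def shifted (ask : List ℕ → ℕ → ℕ → List (ℕ × R)) (n p Δ τ : ℕ) (w : List ℕ) (h : List (Term R)) :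
    Run (List (Sparse R)) :=
  (rangeRun n 0).bind fun ks => mapRun (fun k => (bump p k w).bind fun wk =>
    (interpolate ask wk Δ τ).bind fun l => (Sparse.ofList l).bind fun G =>
      foldRun (minusImage wk) G h) ks

/-- Step 4c for a single candidate `u`: are there at least `need` bases `d ≤ last` for which
subtracting `u` makes the number of terms of the remainder smaller? -/
def accepts (p need last : ℕ) (bs : List (Base R)) (u : Term R) : Run Bool :=
  (foldRun (fun c b => (natLe b.d last).bind fun use =>
    if use then (minusImageMod p b.weights b.M u).bind fun G =>
      (natLt G.count b.M.count).bind fun less => if less then natAdd c 1 else Run.pure c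
    else Run.pure c) 0 bs).bind fun c => natLe need c

/-- Step 4c. -/
def select (p need last : ℕ) (bs : List (Base R)) (ts : List (Term R)) : Run (List (Term R)) :=
  foldRun (fun s u => (accepts p need last bs u).bind fun ok =>
    Run.pure (if ok then u :: s else s)) [] ts

/-- Step 4e: drop the bases beyond `N` and update the others. -/
def update (p N : ℕ) (s : List (Term R)) (bs : List (Base R)) : Run (List (Base R)) :=
  match bs with
  | [] => Run.pure []
  | b :: bs => (natLe b.d N).bind fun keep =>
      if keep then
        (foldRun (minusImage b.weights) b.F s).bind fun F =>
          (foldRun (minusImageMod p b.weights) b.M s).bind fun M =>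
            (update p N s bs).bind fun bs' => Run.pure (⟨b.d, b.weights, F, M⟩ :: bs')
      else update p N s bs

/-- The loop of Step 4. `τ` is the term bound given as input, `T` the current value of that
variable. The loop is cut off, with the result `none`, after `fuel` tests of its condition. -/
def mainLoop (ask : List ℕ → ℕ → ℕ → List (ℕ × R)) (n p D Δ τ : ℕ) :
    ℕ → ℕ → List (Term R) → List (Base R) → Run (Option (List (Term R)))
  | 0, _, _, _ => Run.pure none
  | fuel + 1, T, h, bs => (bestBase bs).bind fun
      | none => Run.pure (some h)
      | some b₀ => (natEq b₀.M.count 0).bind fun done =>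
          if done then Run.pure (some h)
          else
            (shifted ask n p Δ τ b₀.weights h).bind fun gs =>
            (tsTerms b₀.M b₀.F gs b₀.weights p D).bind fun ts =>
            (bounds n T).bind fun bd =>
            (select p bd.1 bd.2.1 bs ts).bind fun s =>
            (foldRun (fun h' u => Run.pure (u :: h')) h s).bind fun h' =>
            (lengthRun s).bind fun c =>
            (natSub T c).bind fun T' =>
            (bounds n T').bind fun bd' =>
            (update p bd'.2.2 s bs).bind fun bs' =>
              mainLoop ask n p D Δ τ fuel T' h' bs'

/-- The algorithm MIPolyBase, with the prime `p` of Step 1 as an input.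

`box : (Fin n → A) → A` is the black box and `interp` the univariate interpolation algorithm: it is
given a black box `A → A`, a strict degree bound and a bound on the number of terms, and returns a
list of terms. -/
def miPolyBase {A : Type*} [CommRing A] (n T D p : ℕ) (box : (Fin n → A) → A)
    (interp : (A → A) → ℕ → ℕ → List (ℕ × R)) (fuel : ℕ) : Run (Option (List (Term R))) :=
  let ask := fun (w : List ℕ) => interp fun x => box fun i => x ^ w.getD i 0
  (natMul D p).bind fun y => (natMul 2 y).bind fun Δ => (bounds n T).bind fun bd =>
    (rangeRun bd.2.2 1).bind fun ds => (mapRun (initBase ask n p Δ T) ds).bind fun bs =>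
      mainLoop ask n p D Δ T fuel T [] bs

end Algorithm

section Specification

open Polynomial

variable {R : Type*} [CommRing R]

/-- `l` lists the terms of the univariate polynomial `g`, each of them once. -/
def ListsTerms (l : List (ℕ × R)) (g : R[X]) : Prop :=
  (l.map Prod.fst).Nodup ∧ (∀ t ∈ l, t.2 ≠ 0) ∧
    (l.map fun t => Polynomial.monomial t.1 t.2).sum = g

/-- `l` lists the terms of the multivariate polynomial `f`, each of them once. -/
def ListsMvTerms {n : ℕ} (l : List (Term R)) (f : MvPolynomial (Fin n) R) : Prop :=
  (l.map Term.exps).Nodup ∧ (∀ u ∈ l, u.exps.length = n ∧ u.coeff ≠ 0) ∧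
    (l.map fun u => MvPolynomial.monomial
      (Finsupp.equivFunOnFinite.symm fun i : Fin n => u.exps.getD i 0) u.coeff).sum = f

/-- `f(x ^ w₁, …, x ^ wₙ)`. -/
noncomputable def powerSubst {n : ℕ} (w : List ℕ) (f : MvPolynomial (Fin n) R) : R[X] :=
  MvPolynomial.aeval (fun i : Fin n => (X : R[X]) ^ w.getD i 0) f

/-- `box` is a black box for `f`: it evaluates `f` at points with coordinates in the `R`-algebra `A`
(for instance `A = R`). -/
def IsBlackBox {n : ℕ} {A : Type*} [CommRing A] [Algebra R A] (box : (Fin n → A) → A)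
    (f : MvPolynomial (Fin n) R) : Prop :=
  ∀ x, box x = MvPolynomial.aeval x f

/-- `interp` recovers every univariate polynomial of degree less than `Δ` with at most `τ` terms
from its values on `A`. -/
def IsUnivariateInterpolation {A : Type*} [CommRing A] [Algebra R A]
    (interp : (A → A) → ℕ → ℕ → List (ℕ × R)) (Δ τ : ℕ) : Prop :=
  ∀ g : R[X], g.natDegree < Δ → g.support.card ≤ τ →
    ListsTerms (interp (fun x => Polynomial.aeval x g) Δ τ) g

/-- `c ≤ C g log₂(3 + g) ^ k`. With `C` and `k` absolute constants, this is `c = O^~(g)`. -/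
def SoftLe (C k : ℕ) (c : ℕ) (g : ℝ) : Prop :=
  (c : ℝ) ≤ C * g * Real.logb 2 (3 + g) ^ k

end Specification

end SparseInterp

/-! Correctness rests on counting collisions. Two distinct exponent vectors `s`, `s'` with entries
below `p` have the same residue at the base `d` only if `d` is a root modulo `p` of the nonzero
polynomial with coefficients `s i - s' i`, whose degree is at most `n - 1`. Hence at most `n - 1` of
the bases `1, …, N ≤ p` make a given pair collide (`card_filter_residue_eq_le`). Let `g = f - h` be
what is still unknown and `T` the current bound for its number of terms.

Progress: among `4 (n-1)(T-1) + 1` bases, averaging gives one at which at least `3/4` of the terms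
of `g` meet no other term (`exists_many_isolated`). The chosen base leaves at least as many terms
modulo `x ^ p - 1`. A residue class that holds no isolated term uses up at least two terms, so the
chosen base still isolates at least half of them (`card_support_le_two_mul_card_isolated`). An
isolated term stays alone in its class when one weight is raised by `p`; its exponent then moves by
`p * e_k`, which reveals `e_k`. So every isolated term is among the candidates (`tsTerms_meets`).

Soundness: subtracting `a x ^ r` lowers the number of terms exactly when the coefficient at `r`
equals `a`. At a base where the candidate meets no other term of `g`, this tests the true
coefficient. A genuine term is disturbed at no more than `δ₁` bases, a wrong one can profit from no
more than `δ₂`, so `δ₂ + 1` successes among `δ₁ + δ₂ + 1` bases decide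
(`delta₂_lt_card_goodBases_iff`). Each pass therefore removes only true terms, and at least half of
them; `T.size` passes suffice (`mainLoop_meets`).

Cost: `Run.Meets` carries postcondition and resource bounds together through the program. All
integers are at most some `B` polynomial in `n T D`, so each arithmetic operation or trie access
costs at most `opCost B`, which is `log D` up to logarithmic factors (`opCost_le`). The dominant
work is testing up to `T` candidates at `O(nT)` bases, each test with an inner product of length
`n`. -/

namespace SparseInterp

/-! ### Resource bounds for computations -/

/-- The result of `x` satisfies `P`, and `x` uses at most `r` ring operations, `b` bit operations
and `q` interpolations, all of which satisfy `Q`. -/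
structure Run.Meets {α : Type*} (Q : Query → Prop) (x : Run α) (P : α → Prop) (r b q : ℕ) :
    Prop where
  val : P x.val
  ring : x.ringOps ≤ r
  bit : x.bitOps ≤ b
  len : x.queries.length ≤ q
  qry : ∀ y ∈ x.queries, Q y

namespace Run

variable {α β : Type*} {Q : Query → Prop}

theorem Meets.mono {x : Run α} {P P' : α → Prop} {r b q r' b' q' : ℕ} (h : x.Meets Q P r b q)
    (hP : ∀ a, P a → P' a) (hr : r ≤ r') (hb : b ≤ b') (hq : q ≤ q') : x.Meets Q P' r' b' q' :=
  ⟨hP _ h.val, h.ring.trans hr, h.bit.trans hb, h.len.trans hq, h.qry⟩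

theorem Meets.bound {x : Run α} {P : α → Prop} {r b q r' b' q' : ℕ} (h : x.Meets Q P r b q)
    (hr : r ≤ r') (hb : b ≤ b') (hq : q ≤ q') : x.Meets Q P r' b' q' :=
  h.mono (fun _ => id) hr hb hq

theorem Meets.bind {x : Run α} {g : α → Run β} {P : α → Prop} {P' : β → Prop}
    {r b q r' b' q' : ℕ} (hx : x.Meets Q P r b q) (hg : ∀ a, P a → (g a).Meets Q P' r' b' q') :
    (x.bind g).Meets Q P' (r + r') (b + b') (q + q') := by
  have h := hg _ hx.val
  refine ⟨h.val, Nat.add_le_add hx.ring h.ring, Nat.add_le_add hx.bit h.bit, ?_, ?_⟩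
  · simpa [Run.bind] using Nat.add_le_add hx.len h.len
  · intro y hy
    rcases List.mem_append.1 hy with hy | hy
    · exact hx.qry y hy
    · exact h.qry y hy

theorem Meets.tick {x : Run α} {P : α → Prop} {r b q : ℕ} (h : x.Meets Q P r b q) :
    x.tick.Meets Q P r (b + 1) q :=
  ⟨h.val, h.ring, Nat.add_le_add_right h.bit 1, h.len, h.qry⟩

theorem Meets.pure {a : α} {P : α → Prop} (h : P a) (r b q : ℕ) :
    (Run.pure a).Meets Q P r b q :=
  ⟨h, Nat.zero_le _, Nat.zero_le _, Nat.zero_le _, by simp [Run.pure]⟩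

theorem Meets.pure_eq (a : α) : (Run.pure a).Meets Q (· = a) 0 0 0 :=
  .pure (P := (· = a)) rfl 0 0 0

end Run

open Run

/-! ### Costs of single operations -/

section Primitives

variable {Q : Query → Prop} {B a b : ℕ}

/-- A bound for the cost of an arithmetic operation on integers that are at most `B`. -/
def opCost (B : ℕ) : ℕ := mulCost (2 * B.size + 1)

theorem le_mulCost (L : ℕ) : L ≤ mulCost L :=
  Nat.le_mul_of_pos_right _ (by positivity)

theorem mulCost_mono {L L' : ℕ} (h : L ≤ L') : mulCost L ≤ mulCost L' := by
  unfold mulCost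
  have := Nat.log_mono_right (b := 2) h
  gcongr

theorem bitLen_le (ha : a ≤ B) (hb : b ≤ B) : bitLen a b ≤ 2 * B.size + 1 := by
  have := Nat.size_le_size ha
  have := Nat.size_le_size hb
  unfold bitLen
  omega

theorem bitLen_le_opCost (ha : a ≤ B) (hb : b ≤ B) : bitLen a b ≤ opCost B :=
  (bitLen_le ha hb).trans (le_mulCost _)

theorem mulCost_le_opCost (ha : a ≤ B) (hb : b ≤ B) : mulCost (bitLen a b) ≤ opCost B :=
  mulCost_mono (bitLen_le ha hb)

theorem one_le_opCost (B : ℕ) : 1 ≤ opCost B :=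
  le_trans (by omega) (le_mulCost (2 * B.size + 1))

/-- Walking down a trie takes one step per binary digit of the key and one more at the end, so a
dictionary access is charged in the same unit as an arithmetic operation. -/
theorem length_bits_lt_opCost (h : a ≤ B) : a.bits.length + 1 ≤ opCost B := by
  have := Nat.size_le_size h
  rw [Nat.size_eq_bits_len]
  exact le_trans (by omega) (le_mulCost (2 * B.size + 1))

theorem natAdd_meets (ha : a ≤ B) (hb : b ≤ B) :
    (natAdd a b).Meets Q (· = a + b) 0 (opCost B) 0 :=
  ⟨rfl, le_rfl, bitLen_le_opCost ha hb, le_rfl, by simp [natAdd]⟩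

theorem natSub_meets (ha : a ≤ B) (hb : b ≤ B) :
    (natSub a b).Meets Q (· = a - b) 0 (opCost B) 0 :=
  ⟨rfl, le_rfl, bitLen_le_opCost ha hb, le_rfl, by simp [natSub]⟩

theorem natLe_meets (ha : a ≤ B) (hb : b ≤ B) :
    (natLe a b).Meets Q (· = decide (a ≤ b)) 0 (opCost B) 0 :=
  ⟨rfl, le_rfl, bitLen_le_opCost ha hb, le_rfl, by simp [natLe]⟩

theorem natLt_meets (ha : a ≤ B) (hb : b ≤ B) :
    (natLt a b).Meets Q (· = decide (a < b)) 0 (opCost B) 0 :=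
  ⟨rfl, le_rfl, bitLen_le_opCost ha hb, le_rfl, by simp [natLt]⟩

theorem natEq_meets (ha : a ≤ B) (hb : b ≤ B) :
    (natEq a b).Meets Q (· = decide (a = b)) 0 (opCost B) 0 :=
  ⟨rfl, le_rfl, bitLen_le_opCost ha hb, le_rfl, by simp [natEq]⟩

theorem natMul_meets (ha : a ≤ B) (hb : b ≤ B) :
    (natMul a b).Meets Q (· = a * b) 0 (opCost B) 0 :=
  ⟨rfl, le_rfl, mulCost_le_opCost ha hb, le_rfl, by simp [natMul]⟩

theorem natDiv_meets (ha : a ≤ B) (hb : b ≤ B) :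
    (natDiv a b).Meets Q (· = a / b) 0 (opCost B) 0 :=
  ⟨rfl, le_rfl, mulCost_le_opCost ha hb, le_rfl, by simp [natDiv]⟩

theorem natMod_meets (ha : a ≤ B) (hb : b ≤ B) :
    (natMod a b).Meets Q (· = a % b) 0 (opCost B) 0 :=
  ⟨rfl, le_rfl, mulCost_le_opCost ha hb, le_rfl, by simp [natMod]⟩

variable {R : Type*}

theorem ringAdd_meets [CommRing R] (a b : R) : (ringAdd a b).Meets Q (· = a + b) 1 0 0 :=
  ⟨rfl, le_rfl, le_rfl, le_rfl, by simp [ringAdd]⟩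

theorem ringNeg_meets [CommRing R] (a : R) : (ringNeg a).Meets Q (· = -a) 1 0 0 :=
  ⟨rfl, le_rfl, le_rfl, le_rfl, by simp [ringNeg]⟩

theorem ringEq_meets [DecidableEq R] (a b : R) : (ringEq a b).Meets Q (· = decide (a = b)) 1 0 0 :=
  ⟨rfl, le_rfl, le_rfl, le_rfl, by simp [ringEq]⟩

end Primitives

/-! ### Loops over lists -/

section Lists

variable {Q : Query → Prop} {α β : Type*} {B r b q : ℕ}

/-- The loop rule. The invariant speaks of the prefix already processed; the splitting of `l` is
handed to the step so that it can use membership in `l` and the length of the prefix. -/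
theorem foldRun_meets {g : β → α → Run β} {l : List α} {x : β} (I : List α → β → Prop)
    (h0 : I [] x)
    (h : ∀ pre a suf y, l = pre ++ a :: suf → I pre y → (g y a).Meets Q (I (pre ++ [a])) r b q) :
    (foldRun g x l).Meets Q (I l) (l.length * r) (l.length * (b + 1)) (l.length * q) := by
  suffices H : ∀ suf pre x, l = pre ++ suf → I pre x → (foldRun g x suf).Meets Q (I l)
      (suf.length * r) (suf.length * (b + 1)) (suf.length * q) from H l [] x rfl h0
  intro suf
  induction suf with
  | nil => intro pre x hl hx; exact .pure (by simpa [hl] using hx) _ _ _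
  | cons a suf ih =>
    intro pre x hl hx
    refine (((h pre a suf x hl hx).bind fun y hy =>
      ih (pre ++ [a]) y (by simpa using hl) hy).tick).bound ?_ ?_ ?_ <;>
    · simp only [List.length_cons]
      ring_nf
      rfl

theorem mapRun_meets {g : α → Run β} {l : List α} {P : α → β → Prop}
    (h : ∀ a ∈ l, (g a).Meets Q (P a) r b q) :
    (mapRun g l).Meets Q (List.Forall₂ P l)
      (l.length * r) (l.length * (b + 1)) (l.length * q) := by
  induction l with
  | nil => exact .pure .nil _ _ _
  | cons a l ih =>
    refine ((h a (by simp)).bind fun y hy => (ih fun a ha => h a (by simp [ha])).bind fun ys hys =>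
      Meets.pure (.cons hy hys) 0 0 0).tick.bound ?_ ?_ ?_ <;>
    · simp only [List.length_cons]
      ring_nf
      rfl

theorem rangeRun_meets (m i : ℕ) (h : i + m ≤ B) (hB : 1 ≤ B) :
    (rangeRun m i).Meets Q (· = List.range' i m) 0 (m * opCost B) 0 := by
  induction m generalizing i with
  | zero => exact (Meets.pure_eq _).bound le_rfl (Nat.zero_le _) le_rfl
  | succ m ih =>
    refine ((natAdd_meets (B := B) (by omega) hB).bind (β := List ℕ) (r' := 0) (q' := 0)
      (b' := m * opCost B) ?_).bound (by simp) (by ring_nf; rfl) (by simp)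
    rintro _ rfl
    refine ((ih (i + 1) (by omega)).bind fun l hl => Meets.pure (b := 0) (r := 0) (q := 0) ?_).bound
      (by simp) (by simp) (by simp)
    rw [hl, List.range'_succ]

theorem sumRun_meets {l : List ℕ} (h : l.sum ≤ B) :
    (sumRun l).Meets Q (· = l.sum) 0 (l.length * (opCost B + 1)) 0 := by
  refine (foldRun_meets (q := 0) (r := 0) (fun pre y => y = pre.sum) rfl ?_).bound
    (by simp) le_rfl (by simp)
  rintro pre a suf _ hl rfl
  have : pre.sum + (a + suf.sum) ≤ B := by simpa [hl] using h
  simpa using natAdd_meets (B := B) (Q := Q) (a := pre.sum) (b := a) (by omega) (by omega)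

theorem lengthRun_meets {l : List α} (h : l.length ≤ B) (hB : 1 ≤ B) :
    (lengthRun l).Meets Q (· = l.length) 0 (l.length * (opCost B + 1)) 0 := by
  refine (foldRun_meets (q := 0) (r := 0) (fun pre y => y = pre.length) rfl ?_).bound
    (by simp) le_rfl (by simp)
  rintro pre a suf _ hl rfl
  have : pre.length ≤ B := by
    rw [hl] at h
    simp at h
    omega
  simpa using natAdd_meets (B := B) (Q := Q) this hB

/-- The inner product of two lists. -/
def dot (e w : List ℕ) : ℕ := (List.zipWith (· * ·) e w).sum

theorem dotRun_meets {e w : List ℕ} (he : ∀ x ∈ e, x ≤ B) (hw : ∀ x ∈ w, x ≤ B)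
    (h : dot e w ≤ B) :
    (dotRun e w).Meets Q (· = dot e w) 0 (2 * e.length * opCost B + 1) 0 := by
  induction e generalizing w with
  | nil => exact (Meets.pure_eq 0).tick.bound le_rfl (by omega) le_rfl
  | cons a e ih =>
    cases w with
    | nil => exact (Meets.pure_eq 0).tick.bound le_rfl (by omega) le_rfl
    | cons c w =>
      have h' : a * c + dot e w ≤ B := by simpa [dot] using h
      refine ((natMul_meets (B := B) (he a (by simp)) (hw c (by simp))).bind (β := ℕ)
        (r' := 0) (q' := 0) (b' := 2 * e.length * opCost B + 1 + opCost B) ?_).bound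
        (by simp) (by simp only [List.length_cons]; ring_nf; rfl) (by simp)
      rintro _ rfl
      refine (ih (fun x hx => he x (by simp [hx])) (fun x hx => hw x (by simp [hx]))
        (by omega)).bind (r' := 0) (q' := 0) ?_
      rintro _ rfl
      exact natAdd_meets (by omega) (by omega)

end Lists

/-! ### Tries -/

namespace Trie

variable {Q : Query → Prop} {α : Type*}

/-- The entry at a path. -/
def lookup : Trie α → List Bool → Option α
  | empty, _ => none
  | node v _ _, [] => v
  | node _ l _, false :: bs => l.lookup bs
  | node _ _ r, true :: bs => r.lookup bs

/-- The number of nodes, the empty ones included. -/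
def size : Trie α → ℕ
  | empty => 1
  | node _ l r => l.size + r.size + 1

/-- All entries. -/
def toList : Trie α → List α
  | empty => []
  | node v l r => v.toList ++ (l.toList ++ r.toList)

@[simp] theorem lookup_empty (bs : List Bool) : (empty : Trie α).lookup bs = none := by
  cases bs <;> rfl

theorem get_meets (t : Trie α) (bs : List Bool) :
    (t.get bs).Meets Q (· = t.lookup bs) 0 (bs.length + 1) 0 := by
  induction bs generalizing t with
  | nil => cases t <;> exact (Meets.pure_eq _).tick
  | cons c bs ih =>
    cases t with
    | empty => exact (Meets.pure_eq _).tick.bound le_rfl (by omega) le_rfl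
    | node v l r => cases c <;> exact (ih _).tick

/-- Each step of the path replaces at worst an empty leaf by a node with two empty children, which
adds two to the size. -/
theorem set_meets (x : Option α) (t : Trie α) (bs : List Bool) :
    (t.set x bs).Meets Q (fun t' => (∀ bs', t'.lookup bs' = if bs' = bs then x else t.lookup bs') ∧
      t'.size ≤ t.size + 2 * (bs.length + 1)) 0 (bs.length + 1) 0 := by
  induction bs generalizing t with
  | nil =>
    cases t with
    | empty =>
      refine (Meets.pure ⟨?_, ?_⟩ 0 0 0).tick
      · rintro (_ | ⟨_ | _, _⟩) <;> simp [lookup]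
      · simp [size]
    | node v l r =>
      refine (Meets.pure ⟨?_, ?_⟩ 0 0 0).tick
      · rintro (_ | ⟨_ | _, _⟩) <;> simp [lookup]
      · simp [size]
  | cons c bs ih =>
    cases t with
    | empty =>
      cases c
      all_goals
        refine ((ih empty).bind fun t ht => Meets.pure ⟨?_, ?_⟩ 0 0 0).tick
        · rintro (_ | ⟨_ | _, _⟩) <;> simp [lookup, ht.1]
        · have := ht.2
          simp only [size, List.length_cons] at this ⊢
          omega
    | node v l r =>
      cases c
      · refine ((ih l).bind fun t ht => Meets.pure ⟨?_, ?_⟩ 0 0 0).tick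
        · rintro (_ | ⟨_ | _, _⟩) <;> simp [lookup, ht.1]
        · have := ht.2
          simp only [size, List.length_cons] at this ⊢
          omega
      · refine ((ih r).bind fun t ht => Meets.pure ⟨?_, ?_⟩ 0 0 0).tick
        · rintro (_ | ⟨_ | _, _⟩) <;> simp [lookup, ht.1]
        · have := ht.2
          simp only [size, List.length_cons] at this ⊢
          omega

theorem entries_meets (t : Trie α) (acc : List α) :
    (t.entries acc).Meets Q (· = t.toList ++ acc) 0 t.size 0 := by
  induction t generalizing acc with
  | empty => exact (Meets.pure_eq _).tick
  | node v l r ihl ihr =>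
    cases v with
    | none =>
      refine ((ihr acc).bind (b' := l.size) (r' := 0) (q' := 0) ?_).tick.bound le_rfl
        (by simp only [size]; omega) le_rfl
      rintro _ rfl
      simpa [toList] using ihl (r.toList ++ acc)
    | some v =>
      refine ((ihr acc).bind (b' := l.size) (r' := 0) (q' := 0) ?_).tick.bound le_rfl
        (by simp only [size]; omega) le_rfl
      rintro _ rfl
      refine (ihl _).bind (b' := 0) (r' := 0) (q' := 0) ?_
      rintro _ rfl
      exact .pure (by simp [toList]) _ _ _

theorem mem_toList {t : Trie α} {v : α} : v ∈ t.toList ↔ ∃ bs, t.lookup bs = some v := by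
  induction t with
  | empty => simp [toList]
  | node u l r ihl ihr =>
    simp only [toList, List.mem_append, ihl, ihr, Option.mem_toList]
    constructor
    · rintro (h | ⟨bs, h⟩ | ⟨bs, h⟩)
      · exact ⟨[], h⟩
      · exact ⟨false :: bs, h⟩
      · exact ⟨true :: bs, h⟩
    · rintro ⟨_ | ⟨_ | _, bs⟩, h⟩
      · exact .inl h
      · exact .inr (.inl ⟨bs, h⟩)
      · exact .inr (.inr ⟨bs, h⟩)

/-- The hypothesis holds in the intended use because an entry contains its own key, and the key
determines the path. -/
theorem nodup_toList {t : Trie α}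
    (h : ∀ bs bs' v, t.lookup bs = some v → t.lookup bs' = some v → bs = bs') :
    t.toList.Nodup := by
  induction t with
  | empty => simp [toList]
  | node u l r ihl ihr =>
    have hl : l.toList.Nodup := ihl fun bs bs' v h1 h2 =>
      (List.cons.inj (h (false :: bs) (false :: bs') v h1 h2)).2
    have hr : r.toList.Nodup := ihr fun bs bs' v h1 h2 =>
      (List.cons.inj (h (true :: bs) (true :: bs') v h1 h2)).2
    rw [toList, List.nodup_append, List.nodup_append]
    refine ⟨by cases u <;> simp, ⟨hl, hr, ?_⟩, ?_⟩
    · rintro v hv _ hv' rfl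
      obtain ⟨bs, h1⟩ := mem_toList.1 hv
      obtain ⟨bs', h2⟩ := mem_toList.1 hv'
      simpa using h (false :: bs) (true :: bs') v h1 h2
    · rintro v hv _ hv' rfl
      have h0 : (node u l r).lookup [] = some v := by simpa [lookup] using hv
      rcases List.mem_append.1 hv' with hv' | hv'
      · obtain ⟨bs, h1⟩ := mem_toList.1 hv'
        simpa using h [] (false :: bs) v h0 h1
      · obtain ⟨bs, h1⟩ := mem_toList.1 hv'
        simpa using h [] (true :: bs) v h0 h1

end Trie

end SparseInterp

namespace SparseInterp

open Run Polynomial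

/-! ### Sparse polynomials -/

/-- The digits can be folded back to the number. This is what keeps different keys on different
paths. -/
theorem bits_injective : Function.Injective Nat.bits := by
  have h (n : ℕ) : n.bits.foldr Nat.bit 0 = n := by
    induction n using Nat.binaryRec' with
    | zero => simp
    | bit b n hn ih => rw [Nat.bits_append_bit n b hn, List.foldr_cons, ih]
  intro a b hab
  rw [← h a, hab, h b]

/-- Brings addition of a term into the form in which the trie performs it: one entry is overwritten.
-/
theorem add_monomial_eq_update {R : Type*} [CommRing R] (g : R[X]) (k : ℕ) (a : R) :
    g + monomial k a = g.update k (g.coeff k + a) := by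
  ext i
  rw [coeff_add, coeff_monomial, coeff_update_apply]
  split_ifs <;> simp_all

variable {Q : Query → Prop} {R : Type*} [CommRing R] {B m k : ℕ}

/-- `F` stores the polynomial `g` and results from at most `m` additions of terms. -/
structure Sparse.Represents (B : ℕ) (F : Sparse R) (g : R[X]) (m : ℕ) : Prop where
  lookup : ∀ bs v, F.tree.lookup bs = some v ↔ bs = v.1.bits ∧ v.2 ≠ 0 ∧ g.coeff v.1 = v.2
  count : F.count = g.support.card
  card_le : g.support.card ≤ m
  size_le : F.tree.size ≤ 1 + 2 * opCost B * m

namespace Sparse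

theorem represents_zero : (zero : Sparse R).Represents B 0 0 where
  lookup bs v := by
    simp only [zero, Trie.lookup_empty, coeff_zero]
    constructor
    · simp
    · rintro ⟨-, h1, h2⟩
      exact absurd h2.symm h1
  count := by simp [zero]
  card_le := by simp
  size_le := by simp [zero, Trie.size]

theorem Represents.mono {F : Sparse R} {g : R[X]} {m' : ℕ} (h : F.Represents B g m)
    (hm : m ≤ m') : F.Represents B g m' :=
  ⟨h.lookup, h.count, h.card_le.trans hm, h.size_le.trans (by gcongr)⟩

variable [DecidableEq R]

/-- A cancelled term only has its entry cleared; the path leading to it stays in the trie. Hence the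
size is controlled by the number `m` of additions ever made and not by the number of terms. -/
theorem Represents.update {F : Sparse R} {g : R[X]} (h : F.Represents B g m) (hk : k ≤ B)
    {c : R} {t : Trie (ℕ × R)} {x : Option (ℕ × R)} {N : ℕ}
    (hx : x = if c = 0 then none else some (k, c))
    (ht : (∀ bs', t.lookup bs' = if bs' = k.bits then x else F.tree.lookup bs') ∧
      t.size ≤ F.tree.size + 2 * (k.bits.length + 1))
    (hN : N = (g.update k c).support.card) :
    (⟨t, N⟩ : Sparse R).Represents B (g.update k c) (m + 1) where
  lookup bs v := by
    obtain ⟨i, a⟩ := v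
    rw [ht.1]
    by_cases hbs : bs = k.bits
    · subst hbs
      simp only [if_pos, hx, bits_injective.eq_iff, coeff_update_apply]
      split_ifs with h0 h1 h1
      · subst h0 h1
        simpa using fun h => Ne.symm h
      · simpa using fun h => absurd h.symm h1
      · subst h1
        simp only [Option.some.injEq, Prod.mk.injEq, true_and]
        exact ⟨fun e => e ▸ ⟨h0, rfl⟩, fun e => e.2⟩
      · simp [Ne.symm h1]
    · rw [if_neg hbs, h.lookup]
      refine and_congr_right fun e => ?_
      have : i ≠ k := fun e' => hbs (e'.symm ▸ e)
      simp [coeff_update_apply, this]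
  count := hN
  card_le := by
    rw [support_update]
    split_ifs
    · exact (Finset.card_erase_le).trans (h.card_le.trans (Nat.le_succ m))
    · exact (Finset.card_insert_le _ _).trans (Nat.add_le_add_right h.card_le 1)
  size_le := by
    have h1 := ht.2
    have h2 := h.size_le
    have h3 := length_bits_lt_opCost hk
    change t.size ≤ _
    rw [mul_add, mul_one]
    omega

theorem plusTerm_meets {F : Sparse R} {g : R[X]} (h : F.Represents B g m) (hk : k ≤ B)
    (hm : m < B) (a : R) :
    (F.plusTerm k a).Meets Q (fun F' => F'.Represents B (g + monomial k a) (m + 1)) 2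
      (3 * opCost B) 0 := by
  have hW := length_bits_lt_opCost hk
  have hc : F.count ≤ B := by
    have := h.card_le
    rw [h.count]
    omega
  rw [add_monomial_eq_update]
  refine ((Trie.get_meets F.tree k.bits).bind (r' := 2) (b' := 2 * opCost B) (q' := 0) ?_).bound
    (by simp) (by omega) (by simp)
  rintro _ rfl
  rcases hl : F.tree.lookup k.bits with _ | ⟨i, b⟩
  · have hg : g.coeff k = 0 := by
      by_contra hg
      have := (h.lookup k.bits (k, g.coeff k)).2 ⟨rfl, hg, rfl⟩
      simp [hl] at this
    refine ((ringEq_meets a 0).bind (r' := 0) (b' := 2 * opCost B) (q' := 0) ?_).bound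
      (by simp) (by omega) (by simp)
    rintro _ rfl
    simp only [hg, zero_add]
    by_cases ha : a = 0
    · simp only [ha, decide_true, if_true]
      refine .pure ?_ _ _ _
      rw [show g.update k 0 = g by
        ext i
        rw [coeff_update_apply]
        split_ifs with hi
        · rw [hi, hg]
        · rfl]
      exact h.mono (Nat.le_succ m)
    · simp only [ha, decide_false, Bool.false_eq_true, if_false]
      refine ((Trie.set_meets _ F.tree k.bits).bind (r' := 0) (b' := opCost B) (q' := 0)
        ?_).bound (by simp) (by omega) (by simp)
      intro t ht
      refine (natAdd_meets hc (by omega)).bind (r' := 0) (b' := 0) (q' := 0) ?_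
      rintro _ rfl
      refine .pure ?_ _ _ _
      refine h.update hk (c := a) (by simp [ha]) ht ?_
      rw [support_update, if_neg ha, Finset.card_insert_of_notMem (by simp [hg]), h.count]
  · obtain ⟨hi, hb, hg⟩ := (h.lookup _ _).1 hl
    obtain rfl : k = i := bits_injective hi
    simp only at hg hb
    refine ((ringAdd_meets b a).bind (r' := 1) (b' := 2 * opCost B) (q' := 0) ?_).bound
      (by simp) (by omega) (by simp)
    rintro _ rfl
    refine ((ringEq_meets (b + a) 0).bind (r' := 0) (b' := 2 * opCost B) (q' := 0) ?_).bound
      (by simp) (by omega) (by simp)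
    rintro _ rfl
    rw [hg]
    have hks : k ∈ g.support := by simp [hg, hb]
    by_cases ha : b + a = 0
    · simp only [ha, decide_true, if_true]
      refine ((Trie.set_meets _ F.tree k.bits).bind (r' := 0) (b' := opCost B) (q' := 0)
        ?_).bound (by simp) (by omega) (by simp)
      intro t ht
      refine (natSub_meets hc (by omega)).bind (r' := 0) (b' := 0) (q' := 0) ?_
      rintro _ rfl
      refine .pure ?_ _ _ _
      refine h.update hk (c := 0) (by simp) ht ?_
      rw [support_update, if_pos rfl, Finset.card_erase_of_mem hks, h.count]
    · simp only [ha, decide_false, Bool.false_eq_true, if_false]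
      refine ((Trie.set_meets _ F.tree k.bits).bind (r' := 0) (b' := 0) (q' := 0)
        ?_).bound (by simp) (by omega) (by simp)
      intro t ht
      refine .pure ?_ _ _ _
      refine h.update hk (c := b + a) (by simp [ha]) ht ?_
      rw [support_update, if_neg ha, Finset.insert_eq_of_mem hks, h.count]

theorem minusTerm_meets {F : Sparse R} {g : R[X]} (h : F.Represents B g m) (hk : k ≤ B)
    (hm : m < B) (a : R) :
    (F.minusTerm k a).Meets Q (fun F' => F'.Represents B (g - monomial k a) (m + 1)) 3
      (3 * opCost B) 0 := by
  refine ((ringNeg_meets a).bind (r' := 2) (b' := 3 * opCost B) (q' := 0) ?_).bound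
    (by simp) (by omega) (by simp)
  rintro _ rfl
  simpa [sub_eq_add_neg] using plusTerm_meets h hk hm (-a)

theorem ofList_meets {l : List (ℕ × R)} (hk : ∀ t ∈ l, t.1 ≤ B) (hm : l.length ≤ B) :
    (ofList l).Meets Q
      (fun F => F.Represents B (l.map fun t => monomial t.1 t.2).sum l.length)
      (l.length * 2) (l.length * (3 * opCost B + 1)) 0 := by
  refine (foldRun_meets (q := 0) (fun (pre : List (ℕ × R)) (F : Sparse R) => F.Represents B
    (pre.map fun t => monomial t.1 t.2).sum pre.length) represents_zero ?_).bound
    le_rfl le_rfl (by simp)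
  intro pre t suf F hl hF
  have : pre.length < B := by
    rw [hl] at hm
    simp at hm
    omega
  simpa using plusTerm_meets (Q := Q) hF (hk t (by simp [hl])) this t.2

theorem ofListMod_meets {l : List (ℕ × R)} {p : ℕ} (hk : ∀ t ∈ l, t.1 ≤ B)
    (hm : l.length ≤ B) (hp : p ≤ B) (hp0 : 0 < p) :
    (ofListMod p l).Meets Q
      (fun F => F.Represents B (l.map fun t => monomial (t.1 % p) t.2).sum l.length)
      (l.length * 2) (l.length * (4 * opCost B + 1)) 0 := by
  refine (foldRun_meets (q := 0) (fun (pre : List (ℕ × R)) (F : Sparse R) => F.Represents B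
    (pre.map fun t => monomial (t.1 % p) t.2).sum pre.length) represents_zero ?_).bound
    le_rfl le_rfl (by simp)
  intro pre t suf F hl hF
  have : pre.length < B := by
    rw [hl] at hm
    simp at hm
    omega
  refine ((natMod_meets (hk t (by simp [hl])) hp).bind (r' := 2) (b' := 3 * opCost B) (q' := 0)
    ?_).bound (by simp) (by omega) (by simp)
  rintro _ rfl
  simpa using plusTerm_meets (Q := Q) hF ((Nat.mod_lt t.1 hp0).le.trans hp) this t.2

omit [DecidableEq R] in
theorem Represents.mem_toList {F : Sparse R} {g : R[X]} (h : F.Represents B g m) {v : ℕ × R} :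
    v ∈ F.tree.toList ↔ v.2 ≠ 0 ∧ g.coeff v.1 = v.2 := by
  rw [Trie.mem_toList]
  simp [h.lookup]

omit [DecidableEq R] in
theorem Represents.nodup_toList {F : Sparse R} {g : R[X]} (h : F.Represents B g m) :
    (F.tree.toList.map Prod.fst).Nodup := by
  rw [List.nodup_map_iff_inj_on]
  · intro x hx y hy hxy
    have h1 := (h.mem_toList.1 hx).2
    have h2 := (h.mem_toList.1 hy).2
    ext
    · exact hxy
    · rw [← h1, ← h2, hxy]
  · refine Trie.nodup_toList fun bs bs' v h1 h2 => ?_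
    rw [((h.lookup _ _).1 h1).1, ((h.lookup _ _).1 h2).1]

omit [DecidableEq R] in
theorem Represents.length_toList {F : Sparse R} {g : R[X]} (h : F.Represents B g m) :
    F.tree.toList.length ≤ g.support.card := by
  classical
  rw [← List.length_map (f := Prod.fst), ← List.toFinset_card_of_nodup h.nodup_toList]
  refine Finset.card_le_card fun k hk => ?_
  obtain ⟨v, hv, rfl⟩ := List.mem_map.1 (List.mem_toFinset.1 hk)
  have := h.mem_toList.1 hv
  simpa [this.2] using this.1

end Sparse

/-! ### Class tables -/

/-- `C` tells for every residue class modulo `p` whether it contains exactly one exponent of a term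
of `g`, and which one. -/
def IsClassTable (p : ℕ) (g : R[X]) (C : Trie (Option (ℕ × R))) : Prop :=
  ∀ r t, C.lookup r.bits = some (some t) ↔
    t.1 % p = r ∧ t.2 ≠ 0 ∧ g.coeff t.1 = t.2 ∧ ∀ i, g.coeff i ≠ 0 → i % p = r → i = t.1

/-- What a class table has to contain for a residue class with the given terms. -/
def classEntry : List (ℕ × R) → Option (Option (ℕ × R))
  | [] => none
  | [t] => some (some t)
  | _ => some none

omit [CommRing R] in
theorem classEntry_eq_some_some {l : List (ℕ × R)} {t : ℕ × R} :
    classEntry l = some (some t) ↔ l = [t] := by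
  rcases l with _ | ⟨a, _ | ⟨b, l⟩⟩ <;> simp [classEntry]

/-- The loop keeps in each class the summary `classEntry` of the terms seen there so far. At the end
these are all terms of `g` in the class, and the list has the form `[t]` exactly when `t` is alone.
-/
theorem classTable_meets {p : ℕ} {F : Sparse R} {g : R[X]} (h : F.Represents B g m)
    (hk : ∀ i, g.coeff i ≠ 0 → i ≤ B) (hp : p ≤ B) (hp0 : 0 < p) :
    (classTable p F).Meets Q (IsClassTable p g) 0 (1 + 6 * opCost B * m) 0 := by
  refine ((Trie.entries_meets F.tree []).bind (r' := 0) (q' := 0) (b' := m * (4 * opCost B))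
    ?_).bound (by simp) (by have := h.size_le; nlinarith) (by simp)
  rintro _ rfl
  rw [List.append_nil]
  have hlen := h.length_toList.trans h.card_le
  have hW := one_le_opCost B
  refine (foldRun_meets (r := 0) (q := 0) (b := 3 * opCost B) (fun pre (C : Trie (Option (ℕ × R))) =>
    ∀ r : ℕ, C.lookup r.bits = classEntry (pre.filter fun t => t.1 % p = r))
    (by simp [classEntry]) ?_).mono ?_ (by simp)
    (Nat.mul_le_mul hlen (by omega)) (by simp)
  · intro pre t suf C hl hC
    have ht : t ∈ F.tree.toList := by simp [hl]
    have htB : t.1 ≤ B := hk _ (by have := h.mem_toList.1 ht; simpa [this.2] using this.1)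
    have hr : t.1 % p ≤ B := (Nat.mod_lt _ hp0).le.trans hp
    have hlt := length_bits_lt_opCost hr
    refine ((natMod_meets htB hp).bind (r' := 0) (b' := 2 * opCost B) (q' := 0) ?_).bound
      (by simp) (by omega) (by simp)
    rintro _ rfl
    refine ((Trie.get_meets C _).bind (r' := 0) (b' := opCost B) (q' := 0) ?_).bound
      (by simp) (by omega) (by simp)
    rintro _ rfl
    -- Both branches end in one `set` that touches only the class of `t`; it remains to check that
    -- the value written summarises that class after `t` has been appended.
    have step {x : Option (Option (ℕ × R))}
        (hx : x = classEntry ((pre.filter fun s => s.1 % p = t.1 % p) ++ [t])) :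
        (C.set x (t.1 % p).bits).Meets Q (fun C' => ∀ r : ℕ, C'.lookup r.bits =
          classEntry ((pre ++ [t]).filter fun t => t.1 % p = r)) 0 (opCost B) 0 := by
      refine (Trie.set_meets x C _).mono ?_ le_rfl (by omega) le_rfl
      intro C' hC' r
      rw [hC'.1, List.filter_append]
      by_cases hrt : r = t.1 % p
      · subst hrt
        simp [hx]
      · have : ¬ t.1 % p = r := fun e => hrt e.symm
        simp [bits_injective.eq_iff, hrt, this, hC]
    have hCt := hC (t.1 % p)
    rcases hx : C.lookup (t.1 % p).bits with _ | y
    · refine step ?_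
      rw [hx] at hCt
      rcases hf : pre.filter fun s => s.1 % p = t.1 % p with _ | ⟨a, _ | ⟨b, l⟩⟩
      · rw [hf]; simp [classEntry]
      · simp [hf, classEntry] at hCt
      · simp [hf, classEntry] at hCt
    · refine step ?_
      rw [hx] at hCt
      rcases hf : pre.filter fun s => s.1 % p = t.1 % p with _ | ⟨a, _ | ⟨b, l⟩⟩
      · simp [hf, classEntry] at hCt
      · rw [hf]; simp [classEntry]
      · rw [hf]; simp [classEntry]
  · intro C hC r t
    rw [hC, classEntry_eq_some_some]
    have hmem (v : ℕ × R) : v ∈ (F.tree.toList.filter fun t => t.1 % p = r) ↔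
        (v.2 ≠ 0 ∧ g.coeff v.1 = v.2) ∧ v.1 % p = r := by
      simp [h.mem_toList]
    constructor
    · intro he
      have ht := (hmem t).1 (by simp [he])
      refine ⟨ht.2, ht.1.1, ht.1.2, fun i hi hir => ?_⟩
      have := (hmem (i, g.coeff i)).2 ⟨⟨hi, rfl⟩, hir⟩
      rw [he, List.mem_singleton] at this
      rw [← this]
    · rintro ⟨h1, h2, h3, h4⟩
      have hnd : (F.tree.toList.filter fun t => t.1 % p = r).Nodup :=
        (List.Nodup.of_map _ h.nodup_toList).filter _
      refine List.perm_singleton.1 ((List.perm_ext_iff_of_nodup hnd (List.nodup_singleton t)).2 ?_)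
      intro v
      rw [hmem, List.mem_singleton]
      constructor
      · rintro ⟨⟨h5, h6⟩, h7⟩
        have h8 := h4 v.1 (by rwa [h6]) h7
        ext
        · exact h8
        · rw [← h6, h8, h3]
      · rintro rfl
        exact ⟨⟨h2, h3⟩, h1⟩

variable [DecidableEq R]

theorem singleTerm_meets {p r : ℕ} {g : R[X]} {C : Trie (Option (ℕ × R))}
    (h : IsClassTable p g C) (hr : r ≤ B) (a : R) :
    (singleTerm C r a).Meets Q (fun o => ∀ γ, o = some γ ↔ γ % p = r ∧ a ≠ 0 ∧ g.coeff γ = a ∧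
      ∀ i, g.coeff i ≠ 0 → i % p = r → i = γ) 1 (opCost B) 0 := by
  refine ((Trie.get_meets C r.bits).bind (r' := 1) (b' := 0) (q' := 0) ?_).bound
      (by simp) (length_bits_lt_opCost hr) (by simp)
  rintro _ rfl
  have none_case (hn : ∀ t, C.lookup r.bits ≠ some (some t)) :
      (Run.pure (none : Option ℕ)).Meets Q (fun o => ∀ γ, o = some γ ↔ γ % p = r ∧ a ≠ 0 ∧
        g.coeff γ = a ∧ ∀ i, g.coeff i ≠ 0 → i % p = r → i = γ) 1 0 0 := by
    refine .pure (fun γ => ?_) _ _ _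
    have := mt (h r (γ, a)).2 (hn _)
    simpa using this
  rcases hl : C.lookup r.bits with _ | _ | ⟨γ, b⟩
  · exact none_case (by simp [hl])
  · exact none_case (by simp [hl])
  · refine (ringEq_meets a b).bind (r' := 0) (b' := 0) (q' := 0) ?_
    rintro _ rfl
    obtain ⟨h1, h2, h3, h4⟩ := (h _ _).1 hl
    simp only at h1 h2 h3 h4
    refine .pure (fun γ' => ?_) _ _ _
    by_cases hab : a = b
    · subst hab
      simp only [decide_true, if_true, Option.some.injEq]
      constructor
      · rintro rfl
        exact ⟨h1, h2, h3, h4⟩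
      · rintro ⟨h5, h6, h7, h8⟩
        exact h8 _ (by rwa [h3]) h1
    -- The only exponent of the class carries the coefficient `b ≠ a`, so no `γ` can qualify.
    · simp only [hab, decide_false, Bool.false_eq_true, if_false]
      simp only [reduceCtorEq, false_iff]
      rintro ⟨h5, h6, h7, h8⟩
      obtain rfl := h8 γ (by rwa [h3]) h1
      exact hab (by rw [← h7, h3])

end SparseInterp

namespace SparseInterp

/-! ### Collisions of exponents -/

section Collisions

variable {ι : Type*} [DecidableEq ι]

/-- The elements of `S` whose value under `φ` is taken by no other element of `S`. -/
def isolated (φ : ι → ℕ) (S : Finset ι) : Finset ι :=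
  S.filter fun s => ∀ s' ∈ S, s' ≠ s → φ s' ≠ φ s

/-- A union bound over the partners of `e`. The point `e` need not lie in `S`: the bound is applied
to candidates that may turn out not to be terms. -/
theorem card_filter_clash_le {I : Finset ℕ} {S : Finset ι} {φ : ℕ → ι → ℕ} {c : ℕ} {e : ι}
    (h : ∀ s ∈ S, s ≠ e → (I.filter fun d => φ d s = φ d e).card ≤ c) :
    (I.filter fun d => ∃ s ∈ S, s ≠ e ∧ φ d s = φ d e).card ≤ (S.erase e).card * c := by
  refine le_trans (Finset.card_le_card ?_) (Finset.card_biUnion_le_card_mul (S.erase e)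
    (fun s => I.filter fun d => φ d s = φ d e) c ?_)
  · intro d hd
    obtain ⟨hd, s, hs, hse, hφ⟩ := Finset.mem_filter.1 hd
    exact Finset.mem_biUnion.2 ⟨s, Finset.mem_erase.2 ⟨hse, hs⟩, Finset.mem_filter.2 ⟨hd, hφ⟩⟩
  · intro s hs
    exact h s (Finset.mem_of_mem_erase hs) (Finset.ne_of_mem_erase hs)

/-- A nonempty fibre of `φ` either is a single isolated element, counted in both summands on the
right, or has at least two elements. Either way it contributes at least two. -/
theorem two_mul_card_image_le (φ : ι → ℕ) (S : Finset ι) :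
    2 * (S.image φ).card ≤ S.card + (isolated φ S).card := by
  have h1 : (isolated φ S).card = ∑ r ∈ S.image φ, {s ∈ isolated φ S | φ s = r}.card :=
    Finset.card_eq_sum_card_fiberwise fun s hs =>
      Finset.mem_image_of_mem φ (Finset.mem_filter.1 hs).1
  have h2 : S.card = ∑ r ∈ S.image φ, {s ∈ S | φ s = r}.card :=
    Finset.card_eq_sum_card_fiberwise fun s hs => Finset.mem_image_of_mem φ hs
  rw [h1, h2, ← Finset.sum_add_distrib, mul_comm, ← smul_eq_mul, ← Finset.sum_const]
  refine Finset.sum_le_sum fun r hr => ?_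
  obtain ⟨s, hs, rfl⟩ := Finset.mem_image.1 hr
  have hmem : s ∈ {s' ∈ S | φ s' = φ s} := by simp [hs]
  have hpos := Finset.card_pos.2 ⟨s, hmem⟩
  by_cases hiso : s ∈ isolated φ S
  · have : 0 < {s' ∈ isolated φ S | φ s' = φ s}.card := Finset.card_pos.2 ⟨s, by simp [hiso]⟩
    omega
  · have : ∃ s' ∈ S, s' ≠ s ∧ φ s' = φ s := by
      simpa [isolated, hs] using hiso
    obtain ⟨s', hs', hne, hφ⟩ := this
    have : 1 < {s' ∈ S | φ s' = φ s}.card :=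
      Finset.one_lt_card.2 ⟨s', by simp [hs', hφ], s, hmem, hne⟩
    omega

/-- Double counting of pairs (base, element that collides there). If every base isolated fewer than
`3/4` of `S`, each would have more than `S.card / 4` colliding elements; but an element collides at
no more than `c * (T - 1)` bases, and there are more than four times as many bases. -/
theorem exists_many_isolated {I : Finset ℕ} {S : Finset ι} {φ : ℕ → ι → ℕ} {c T : ℕ}
    (h : ∀ s ∈ S, ∀ s' ∈ S, s ≠ s' → (I.filter fun d => φ d s = φ d s').card ≤ c)
    (hS : S.card ≤ T) (hI : 4 * (c * (T - 1)) + 1 ≤ I.card) :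
    ∃ d ∈ I, 3 * S.card ≤ 4 * (isolated (φ d) S).card := by
  by_contra! hcon
  let bad (d : ℕ) : ℕ := (S.filter fun e => ∃ s ∈ S, s ≠ e ∧ φ d s = φ d e).card
  have hsplit (d : ℕ) : (isolated (φ d) S).card + bad d = S.card := by
    rw [← Finset.card_filter_add_card_filter_not (s := S)
      (fun e => ∀ s' ∈ S, s' ≠ e → φ d s' ≠ φ d e)]
    simp [isolated, bad]
  -- The negated claim is a strict inequality of integers, so `4 * bad d` is at least `S.card + 1`.
  -- This extra one is what survives when `S` is empty.
  have hlow : I.card * (S.card + 1) ≤ 4 * ∑ d ∈ I, bad d := by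
    rw [Finset.mul_sum, ← smul_eq_mul, ← Finset.sum_const]
    refine Finset.sum_le_sum fun d hd => ?_
    have := hcon d hd
    have := hsplit d
    omega
  have hup : ∑ d ∈ I, bad d ≤ S.card * ((S.card - 1) * c) := by
    simp only [bad, Finset.card_filter]
    rw [Finset.sum_comm, ← smul_eq_mul, ← Finset.sum_const]
    refine Finset.sum_le_sum fun e he => ?_
    rw [← Finset.card_filter, ← Finset.card_erase_of_mem he]
    exact card_filter_clash_le fun s hs hse => h s hs e he hse
  have hc : (S.card - 1) * c ≤ c * (T - 1) := by
    rw [mul_comm]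
    exact Nat.mul_le_mul_left _ (Nat.sub_le_sub_right hS 1)
  have h1 : I.card * (S.card + 1) ≤ 4 * (S.card * (c * (T - 1))) :=
    hlow.trans (Nat.mul_le_mul_left _ (hup.trans (Nat.mul_le_mul_left _ hc)))
  have h2 : (4 * (c * (T - 1)) + 1) * (S.card + 1) ≤ I.card * (S.card + 1) :=
    Nat.mul_le_mul_right _ hI
  nlinarith [h1, h2, Nat.zero_le (c * (T - 1))]

end Collisions

/-! ### Kronecker substitutions -/

section Kronecker

variable {n p D : ℕ}

/-- The exponent to which the substitution with weights `w` maps the exponent vector `s`. -/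
def pairing (w : List ℕ) (s : Fin n →₀ ℕ) : ℕ := ∑ i : Fin n, s i * w.getD i 0

/-- The weights `dⁱ mod p`. -/
def weights (n d p : ℕ) : List ℕ := (List.range n).map fun i => d ^ i % p

theorem weights_getD (d : ℕ) (i : Fin n) : (weights n d p).getD i 0 = d ^ (i : ℕ) % p := by
  simp [weights, List.getD]

/-- The exponent modulo `p` to which the base `d` maps an exponent vector. -/
def residue (p d : ℕ) (s : Fin n →₀ ℕ) : ℕ := pairing (weights n d p) s % p

open Polynomial in
-- Equal residues at `d` say that `d` is a root of `P` over the field `ZMod p`. Since all entries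
-- are below `p`, distinct vectors remain distinct modulo `p`, so `P` is nonzero and has at most `n
-- - 1` roots.
theorem card_filter_residue_eq_le (hp : p.Prime) {N : ℕ} (hN : N ≤ p) {s s' : Fin n →₀ ℕ}
    (hs : ∀ i, s i < p) (hs' : ∀ i, s' i < p) (hne : s ≠ s') :
    ((Finset.Icc 1 N).filter fun d => residue p d s = residue p d s').card ≤ n - 1 := by
  have : Fact p.Prime := ⟨hp⟩
  let P : (ZMod p)[X] := ∑ i : Fin n, monomial (i : ℕ) ((s i : ZMod p) - (s' i : ZMod p))
  have hcoeff (i : Fin n) : P.coeff i = (s i : ZMod p) - (s' i : ZMod p) := by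
    simp only [P, finsetSum_coeff, coeff_monomial, Fin.val_inj]
    simp
  have hP : P ≠ 0 := by
    intro h0
    refine hne (Finsupp.ext fun i => ?_)
    have h1 := hcoeff i
    rw [h0, coeff_zero, eq_comm, sub_eq_zero, ZMod.natCast_eq_natCast_iff] at h1
    exact Nat.ModEq.eq_of_lt_of_lt h1 (hs i) (hs' i)
  have hdeg : P.natDegree ≤ n - 1 := by
    refine natDegree_sum_le_of_forall_le _ _ fun i _ => (natDegree_monomial_le _).trans ?_
    have := i.2
    omega
  rw [← Finset.card_image_of_injOn (f := fun d : ℕ => (d : ZMod p))]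
  · refine le_trans ?_ ((Multiset.toFinset_card_le _).trans ((card_roots' P).trans hdeg))
    refine Finset.card_le_card fun x hx => ?_
    obtain ⟨d, hd, rfl⟩ := Finset.mem_image.1 hx
    have h1 := (Finset.mem_filter.1 hd).2
    rw [Multiset.mem_toFinset, mem_roots hP, IsRoot.def]
    have h2 : ((pairing (weights n d p) s : ℕ) : ZMod p) = (pairing (weights n d p) s' : ℕ) :=
      (ZMod.natCast_eq_natCast_iff _ _ _).2 h1
    simp only [pairing, weights_getD, Nat.cast_sum, Nat.cast_mul, ZMod.natCast_mod,
      Nat.cast_pow] at h2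
    simp only [P, eval_finsetSum, eval_monomial, sub_mul, Finset.sum_sub_distrib, h2, sub_self]
  -- Distinct bases are distinct elements of `ZMod p`. As the base `p` itself may occur, the
  -- comparison is made after subtracting one, which puts both numbers below `p`.
  · intro a ha b hb hab
    have ha' := Finset.mem_Icc.1 (Finset.mem_filter.1 ha).1
    have hb' := Finset.mem_Icc.1 (Finset.mem_filter.1 hb).1
    have h1 : ((a - 1 : ℕ) : ZMod p) = ((b - 1 : ℕ) : ZMod p) := by
      rw [Nat.cast_sub ha'.1, Nat.cast_sub hb'.1]
      simpa using hab
    have := Nat.ModEq.eq_of_lt_of_lt ((ZMod.natCast_eq_natCast_iff _ _ _).1 h1)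
      (by omega) (by omega)
    omega

end Kronecker

/-! ### Images under substitutions -/

section Image

open Polynomial

variable {n : ℕ} {R : Type*} [CommRing R]

/-- The linear map that sends the monomial with exponent vector `s` to `x ^ φ s`. -/
noncomputable def image (φ : (Fin n →₀ ℕ) → ℕ) : MvPolynomial (Fin n) R →ₗ[R] R[X] :=
  (MvPolynomial.basisMonomials (Fin n) R).constr R fun s => monomial (φ s) 1

@[simp]
theorem image_monomial (φ : (Fin n →₀ ℕ) → ℕ) (s : Fin n →₀ ℕ) (a : R) :
    image φ (MvPolynomial.monomial s a) = monomial (φ s) a := by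
  have h := (MvPolynomial.basisMonomials (Fin n) R).constr_basis R
    (fun s => (monomial (φ s) 1 : R[X])) s
  rw [MvPolynomial.coe_basisMonomials] at h
  rw [show MvPolynomial.monomial s a = a • MvPolynomial.monomial s (1 : R) by
    simp [MvPolynomial.smul_monomial], map_smul, image, h, smul_monomial, smul_eq_mul, mul_one]

theorem image_eq_sum (φ : (Fin n →₀ ℕ) → ℕ) (g : MvPolynomial (Fin n) R) :
    image φ g = ∑ s ∈ g.support, monomial (φ s) (g.coeff s) := by
  conv_lhs => rw [← MvPolynomial.support_sum_monomial_coeff g]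
  rw [map_sum]
  simp only [image_monomial]

theorem coeff_image (φ : (Fin n →₀ ℕ) → ℕ) (g : MvPolynomial (Fin n) R) (k : ℕ) :
    (image φ g).coeff k = ∑ s ∈ g.support with φ s = k, g.coeff s := by
  rw [image_eq_sum, finsetSum_coeff, Finset.sum_filter]
  simp [coeff_monomial]

theorem powerSubst_eq_image (w : List ℕ) (g : MvPolynomial (Fin n) R) :
    powerSubst w g = image (pairing w) g := by
  rw [image_eq_sum, powerSubst, MvPolynomial.aeval_def, MvPolynomial.eval₂_eq']
  refine Finset.sum_congr rfl fun s _ => ?_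
  rw [← C_mul_X_pow_eq_monomial, pairing, ← Finset.prod_pow_eq_pow_sum]
  simp [← pow_mul, mul_comm]

theorem support_image_subset (φ : (Fin n →₀ ℕ) → ℕ) (g : MvPolynomial (Fin n) R) :
    (image φ g).support ⊆ g.support.image φ := by
  intro k hk
  rw [mem_support_iff, coeff_image] at hk
  obtain ⟨s, hs, -⟩ := Finset.exists_ne_zero_of_sum_ne_zero hk
  exact Finset.mem_image.2 ⟨s, (Finset.mem_filter.1 hs).1, (Finset.mem_filter.1 hs).2⟩

theorem card_support_image_le (φ : (Fin n →₀ ℕ) → ℕ) (g : MvPolynomial (Fin n) R) :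
    (image φ g).support.card ≤ g.support.card :=
  (Finset.card_le_card (support_image_subset φ g)).trans Finset.card_image_le

/-- Only `e` can contribute to the coefficient at `φ e`. If `e` is not in the support, both sides
vanish, so the statement also covers wrong candidates. -/
theorem coeff_image_of_forall_ne {φ : (Fin n →₀ ℕ) → ℕ} {g : MvPolynomial (Fin n) R}
    {e : Fin n →₀ ℕ} (h : ∀ s ∈ g.support, s ≠ e → φ s ≠ φ e) :
    (image φ g).coeff (φ e) = g.coeff e := by
  rw [coeff_image, Finset.sum_eq_single e]
  · intro s hs hse
    exact absurd (Finset.mem_filter.1 hs).2 (h s (Finset.mem_filter.1 hs).1 hse)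
  · intro he
    simpa using he

theorem card_isolated_le_card_support_image (φ : (Fin n →₀ ℕ) → ℕ)
    (g : MvPolynomial (Fin n) R) :
    (isolated φ g.support).card ≤ (image φ g).support.card := by
  refine Finset.card_le_card_of_injOn φ ?_ ?_
  · intro s hs
    obtain ⟨h1, h2⟩ := Finset.mem_filter.1 hs
    rw [Finset.mem_coe, mem_support_iff, coeff_image_of_forall_ne h2]
    exact MvPolynomial.mem_support_iff.1 h1
  · intro s hs s' hs' hss
    by_contra hne
    exact (Finset.mem_filter.1 hs').2 s (Finset.mem_filter.1 hs).1 hne hss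

theorem two_mul_card_support_image_le (φ : (Fin n →₀ ℕ) → ℕ) (g : MvPolynomial (Fin n) R) :
    2 * (image φ g).support.card ≤ g.support.card + (isolated φ g.support).card :=
  (Nat.mul_le_mul_left 2 (Finset.card_le_card (support_image_subset φ g))).trans
    (two_mul_card_image_le φ g.support)

/-- Only the coefficient at `k` changes, so the support shrinks precisely when that coefficient is
cancelled. The comparison of term counts in Step 4c is thereby a test of one coefficient. -/
theorem card_support_sub_monomial_lt_iff (P : R[X]) (k : ℕ) {a : R} (ha : a ≠ 0) :
    (P - monomial k a).support.card < P.support.card ↔ P.coeff k = a := by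
  classical
  rw [sub_eq_add_neg, ← map_neg, add_monomial_eq_update, support_update]
  split_ifs with h
  · have hk : P.coeff k = a := by linear_combination h
    have : k ∈ P.support := by simp [hk, ha]
    simpa [hk] using Finset.card_erase_lt_of_mem this
  · have : P.coeff k ≠ a := fun e => h (by simp [e])
    simp only [this, iff_false, not_lt]
    exact Finset.card_le_card (Finset.subset_insert k _)

/-- The reduction modulo `x ^ p - 1`. -/
noncomputable def reduceMod (p : ℕ) : R[X] →ₗ[R] R[X] :=
  (Polynomial.basisMonomials R).constr R fun k => monomial (k % p) 1

theorem reduceMod_monomial (p k : ℕ) (a : R) :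
    reduceMod p (monomial k a) = monomial (k % p) a := by
  have h := (Polynomial.basisMonomials R).constr_basis R
    (fun k => (monomial (k % p) 1 : R[X])) k
  rw [Polynomial.coe_basisMonomials] at h
  rw [show monomial k a = a • monomial k (1 : R) by simp [smul_monomial], map_smul, reduceMod, h,
    smul_monomial, smul_eq_mul, mul_one]

theorem reduceMod_image (p : ℕ) (φ : (Fin n →₀ ℕ) → ℕ) (g : MvPolynomial (Fin n) R) :
    reduceMod p (image φ g) = image (fun s => φ s % p) g := by
  simp [image_eq_sum, map_sum, reduceMod_monomial]

end Image

/-! ### Recognition of terms -/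

section Recognition

open Polynomial

variable {n p T d : ℕ} {R : Type*} [CommRing R] {g : MvPolynomial (Fin n) R}

/-- The bases at which subtracting the term with exponent vector `e` and coefficient `a` makes the
number of terms smaller. -/
noncomputable def goodBases (p last : ℕ) (g : MvPolynomial (Fin n) R) (e : Fin n →₀ ℕ) (a : R) :
    Finset ℕ :=
  open Classical in (Finset.Icc 1 last).filter fun d =>
    (image (residue p d) g - monomial (residue p d e) a).support.card <
      (image (residue p d) g).support.card

/-- Outside the set `bad` of bases where `e` meets another term of `g`, the test gives the right
answer. The threshold separates the two cases because `bad` is small in both. -/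
theorem delta₂_lt_card_goodBases_iff (hp : p.Prime) (hg : g.support.card ≤ T)
    (hlast : delta₁ n T + delta₂ n T + 1 ≤ p) (hgp : ∀ s ∈ g.support, ∀ i, s i < p)
    {e : Fin n →₀ ℕ} (he : ∀ i, e i < p) {a : R} (ha : a ≠ 0) :
    delta₂ n T + 1 ≤ (goodBases p (delta₁ n T + delta₂ n T + 1) g e a).card ↔
      g.coeff e = a := by
  set I := Finset.Icc 1 (delta₁ n T + delta₂ n T + 1) with hI
  have hcard : I.card = delta₁ n T + delta₂ n T + 1 := by simp [I]
  have hclash := card_filter_clash_le (I := I) (S := g.support) (φ := residue p) (c := n - 1)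
    (e := e) fun s hs hse => card_filter_residue_eq_le hp hlast (hgp s hs) he hse
  set bad := I.filter fun d => ∃ s ∈ g.support, s ≠ e ∧ residue p d s = residue p d e
  have hgood (d : ℕ) (hd : d ∈ I) (hd' : d ∉ bad) :
      d ∈ goodBases p (delta₁ n T + delta₂ n T + 1) g e a ↔ g.coeff e = a := by
    have : ∀ s ∈ g.support, s ≠ e → residue p d s ≠ residue p d e := by
      simpa [bad, hd] using hd'
    rw [goodBases, Finset.mem_filter, card_support_sub_monomial_lt_iff _ _ ha,
      coeff_image_of_forall_ne this]
    exact and_iff_right hd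
  constructor
  · intro h
    by_contra hne
    have hsub : goodBases p (delta₁ n T + delta₂ n T + 1) g e a ⊆ bad := by
      intro d hd
      by_contra hd'
      exact hne ((hgood d (Finset.mem_filter.1 hd).1 hd').1 hd)
    have h1 := Finset.card_le_card hsub
    -- A wrong candidate may have any of the at most `T` terms as partner, which gives `δ₂` for the
    -- number of false successes.
    have h2 : (g.support.erase e).card * (n - 1) ≤ delta₂ n T := by
      rw [delta₂, mul_comm]
      exact Nat.mul_le_mul_left _ ((Finset.card_erase_le).trans hg)
    omega
  · intro h
    have hsub : I \ bad ⊆ goodBases p (delta₁ n T + delta₂ n T + 1) g e a := by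
      intro d hd
      obtain ⟨hd, hd'⟩ := Finset.mem_sdiff.1 hd
      exact (hgood d hd hd').2 h
    have h1 := Finset.card_le_card hsub
    have h2 := Finset.le_card_sdiff bad I
    -- A genuine term is itself one of the terms of `g`, so only `T - 1` partners remain and at most
    -- `δ₁` of the `δ₁ + δ₂ + 1` bases are lost.
    have h3 : (g.support.erase e).card * (n - 1) ≤ delta₁ n T := by
      have : e ∈ g.support := by simpa [h] using ha
      rw [delta₁, mul_comm, Finset.card_erase_of_mem this]
      exact Nat.mul_le_mul_left _ (Nat.sub_le_sub_right hg 1)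
    omega

/-- A base with the largest number of terms modulo `x ^ p - 1` isolates at least half of the
terms. -/
theorem card_support_le_two_mul_card_isolated (hp : p.Prime) (hg : g.support.card ≤ T)
    (hN : numBases n T ≤ p) (hgp : ∀ s ∈ g.support, ∀ i, s i < p)
    (hd : ∀ d' ∈ Finset.Icc 1 (numBases n T),
      (image (residue p d') g).support.card ≤ (image (residue p d) g).support.card) :
    g.support.card ≤ 2 * (isolated (residue p d) g.support).card := by
  obtain ⟨d', hd', h⟩ := exists_many_isolated (I := Finset.Icc 1 (numBases n T))
    (S := g.support) (φ := residue p) (c := n - 1) (T := T)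
    (fun s hs s' hs' hne => card_filter_residue_eq_le hp hN (hgp s hs) (hgp s' hs') hne) hg
    (by simp [numBases, delta₁])
  -- With `α'` and `α` the term counts at `d'` and `d`: `3 #g ≤ 4 α' ≤ 4 α ≤ 2 (#g + #isolated)`,
  -- whence `#g ≤ 2 #isolated`.
  have h1 := card_isolated_le_card_support_image (residue p d') g
  have h2 := hd d' hd'
  have h3 := two_mul_card_support_image_le (residue p d) g
  omega

end Recognition

end SparseInterp

namespace SparseInterp

open Run Polynomial

/-! ### Exponent lists and exponent vectors -/

section Vectors

variable {n : ℕ}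

/-- The exponent vector given by a list. -/
noncomputable def expVec (n : ℕ) (e : List ℕ) : Fin n →₀ ℕ :=
  Finsupp.equivFunOnFinite.symm fun i : Fin n => e.getD i 0

theorem expVec_apply (e : List ℕ) (i : Fin n) : expVec n e i = e.getD i 0 := rfl

theorem expVec_ofFn (s : Fin n →₀ ℕ) : expVec n (List.ofFn s) = s := by
  ext i
  simp [expVec_apply, List.getD]

theorem expVec_injOn {e e' : List ℕ} (he : e.length = n) (he' : e'.length = n)
    (h : expVec n e = expVec n e') : e = e' := by
  refine List.ext_getElem (he.trans he'.symm) fun i h1 h2 => ?_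
  have := DFunLike.congr_fun h ⟨i, he ▸ h1⟩
  simpa [expVec_apply, List.getD, h1, h2] using this

theorem dot_eq_pairing {e w : List ℕ} (he : e.length = n) (hw : w.length = n) :
    dot e w = pairing w (expVec n e) := by
  induction n generalizing e w with
  | zero =>
    obtain rfl := List.length_eq_zero_iff.1 he
    simp [dot, pairing]
  | succ n ih =>
    obtain ⟨a, e, rfl⟩ := List.exists_cons_of_length_eq_add_one he
    obtain ⟨b, w, rfl⟩ := List.exists_cons_of_length_eq_add_one hw
    have := ih (e := e) (w := w) (by simpa using he) (by simpa using hw)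
    simp only [dot, pairing, expVec_apply] at this
    simp [dot, pairing, Fin.sum_univ_succ, expVec_apply, this]

theorem sum_expVec {e : List ℕ} (he : e.length = n) : ∑ i, expVec n e i = e.sum := by
  induction n generalizing e with
  | zero =>
    obtain rfl := List.length_eq_zero_iff.1 he
    simp
  | succ n ih =>
    obtain ⟨a, e, rfl⟩ := List.exists_cons_of_length_eq_add_one he
    have := ih (e := e) (by simpa using he)
    simp only [expVec_apply, List.getD_eq_getElem?_getD] at this
    simp [Fin.sum_univ_succ, expVec_apply, this]

theorem pairing_le {w : List ℕ} {b : ℕ} (hw : ∀ x ∈ w, x ≤ b) (s : Fin n →₀ ℕ) :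
    pairing w s ≤ (∑ i, s i) * b := by
  rw [pairing, Finset.sum_mul]
  refine Finset.sum_le_sum fun i _ => Nat.mul_le_mul_left _ ?_
  by_cases h : (i : ℕ) < w.length
  · rw [List.getD_eq_getElem _ _ h]
    exact hw _ (List.getElem_mem h)
  · rw [List.getD_eq_default _ _ (not_lt.1 h)]
    exact Nat.zero_le _

/-- The reason for the substitutions with one weight raised by `p`: the residue is unchanged, and
the shift of the exponent reads off the coordinate `s k`. -/
theorem pairing_modify {w : List ℕ} (hw : w.length = n) (k : Fin n) (p : ℕ) (s : Fin n →₀ ℕ) :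
    pairing (w.modify k (· + p)) s = pairing w s + p * s k := by
  have h (i : Fin n) : (w.modify k (· + p)).getD i 0 =
      w.getD i 0 + if i = k then p else 0 := by
    have hi : (i : ℕ) < w.length := hw ▸ i.2
    rw [List.getD_eq_getElem _ _ (by simpa using hi), List.getD_eq_getElem _ _ hi,
      List.getElem_modify]
    simp only [Fin.ext_iff, eq_comm (a := (k : ℕ))]
    split_ifs <;> rfl
  simp only [pairing, h, mul_add, Finset.sum_add_distrib]
  simp [mul_comm]

theorem length_weights (n d p : ℕ) : (weights n d p).length = n := by simp [weights]

theorem lt_of_mem_weights {n d p x : ℕ} (hp : 0 < p) (hx : x ∈ weights n d p) : x < p := by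
  obtain ⟨i, -, rfl⟩ := List.mem_map.1 hx
  exact Nat.mod_lt _ hp

theorem le_of_mem_modify {w : List ℕ} {p k x : ℕ} (hw : ∀ y ∈ w, y < p)
    (hx : x ∈ w.modify k (· + p)) : x ≤ 2 * p := by
  obtain ⟨i, hi, rfl⟩ := List.mem_iff_getElem.1 hx
  have hi' : i < w.length := by simpa using hi
  have := hw _ (List.getElem_mem hi')
  rw [List.getElem_modify]
  split_ifs <;> omega

end Vectors

/-! ### Sizes of the integers that occur -/

/-- The integers occurring in the algorithm are bounded by `B`. -/
structure Sizes (n T D p B : ℕ) : Prop where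
  n_pos : 1 ≤ n
  prime : p.Prime
  D_pos : 1 ≤ D
  D_le : D ≤ p
  nT : 8 * (n * (T + 1)) ≤ B
  pp : p * p ≤ B
  nDp : n * (2 * (D * p)) ≤ B

namespace Sizes

variable {n T D p B : ℕ}

theorem p_pos (h : Sizes n T D p B) : 0 < p := h.prime.pos

theorem two_p (h : Sizes n T D p B) : 2 * p ≤ B :=
  (Nat.mul_le_mul_right p h.prime.two_le).trans h.pp

theorem p_le (h : Sizes n T D p B) : p ≤ B := by
  have := h.two_p
  omega

theorem T_le (h : Sizes n T D p B) : 8 * (T + 1) ≤ B :=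
  (Nat.mul_le_mul_left 8 (Nat.le_mul_of_pos_left _ h.n_pos)).trans h.nT

theorem n_le (h : Sizes n T D p B) : 8 * n ≤ B :=
  (Nat.mul_le_mul_left 8 (Nat.le_mul_of_pos_right _ (Nat.succ_pos T))).trans h.nT

theorem Dp_le (h : Sizes n T D p B) : 2 * (D * p) ≤ B :=
  (Nat.le_mul_of_pos_left _ h.n_pos).trans h.nDp

theorem nD_le (h : Sizes n T D p B) : n * (2 * D) ≤ B :=
  le_trans (Nat.mul_le_mul_left n (Nat.mul_le_mul_left 2 (Nat.le_mul_of_pos_right D h.p_pos)))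
    h.nDp

theorem delta₁_le (h : Sizes n T D p B) : 8 * delta₁ n T ≤ B := by
  refine le_trans (Nat.mul_le_mul_left 8 (Nat.mul_le_mul (Nat.sub_le n 1) ?_)) h.nT
  omega

theorem delta₂_le (h : Sizes n T D p B) : 8 * delta₂ n T ≤ B := by
  refine le_trans (Nat.mul_le_mul_left 8 (Nat.mul_le_mul (Nat.sub_le n 1) ?_)) h.nT
  omega

theorem numBases_le (h : Sizes n T D p B) : numBases n T ≤ B := by
  have h1 := h.delta₁_le
  have h2 := h.delta₂_le
  have h3 := h.T_le
  unfold numBases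
  omega

theorem of_le (h : Sizes n T D p B) {T' : ℕ} (hT : T' ≤ T) : Sizes n T' D p B :=
  { h with nT := le_trans (by gcongr) h.nT }

/-- Weights are below `p`, and below `2 * p` after one has been raised. This is the source of the
degree bound `2 * (D * p)` given to the interpolation. -/
theorem pairing_lt (h : Sizes n T D p B) {w : List ℕ} (hw : ∀ x ∈ w, x ≤ 2 * p)
    {s : Fin n →₀ ℕ} (hs : ∑ i, s i < D) : pairing w s < 2 * (D * p) := by
  refine (pairing_le hw s).trans_lt ?_
  have := h.p_pos
  calc (∑ i, s i) * (2 * p) < D * (2 * p) := Nat.mul_lt_mul_of_pos_right hs (by omega)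
    _ = _ := by ring

theorem apply_lt (h : Sizes n T D p B) {s : Fin n →₀ ℕ} (hs : ∑ i, s i < D) (i : Fin n) :
    s i < p :=
  ((Finset.single_le_sum (f := s) (fun _ _ => Nat.zero_le _) (Finset.mem_univ i)).trans_lt
    hs).trans_le h.D_le

theorem le_of_coeff_image_ne_zero (h : Sizes n T D p B) {R : Type*} [CommRing R] {w : List ℕ}
    (hw : ∀ x ∈ w, x ≤ 2 * p) {g : MvPolynomial (Fin n) R}
    (hg : ∀ s ∈ g.support, ∑ i, s i < D) {k : ℕ} (hk : (image (pairing w) g).coeff k ≠ 0) :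
    k < 2 * (D * p) := by
  obtain ⟨s, hs, rfl⟩ := Finset.mem_image.1 (support_image_subset _ _ (mem_support_iff.2 hk))
  exact h.pairing_lt hw (hg s hs)

end Sizes

/-! ### Computing the parameters and the weights -/

variable {Q : Query → Prop} {n T D p B : ℕ}

theorem bounds_meets (h : Sizes n T D p B) :
    (bounds n T).Meets Q (· = (delta₂ n T + 1, delta₁ n T + delta₂ n T + 1, numBases n T))
      0 (9 * opCost B) 0 := by
  have h1 := h.delta₁_le
  have h2 := h.delta₂_le
  have h3 := h.T_le
  have h4 := h.n_le
  have h5 := h.n_pos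
  refine ((natSub_meets (B := B) (a := n) (b := 1) (by omega) (by omega)).bind (r' := 0) (q' := 0)
    (b' := 8 * opCost B) ?_).bound (by simp) (by omega) (by simp)
  rintro _ rfl
  refine ((natSub_meets (B := B) (a := T) (b := 1) (by omega) (by omega)).bind (r' := 0) (q' := 0)
    (b' := 7 * opCost B) ?_).bound (by simp) (by omega) (by simp)
  rintro _ rfl
  refine ((natMul_meets (B := B) (a := n - 1) (b := T - 1) (by omega) (by omega)).bind (r' := 0)
    (q' := 0) (b' := 6 * opCost B) ?_).bound (by simp) (by omega) (by simp)
  rintro _ rfl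
  rw [← delta₁]
  refine ((natMul_meets (B := B) (a := n - 1) (b := T) (by omega) (by omega)).bind (r' := 0)
    (q' := 0) (b' := 5 * opCost B) ?_).bound (by simp) (by omega) (by simp)
  rintro _ rfl
  rw [← delta₂]
  refine ((natMul_meets (B := B) (a := 4) (b := delta₁ n T) (by omega) (by omega)).bind (r' := 0)
    (q' := 0) (b' := 4 * opCost B) ?_).bound (by simp) (by omega) (by simp)
  rintro _ rfl
  refine ((natAdd_meets (B := B) (a := 4 * delta₁ n T) (b := 1) (by omega) (by omega)).bind
    (r' := 0) (q' := 0) (b' := 3 * opCost B) ?_).bound (by simp) (by omega) (by simp)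
  rintro _ rfl
  refine ((natAdd_meets (B := B) (a := delta₂ n T) (b := 1) (by omega) (by omega)).bind
    (r' := 0) (q' := 0) (b' := 2 * opCost B) ?_).bound (by simp) (by omega) (by simp)
  rintro _ rfl
  refine ((natAdd_meets (B := B) (a := delta₁ n T) (b := delta₂ n T + 1) (by omega)
    (by omega)).bind (r' := 0) (q' := 0) (b' := opCost B) ?_).bound (by simp) (by omega) (by simp)
  rintro _ rfl
  refine (natLe_meets (B := B) (a := 4 * delta₁ n T + 1) (b := delta₁ n T + (delta₂ n T + 1))
    (by omega) (by omega)).bind (r' := 0) (q' := 0) (b' := 0) ?_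
  rintro _ rfl
  refine .pure ?_ _ _ _
  simp only [numBases, Prod.mk.injEq, decide_eq_true_eq, true_and]
  refine ⟨by omega, ?_⟩
  split_ifs <;> omega

theorem kroneckerWeights_meets (h : Sizes n T D p B) {d : ℕ} (hd : d ≤ p) :
    (kroneckerWeights n d p).Meets Q (· = weights n d p) 0 ((2 * n + 1) * opCost B) 0 := by
  have hp := h.p_le
  have hp0 := h.p_pos
  -- The loop reduces after each multiplication, so no intermediate product exceeds `p * p`; this
  -- accounts for that summand of `B`. The start `i` is generalised for the induction.
  have H (m i : ℕ) : (weightsFrom d p m (d ^ i % p)).Meets Q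
      (· = (List.range' i m).map fun i => d ^ i % p) 0 (2 * m * opCost B) 0 := by
    induction m generalizing i with
    | zero => exact (Meets.pure_eq _).bound le_rfl (Nat.zero_le _) le_rfl
    | succ m ih =>
      have hv := Nat.mod_lt (d ^ i) hp0
      refine ((natMul_meets (B := B) (hv.le.trans hp) (hd.trans hp)).bind (r' := 0) (q' := 0)
        (b' := 2 * m * opCost B + opCost B) ?_).bound (by simp) (by ring_nf; rfl) (by simp)
      rintro _ rfl
      refine ((natMod_meets (B := B) ((Nat.mul_le_mul hv.le hd).trans h.pp) hp).bind
        (r' := 0) (q' := 0) (b' := 2 * m * opCost B) ?_).bound (by simp) (by omega) (by simp)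
      rintro _ rfl
      have e : d ^ i % p * d % p = d ^ (i + 1) % p := by rw [pow_succ]; simp [Nat.mul_mod]
      rw [e]
      refine (ih (i + 1)).bind (r' := 0) (q' := 0) (b' := 0) ?_
      rintro _ rfl
      exact .pure (by simp [List.range'_succ]) _ _ _
  refine ((natMod_meets (B := B) (a := 1) (b := p) (by omega) hp).bind (r' := 0) (q' := 0)
    (b' := 2 * n * opCost B) ?_).bound (by simp) (by ring_nf; rfl) (by simp)
  rintro _ rfl
  simpa [weights, List.range_eq_range'] using H n 0

theorem bump_meets {w : List ℕ} (hw : ∀ x ∈ w, x ≤ B) (hp : p ≤ B) (k : ℕ) :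
    (bump p k w).Meets Q (· = w.modify k (· + p)) 0 (w.length + opCost B) 0 := by
  induction w generalizing k with
  | nil =>
    rw [bump]
    exact .pure (by simp) _ _ _
  | cons v w ih =>
    cases k with
    | zero =>
      refine ((natAdd_meets (hw v (by simp)) hp).bind (r' := 0) (q' := 0) (b' := 0) ?_).bound
        (by simp) (by omega) (by simp)
      rintro _ rfl
      exact .pure (by simp) _ _ _
    | succ k =>
      refine ((ih (fun x hx => hw x (by simp [hx])) k).bind (r' := 0) (q' := 0)
        (b' := 0) ?_).tick.bound (by simp) (by simp only [List.length_cons]; omega) (by simp)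
      rintro _ rfl
      exact .pure (by simp) _ _ _

/-! ### Lists of terms and subtraction of their images -/

section Lists

variable {R : Type*} [CommRing R]

theorem ListsTerms.coeff_of_mem {l : List (ℕ × R)} {g : R[X]} (h : ListsTerms l g) {t : ℕ × R}
    (ht : t ∈ l) : g.coeff t.1 = t.2 := by
  obtain ⟨h1, -, rfl⟩ := h
  induction l with
  | nil => simp at ht
  | cons a l ih =>
    simp only [List.map_cons, List.nodup_cons, List.mem_map, not_exists, not_and] at h1
    simp only [List.map_cons, List.sum_cons, coeff_add, coeff_monomial]
    rcases List.mem_cons.1 ht with rfl | ht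
    · have : ((l.map fun t : ℕ × R => monomial t.1 t.2).sum).coeff t.1 = 0 := by
        rw [← lcoeff_apply, map_list_sum, List.sum_eq_zero]
        intro x hx
        simp only [List.map_map, List.mem_map, Function.comp_apply, lcoeff_apply,
          coeff_monomial] at hx
        obtain ⟨u, hu, rfl⟩ := hx
        rw [if_neg (h1.1 u hu)]
      rw [if_pos rfl, this, add_zero]
    · rw [if_neg (fun e => h1.1 t ht e.symm), zero_add, ih ht h1.2]

theorem ListsTerms.length_le {l : List (ℕ × R)} {g : R[X]} (h : ListsTerms l g) :
    l.length ≤ g.support.card := by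
  classical
  rw [← List.length_map (f := Prod.fst), ← List.toFinset_card_of_nodup h.1]
  refine Finset.card_le_card fun k hk => ?_
  obtain ⟨v, hv, rfl⟩ := List.mem_map.1 (List.mem_toFinset.1 hk)
  simpa [h.coeff_of_mem hv] using h.2.1 v hv

/-- The multivariate polynomial with a given list of terms. -/
noncomputable def sumTerms (n : ℕ) (l : List (Term R)) : MvPolynomial (Fin n) R :=
  (l.map fun u => MvPolynomial.monomial (expVec n u.exps) u.coeff).sum

/-- A term in `n` variables of degree less than `D`. -/
def IsTerm (n D : ℕ) (u : Term R) : Prop :=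
  u.exps.length = n ∧ u.exps.sum < D

variable [DecidableEq R] {w : List ℕ} {F : Sparse R} {P : R[X]} {m : ℕ}

omit [CommRing R] [DecidableEq R] in
theorem dotRun_meets_pairing (h : Sizes n T D p B) (hw : w.length = n)
    (hwp : ∀ x ∈ w, x ≤ 2 * p) {u : Term R} (hu : IsTerm n D u) :
    (dotRun u.exps w).Meets Q (· = pairing w (expVec n u.exps)) 0 (2 * n * opCost B + 1) 0 := by
  have h1 := dot_eq_pairing hu.1 hw
  have h2 := h.pairing_lt hwp (s := expVec n u.exps) (by rw [sum_expVec hu.1]; exact hu.2)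
  have h3 := h.Dp_le
  rw [← h1, ← hu.1]
  refine dotRun_meets (fun x hx => ?_) (fun x hx => (hwp x hx).trans h.two_p) (by omega)
  have h4 := List.single_le_sum (fun _ _ => Nat.zero_le _) x hx
  have h5 := h.D_le
  have h6 := h.p_le
  have h7 := hu.2
  omega

theorem minusImage_meets (h : Sizes n T D p B) (hw : w.length = n) (hwp : ∀ x ∈ w, x ≤ 2 * p)
    {u : Term R} (hu : IsTerm n D u) (hF : F.Represents B P m) (hm : m < B) :
    (minusImage w F u).Meets Q (fun F' => F'.Represents B
      (P - image (pairing w) (MvPolynomial.monomial (expVec n u.exps) u.coeff)) (m + 1)) 3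
      (6 * n * opCost B) 0 := by
  have hW := Nat.mul_le_mul h.n_pos (one_le_opCost B)
  have hW' := Nat.mul_le_mul_right (opCost B) h.n_pos
  refine ((dotRun_meets_pairing h hw hwp hu).bind (r' := 3) (q' := 0) (b' := 3 * opCost B)
    ?_).bound (by simp) (by nlinarith) (by simp)
  rintro _ rfl
  rw [image_monomial]
  refine Sparse.minusTerm_meets hF ?_ hm _
  have := h.pairing_lt hwp (s := expVec n u.exps) (by rw [sum_expVec hu.1]; exact hu.2)
  have := h.Dp_le
  omega

theorem minusImageMod_meets (h : Sizes n T D p B) (hw : w.length = n) (hwp : ∀ x ∈ w, x ≤ 2 * p)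
    {u : Term R} (hu : IsTerm n D u) (hF : F.Represents B P m) (hm : m < B) :
    (minusImageMod p w F u).Meets Q (fun F' => F'.Represents B
      (P - image (fun s => pairing w s % p)
        (MvPolynomial.monomial (expVec n u.exps) u.coeff)) (m + 1)) 3
      (7 * n * opCost B) 0 := by
  have hW := Nat.mul_le_mul h.n_pos (one_le_opCost B)
  have hW' := Nat.mul_le_mul_right (opCost B) h.n_pos
  refine ((dotRun_meets_pairing h hw hwp hu).bind (r' := 3) (q' := 0) (b' := 4 * opCost B)
    ?_).bound (by simp) (by nlinarith) (by simp)
  rintro _ rfl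
  have := h.pairing_lt hwp (s := expVec n u.exps) (by rw [sum_expVec hu.1]; exact hu.2)
  have := h.Dp_le
  refine ((natMod_meets (B := B) (by omega) h.p_le).bind (r' := 3) (q' := 0)
    (b' := 3 * opCost B) ?_).bound (by simp) (by omega) (by simp)
  rintro _ rfl
  rw [image_monomial]
  exact Sparse.minusTerm_meets hF ((Nat.mod_lt _ h.p_pos).le.trans h.p_le) hm _

omit [DecidableEq R] in
-- Common frame for subtracting a list of terms with or without reduction modulo `x ^ p - 1`. The
-- count of additions grows by the length of the list even though terms may cancel.
theorem fold_minus_meets {φ : (Fin n →₀ ℕ) → ℕ} {step : Sparse R → Term R → Run (Sparse R)}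
    {l : List (Term R)} {r b : ℕ}
    (hstep : ∀ u ∈ l, ∀ (G : Sparse R) (P' : R[X]) (m' : ℕ), G.Represents B P' m' → m' < B →
      (step G u).Meets Q (fun G' => G'.Represents B
        (P' - image φ (MvPolynomial.monomial (expVec n u.exps) u.coeff)) (m' + 1)) r b 0)
    (hF : F.Represents B P m) (hm : m + l.length ≤ B) :
    (foldRun step F l).Meets Q
      (fun F' => F'.Represents B (P - image φ (sumTerms n l)) (m + l.length))
      (l.length * r) (l.length * (b + 1)) 0 := by
  refine (foldRun_meets (q := 0) (fun (pre : List (Term R)) (G : Sparse R) =>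
    G.Represents B (P - image φ (sumTerms n pre)) (m + pre.length))
    (by simpa [sumTerms] using hF) ?_).bound le_rfl le_rfl (by simp)
  intro pre u suf G hl hG
  have hlt : m + pre.length < B := by
    rw [hl] at hm
    simp at hm
    omega
  refine (hstep u (by simp [hl]) G _ _ hG hlt).mono ?_ le_rfl le_rfl le_rfl
  intro G' hG'
  simpa [sumTerms, sub_sub, add_assoc] using hG'

theorem fold_minusImage_meets (h : Sizes n T D p B) (hw : w.length = n)
    (hwp : ∀ x ∈ w, x ≤ 2 * p) {l : List (Term R)} (hl : ∀ u ∈ l, IsTerm n D u)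
    (hF : F.Represents B P m) (hm : m + l.length ≤ B) :
    (foldRun (minusImage w) F l).Meets Q
      (fun F' => F'.Represents B (P - image (pairing w) (sumTerms n l)) (m + l.length))
      (l.length * 3) (l.length * (6 * n * opCost B + 1)) 0 :=
  fold_minus_meets (fun u hu _ _ _ hG hm' => minusImage_meets h hw hwp (hl u hu) hG hm') hF hm

theorem fold_minusImageMod_meets (h : Sizes n T D p B) (hw : w.length = n)
    (hwp : ∀ x ∈ w, x ≤ 2 * p) {l : List (Term R)} (hl : ∀ u ∈ l, IsTerm n D u)
    (hF : F.Represents B P m) (hm : m + l.length ≤ B) :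
    (foldRun (minusImageMod p w) F l).Meets Q
      (fun F' => F'.Represents B (P - image (fun s => pairing w s % p) (sumTerms n l))
        (m + l.length))
      (l.length * 3) (l.length * (7 * n * opCost B + 1)) 0 :=
  fold_minus_meets (fun u hu _ _ _ hG hm' => minusImageMod_meets h hw hwp (hl u hu) hG hm') hF hm

end Lists

end SparseInterp

namespace SparseInterp

open Run Polynomial

variable {Q : Query → Prop} {n T D p B : ℕ} {R : Type*} [CommRing R]

/-- The entries of `l` are known only through their relation to a list `l'` of mathematical objects;
the rule carries this relation over to the results. -/
theorem mapRun_meets_forall₂ {α β γ : Type*} {g : α → Run β} {l : List α} {l' : List γ}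
    {S : γ → α → Prop} {P : γ → β → Prop} {r b q : ℕ} (hl : List.Forall₂ S l' l)
    (h : ∀ x a, S x a → (g a).Meets Q (P x) r b q) :
    (mapRun g l).Meets Q (List.Forall₂ P l')
      (l.length * r) (l.length * (b + 1)) (l.length * q) := by
  induction hl with
  | nil => exact .pure .nil _ _ _
  | cons hxa _ ih =>
    refine ((h _ _ hxa).bind fun y hy => ih.bind fun ys hys =>
      Meets.pure (.cons hy hys) 0 0 0).tick.bound ?_ ?_ ?_ <;>
    · simp only [List.length_cons]
      ring_nf
      rfl

/-- Needed for exponent lists that have not yet passed the degree test. -/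
theorem dot_le {e w : List ℕ} {a b : ℕ} (he : ∀ x ∈ e, x ≤ a) (hw : ∀ y ∈ w, y ≤ b) :
    dot e w ≤ e.length * (a * b) := by
  induction e generalizing w with
  | nil => simp [dot]
  | cons x e ih =>
    cases w with
    | nil => simp [dot]
    | cons y w =>
      have h1 := ih (fun z hz => he z (by simp [hz])) (fun z hz => hw z (List.mem_cons_of_mem y hz))
      have h2 := Nat.mul_le_mul (he x (by simp)) (hw y (by simp))
      simp only [dot, List.zipWith_cons_cons, List.sum_cons, List.length_cons, add_mul,
        one_mul] at h1 ⊢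
      omega

/-! ### The interpolated polynomials -/

/-- `ask` returns the terms of the images of `f` under substitutions with weights at most `2 * p`,
and its calls satisfy `Q`. -/
def Answers (Q : Query → Prop) (p Δ τ : ℕ) (ask : List ℕ → ℕ → ℕ → List (ℕ × R))
    (f : MvPolynomial (Fin n) R) : Prop :=
  ∀ w : List ℕ, w.length = n → (∀ x ∈ w, x ≤ 2 * p) →
    ListsTerms (ask w Δ τ) (powerSubst w f) ∧ Q ⟨w, Δ, τ⟩

section Interpolated

variable {Δ τ : ℕ} {ask : List ℕ → ℕ → ℕ → List (ℕ × R)} {f : MvPolynomial (Fin n) R}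

theorem interpolate_meets (h : Sizes n T D p B) (hask : Answers Q p Δ τ ask f)
    (hf : ∀ s ∈ f.support, ∑ i, s i < D) (hfT : f.support.card ≤ T)
    {w : List ℕ} (hw : w.length = n) (hwp : ∀ x ∈ w, x ≤ 2 * p) :
    (interpolate ask w Δ τ).Meets Q (fun l => (∀ t ∈ l, t.1 ≤ B) ∧ l.length ≤ T ∧
      (l.map fun t => monomial t.1 t.2).sum = image (pairing w) f) 0 0 1 := by
  obtain ⟨h1, h2⟩ := hask w hw hwp
  refine ⟨⟨fun t ht => ?_, ?_, ?_⟩, le_rfl, le_rfl, le_rfl, ?_⟩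
  · have h3 := h1.coeff_of_mem ht
    rw [powerSubst_eq_image] at h3
    have h4 := h.le_of_coeff_image_ne_zero hwp hf (k := t.1) (by rw [h3]; exact h1.2.1 t ht)
    have := h.Dp_le
    omega
  · refine h1.length_le.trans (le_trans ?_ hfT)
    rw [powerSubst_eq_image]
    exact card_support_image_le _ _
  · rw [← powerSubst_eq_image]
    exact h1.2.2
  · simpa [interpolate] using h2

variable [DecidableEq R]

/-- `b` holds the images of `g` under the substitutions with base `b.d`. -/
structure IsBase (p B : ℕ) (g : MvPolynomial (Fin n) R) (m : ℕ) (b : Base R) : Prop where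
  weights : b.weights = weights n b.d p
  F : b.F.Represents B (image (pairing b.weights) g) m
  M : b.M.Represents B (image (residue p b.d) g) m

theorem initBase_meets (h : Sizes n T D p B) (hask : Answers Q p Δ τ ask f)
    (hf : ∀ s ∈ f.support, ∑ i, s i < D) (hfT : f.support.card ≤ T) {d : ℕ} (hd : d ≤ p) :
    (initBase ask n p Δ τ d).Meets Q (fun b => b.d = d ∧ IsBase p B f T b) (4 * T)
      ((2 * n + 1) * opCost B + 9 * (T * opCost B)) 1 := by
  have hW := one_le_opCost B
  have hTW := Nat.mul_le_mul_left T hW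
  refine ((kroneckerWeights_meets h hd).bind (r' := 4 * T) (q' := 1)
    (b' := 9 * (T * opCost B)) ?_).bound (by simp) le_rfl (by simp)
  rintro _ rfl
  have hwp : ∀ x ∈ weights n d p, x ≤ 2 * p := fun x hx => by
    have := lt_of_mem_weights h.p_pos hx
    omega
  refine ((interpolate_meets h hask hf hfT (length_weights n d p) hwp).bind (r' := 4 * T)
    (q' := 0) (b' := 9 * (T * opCost B)) ?_).bound (by simp) (by omega) (by simp)
  rintro l ⟨hl1, hl2, hl3⟩
  have hlB : l.length ≤ B := hl2.trans (by have := h.T_le; omega)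
  refine ((Sparse.ofList_meets hl1 hlB).bind (r' := l.length * 2) (q' := 0)
    (b' := l.length * (4 * opCost B + 1)) ?_).bound (by omega) ?_ (by simp)
  swap
  · have := Nat.mul_le_mul_right (7 * opCost B + 2) hl2
    nlinarith
  intro F hF
  refine (Sparse.ofListMod_meets hl1 hlB h.p_le h.p_pos).bind (r' := 0) (q' := 0) (b' := 0) ?_
  intro M hM
  refine .pure ⟨rfl, rfl, ?_, ?_⟩ _ _ _
  · rw [hl3] at hF
    exact hF.mono hl2
  -- Reducing the exponents of the listed terms is `reduceMod p` applied to their sum, hence yields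
  -- the image under `residue p d`.
  · have : (l.map fun t => monomial (t.1 % p) t.2).sum = image (residue p d) f := by
      have := congrArg (reduceMod p) hl3
      rw [reduceMod_image, map_list_sum, List.map_map] at this
      simp only [Function.comp_def, reduceMod_monomial] at this
      exact this
    rw [this] at hM
    exact hM.mono hl2

/-- The black box only gives `f`, so `f` is interpolated anew and the terms of `h` are subtracted
one at a time. This makes at most `T + hs.length ≤ 2 * T` additions of terms per polynomial. -/
theorem shifted_meets (h : Sizes n T D p B) (hask : Answers Q p Δ τ ask f)
    (hf : ∀ s ∈ f.support, ∑ i, s i < D) (hfT : f.support.card ≤ T) {w : List ℕ}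
    (hw : w.length = n) (hwp : ∀ x ∈ w, x < p) {hs : List (Term R)}
    (hhs : ∀ u ∈ hs, IsTerm n D u) (hsT : hs.length ≤ T) :
    (shifted ask n p Δ τ w hs).Meets Q (List.Forall₂
      (fun k G => G.Represents B (image (pairing (w.modify k (· + p))) (f - sumTerms n hs))
        (2 * T)) (List.range n)) (5 * (n * T)) (4 * (n * (n * opCost B)) +
          11 * (n * (n * (T * opCost B)))) n := by
  have hW := one_le_opCost B
  have hn := h.n_pos
  have hT := h.T_le
  have hnW := Nat.mul_le_mul_right (opCost B) hn
  have hnW' := Nat.mul_le_mul_left n hW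
  have hTnW := Nat.mul_le_mul_left n (Nat.mul_le_mul_left T hW)
  refine ((rangeRun_meets (B := B) n 0 (by have := h.n_le; omega) (by omega)).bind
    (r' := n * (5 * T)) (q' := n)
    (b' := n * (2 * (n * opCost B) + 11 * (n * (T * opCost B)) + 1)) ?_).bound
    (by ring_nf; rfl) ?_ (by simp)
  swap
  · have := Nat.mul_le_mul_left n hnW
    nlinarith
  rintro _ rfl
  rw [← List.range_eq_range']
  refine (mapRun_meets_forall₂ (S := Eq) (l' := List.range n) (r := 5 * T) (q := 1)
    (b := 2 * (n * opCost B) + 11 * (n * (T * opCost B))) (by simp [List.forall₂_same]) ?_).bound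
    (by simp) (by simp) (by simp)
  rintro k _ rfl
  refine ((bump_meets (B := B) (fun x hx => (hwp x hx).le.trans h.p_le) h.p_le k).bind
    (r' := 5 * T) (q' := 1) (b' := 11 * (n * (T * opCost B))) ?_).bound (by simp)
    (by rw [hw]; omega) (by simp)
  rintro _ rfl
  have hwl : (w.modify k (· + p)).length = n := by simpa using hw
  have hwp' : ∀ x ∈ w.modify k (· + p), x ≤ 2 * p := fun x hx => le_of_mem_modify hwp hx
  refine ((interpolate_meets h hask hf hfT hwl hwp').bind (r' := 5 * T) (q' := 0)
    (b' := 11 * (n * (T * opCost B))) ?_).bound (by simp) (by simp) (by simp)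
  rintro l ⟨hl1, hl2, hl3⟩
  have hlB : l.length ≤ B := by omega
  have h1 := Nat.mul_le_mul_left T hnW
  have h2 := Nat.mul_le_mul_left T hW
  refine ((Sparse.ofList_meets hl1 hlB).bind (r' := hs.length * 3) (q' := 0)
    (b' := hs.length * (6 * n * opCost B + 1)) ?_).bound (by omega) ?_ (by simp)
  swap
  · have := Nat.mul_le_mul_right (3 * opCost B + 1) hl2
    have := Nat.mul_le_mul_right (6 * n * opCost B + 1) hsT
    nlinarith
  intro F hF
  rw [hl3] at hF
  refine (fold_minusImage_meets h hwl hwp' hhs hF (by omega)).mono ?_ le_rfl le_rfl le_rfl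
  intro G hG
  rw [map_sub]
  exact hG.mono (by omega)

end Interpolated

/-! ### The algorithm TSTerms -/

section TSTerms

/-- `a x ^ γ` is the only term of `P` with exponent congruent to `r` modulo `p`. -/
def IsSingle (p : ℕ) (P : R[X]) (r : ℕ) (a : R) (γ : ℕ) : Prop :=
  γ % p = r ∧ a ≠ 0 ∧ P.coeff γ = a ∧ ∀ i, P.coeff i ≠ 0 → i % p = r → i = γ

theorem IsSingle.coeff_ne_zero {P : R[X]} {r γ : ℕ} {a : R} (h : IsSingle p P r a γ) :
    P.coeff γ ≠ 0 := by
  rw [h.2.2.1]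
  exact h.2.1

theorem IsSingle.eq {P : R[X]} {r γ γ' : ℕ} {a : R} (h : IsSingle p P r a γ)
    (h' : IsSingle p P r a γ') : γ = γ' :=
  h'.2.2.2 γ h.coeff_ne_zero h.1

/-- Any `φ` lifting `ψ` modulo `p` will do, so one isolated residue yields a single term
simultaneously in `f_(d,p)` and in all the shifted polynomials. -/
theorem isSingle_of_mem_isolated {g : MvPolynomial (Fin n) R} {φ ψ : (Fin n →₀ ℕ) → ℕ}
    (hφ : ∀ s, φ s % p = ψ s) {s : Fin n →₀ ℕ} (hs : s ∈ isolated ψ g.support) :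
    IsSingle p (image φ g) (ψ s) (g.coeff s) (φ s) := by
  obtain ⟨h1, h2⟩ := Finset.mem_filter.1 hs
  refine ⟨hφ s, MvPolynomial.mem_support_iff.1 h1, coeff_image_of_forall_ne ?_, ?_⟩
  · intro s' hs' hne e
    exact h2 s' hs' hne (by rw [← hφ, ← hφ, e])
  · intro i hi hir
    obtain ⟨s', hs', rfl⟩ := Finset.mem_image.1 (support_image_subset _ _ (mem_support_iff.2 hi))
    by_contra hne
    exact h2 s' hs' (fun e => hne (e ▸ rfl)) (by rw [← hφ, hir])

variable [DecidableEq R]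

/-- A class holds at most one single term, so the exponent list is unique if it exists. The
equivalence also shows that a failure of the program excludes every candidate. -/
theorem exponents_meets {r γ : ℕ} {a : R} {Ps : List R[X]} {Cs : List (Trie (Option (ℕ × R)))}
    (hCs : List.Forall₂ (IsClassTable p) Ps Cs) (hPs : ∀ P ∈ Ps, ∀ i, P.coeff i ≠ 0 → i ≤ B)
    (hγ : γ ≤ B) (hγr : γ % p = r) (hp : p ≤ B) (hp0 : 0 < p) :
    (exponents p r a γ Cs).Meets Q (fun o => ∀ es, o = some es ↔
      List.Forall₂ (fun P e => IsSingle p P r a (γ + p * e)) Ps es) Cs.length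
      (Cs.length * (6 * opCost B)) 0 := by
  have hr : r ≤ B := by
    rw [← hγr]
    exact (Nat.mod_lt _ hp0).le.trans hp
  induction hCs with
  | nil =>
    refine .pure (fun es => ?_) _ _ _
    rw [List.forall₂_nil_left_iff, Option.some.injEq, eq_comm]
  | @cons P C Ps Cs hPC _ ih =>
    have ih := ih fun P hP => hPs P (by simp [hP])
    have fail {r' b' : ℕ} (hno : ∀ e, ¬ IsSingle p P r a (γ + p * e)) :
        (Run.pure (none : Option (List ℕ))).Meets Q (fun o => ∀ es, o = some es ↔
          List.Forall₂ (fun P e => IsSingle p P r a (γ + p * e)) (P :: Ps) es) r' b' 0 := by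
      refine .pure (fun es => ?_) _ _ _
      simp only [reduceCtorEq, List.forall₂_cons_left_iff, false_iff]
      rintro ⟨e, es', he, -⟩
      exact hno e he
    refine ((singleTerm_meets hPC hr a).bind (r' := Cs.length) (q' := 0)
      (b' := Cs.length * (6 * opCost B) + 5 * opCost B) ?_).bound (by simp [add_comm])
      (by simp only [List.length_cons]; ring_nf; rfl) (by simp)
    intro o ho
    rcases o with _ | β
    · exact fail fun e he => by simpa using (ho _).2 he
    · have hβ : IsSingle p P r a β := (ho β).1 rfl
      have hβB := hPs P (by simp) β hβ.coeff_ne_zero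
      refine ((natLe_meets hγ hβB).bind (r' := Cs.length) (q' := 0)
        (b' := Cs.length * (6 * opCost B) + 4 * opCost B) ?_).bound (by simp) (by omega) (by simp)
      rintro _ rfl
      by_cases hle : γ ≤ β
      swap
      · simp only [hle, decide_false, Bool.false_eq_true, if_false]
        refine fail fun e he => ?_
        have := hβ.eq he
        omega
      simp only [hle, decide_true, if_true]
      refine ((natSub_meets hβB hγ).bind (r' := Cs.length) (q' := 0)
        (b' := Cs.length * (6 * opCost B) + 3 * opCost B) ?_).bound (by simp) (by omega) (by simp)
      rintro _ rfl
      refine ((natMod_meets ((Nat.sub_le β γ).trans hβB) hp).bind (r' := Cs.length) (q' := 0)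
        (b' := Cs.length * (6 * opCost B) + 2 * opCost B) ?_).bound (by simp) (by omega) (by simp)
      rintro _ rfl
      refine ((natEq_meets ((Nat.mod_lt _ hp0).le.trans hp) (Nat.zero_le B)).bind
        (r' := Cs.length) (q' := 0)
        (b' := Cs.length * (6 * opCost B) + opCost B) ?_).bound (by simp) (by omega) (by simp)
      rintro _ rfl
      -- Both exponents lie in the class `r`, so the divisibility test always succeeds.
      have hmod : (β - γ) % p = 0 :=
        (Nat.modEq_iff_dvd' hle).1 (show γ % p = β % p by rw [hγr, hβ.1]) |> Nat.mod_eq_zero_of_dvd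
      simp only [hmod, decide_true, if_true]
      refine ((natDiv_meets ((Nat.sub_le β γ).trans hβB) hp).bind (r' := Cs.length) (q' := 0)
        (b' := Cs.length * (6 * opCost B)) ?_).bound (by simp) (by omega) (by simp)
      rintro _ rfl
      have hq : γ + p * ((β - γ) / p) = β := by
        rw [Nat.mul_div_cancel' (Nat.dvd_of_mod_eq_zero hmod)]
        omega
      refine ih.bind (r' := 0) (q' := 0) (b' := 0) ?_
      intro o' ho'
      rcases o' with _ | es'
      · refine .pure (fun es => ?_) _ _ _
        simp only [reduceCtorEq, List.forall₂_cons_left_iff, false_iff]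
        rintro ⟨e, es', -, he, -⟩
        simpa using (ho' es').2 he
      · refine .pure (fun es => ?_) _ _ _
        simp only [Option.some.injEq, List.forall₂_cons_left_iff]
        constructor
        · rintro rfl
          exact ⟨_, es', by rwa [hq], (ho' es').1 rfl, rfl⟩
        · rintro ⟨e, es'', he, hes, rfl⟩
          have h1 := (ho' es'').2 hes
          have h2 := he.eq hβ
          rw [Option.some.injEq] at h1
          rw [h1, ← h2]
          simp [hp0]

/-- The conditions of the algorithm TSTerms on the term `u`, read off at the term `t`. -/
def IsCandidate (p D : ℕ) (P₀ : R[X]) (Ps : List R[X]) (w : List ℕ) (t : ℕ × R) (u : Term R) :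
    Prop :=
  u.coeff = t.2 ∧ IsSingle p P₀ t.1 t.2 (dot u.exps w) ∧
    List.Forall₂ (fun P e => IsSingle p P t.1 t.2 (dot u.exps w + p * e)) Ps u.exps ∧
    u.exps.sum < D

/-- The computation displayed is the body of the loop of `tsTerms`. For a given `t`, first `γ` and
then all exponents are forced, so at most one candidate arises. -/
theorem candidate_meets (h : Sizes n T D p B) {P₀ : R[X]} {Ps : List R[X]} {w : List ℕ}
    {C₀ : Trie (Option (ℕ × R))} {Cs : List (Trie (Option (ℕ × R)))}
    (hC₀ : IsClassTable p P₀ C₀) (hCs : List.Forall₂ (IsClassTable p) Ps Cs)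
    (hP₀ : ∀ i, P₀.coeff i ≠ 0 → i < 2 * (D * p))
    (hPs : ∀ P ∈ Ps, ∀ i, P.coeff i ≠ 0 → i < 2 * (D * p)) (hn : Ps.length = n)
    (hw : ∀ x ∈ w, x < p) {t : ℕ × R} (ht : t.1 ≤ B) (S : List (Term R)) :
    ((singleTerm C₀ t.1 t.2).bind fun
        | none => Run.pure S
        | some γ => (exponents p t.1 t.2 γ Cs).bind fun
          | none => Run.pure S
          | some e => (dotRun e w).bind fun v => (natEq v γ).bind fun ok =>
              if ok then
                (sumRun e).bind fun s => (natLt s D).bind fun small =>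
                  Run.pure (if small then ⟨t.2, e⟩ :: S else S)
              else Run.pure S).Meets Q (fun S' =>
        (S' = S ∧ ∀ u, ¬ IsCandidate p D P₀ Ps w t u) ∨
        ∃ u, IsCandidate p D P₀ Ps w t u ∧ S' = u :: S) (n + 1) (14 * (n * opCost B)) 0 := by
  have hW := one_le_opCost B
  have hnW := Nat.mul_le_mul_right (opCost B) h.n_pos
  have hnW' := Nat.mul_le_mul_left n hW
  have hDp := h.Dp_le
  have fail {r' b' : ℕ} (hno : ∀ u, ¬ IsCandidate p D P₀ Ps w t u) :
      (Run.pure S).Meets Q (fun S' => (S' = S ∧ ∀ u, ¬ IsCandidate p D P₀ Ps w t u) ∨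
        ∃ u, IsCandidate p D P₀ Ps w t u ∧ S' = u :: S) r' b' 0 :=
    .pure (.inl ⟨rfl, hno⟩) _ _ _
  refine ((singleTerm_meets hC₀ ht t.2).bind (r' := n) (q' := 0)
    (b' := 13 * (n * opCost B)) ?_).bound (by omega) (by omega) (by simp)
  intro o ho
  rcases o with _ | γ
  · exact fail fun u hu => by simpa using (ho _).2 hu.2.1
  have hγ : IsSingle p P₀ t.1 t.2 γ := (ho γ).1 rfl
  have hγB := hP₀ γ hγ.coeff_ne_zero
  have hCn : Cs.length = n := hCs.length_eq.symm.trans hn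
  refine ((exponents_meets hCs (fun P hP i hi => (hPs P hP i hi).le.trans hDp)
    (by omega) hγ.1 h.p_le h.p_pos).bind (r' := 0) (q' := 0)
    (b' := 7 * (n * opCost B)) ?_).bound (by omega) ?_ (by simp)
  swap
  · rw [hCn]
    nlinarith
  intro o ho'
  rcases o with _ | e
  · exact fail fun u hu => by
      have h1 := hu.2.2.1
      rw [hu.2.1.eq hγ] at h1
      simpa using (ho' _).2 h1
  have he := (ho' e).1 rfl
  have hen : e.length = n := he.length_eq.symm.trans hn
  -- The degree test comes only later. Until then an exponent is bounded because `γ + p * x` is the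
  -- exponent of a term of a shifted polynomial, hence below `2 * (D * p)`. The inner product may
  -- thus reach `n * (2 * (D * p))`, which is why this summand occurs in `B`.
  have heD : ∀ x ∈ e, x ≤ 2 * D := by
    intro x hx
    obtain ⟨i, hi, rfl⟩ := List.mem_iff_getElem.1 hx
    have hi' : i < Ps.length := by omega
    have h1 := hPs _ (List.getElem_mem hi') _ (he.get hi' hi).coeff_ne_zero
    by_contra hlt
    have h2 := Nat.mul_le_mul_left p (not_le.1 hlt).le
    simp only [List.get_eq_getElem] at h1
    nlinarith
  have hdot : dot e w ≤ B := by
    refine (dot_le heD (fun y hy => (hw y hy).le)).trans ?_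
    rw [hen, mul_assoc]
    exact h.nDp
  have hD : 2 * D ≤ B := (Nat.le_mul_of_pos_left _ h.n_pos).trans h.nD_le
  refine ((dotRun_meets (B := B) (fun x hx => (heD x hx).trans hD)
    (fun x hx => (hw x hx).le.trans h.p_le) hdot).bind (r' := 0) (q' := 0)
    (b' := 4 * (n * opCost B)) ?_).bound (by omega) ?_ (by simp)
  swap
  · rw [hen]
    nlinarith
  rintro _ rfl
  refine ((natEq_meets (B := B) hdot (by omega)).bind (r' := 0) (q' := 0)
    (b' := 3 * (n * opCost B)) ?_).bound (by omega) (by omega) (by simp)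
  rintro _ rfl
  have huniq (u : Term R) (hu : IsCandidate p D P₀ Ps w t u) : u.exps = e ∧ dot u.exps w = γ := by
    have h1 := hu.2.1.eq hγ
    have h2 := hu.2.2.1
    rw [h1] at h2
    exact ⟨(Option.some.inj ((ho' _).2 h2)).symm, h1⟩
  by_cases hd : dot e w = γ
  swap
  · simp only [hd, decide_false, Bool.false_eq_true, if_false]
    refine fail fun u hu => hd ?_
    obtain ⟨h1, h2⟩ := huniq u hu
    rw [← h1, h2]
  simp only [hd, decide_true, if_true]
  have hsum : e.sum ≤ B := by
    refine le_trans (List.sum_le_card_nsmul e (2 * D) heD) ?_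
    rw [hen, smul_eq_mul]
    exact h.nD_le
  refine ((sumRun_meets (B := B) hsum).bind (r' := 0) (q' := 0)
    (b' := opCost B) ?_).bound (by omega) ?_ (by simp)
  swap
  · rw [hen]
    nlinarith
  rintro _ rfl
  refine (natLt_meets hsum (by omega)).bind (r' := 0) (q' := 0) (b' := 0) ?_
  rintro _ rfl
  by_cases hlt : e.sum < D
  · simp only [hlt, decide_true, if_true]
    exact .pure (.inr ⟨⟨t.2, e⟩, ⟨rfl, by rwa [hd], by rwa [hd], hlt⟩, rfl⟩) _ _ _
  · simp only [hlt, decide_false, Bool.false_eq_true, if_false]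
    refine fail fun u hu => hlt ?_
    rw [← (huniq u hu).1]
    exact hu.2.2.2

theorem tsTerms_meets (h : Sizes n T D p B) {g : MvPolynomial (Fin n) R}
    (hg : ∀ s ∈ g.support, ∑ i, s i < D) (hgT : g.support.card ≤ T) {d m m' : ℕ}
    {M F : Sparse R} {gs : List (Sparse R)} {w : List ℕ} (hw : w = weights n d p)
    (hM : M.Represents B (image (residue p d) g) m)
    (hF : F.Represents B (image (pairing w) g) m)
    (hgs : List.Forall₂ (fun k G => G.Represents B (image (pairing (w.modify k (· + p))) g) m')
      (List.range n) gs) :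
    (tsTerms M F gs w p D).Meets Q (fun S => (∀ u ∈ S, u.coeff ≠ 0 ∧ IsTerm n D u) ∧
      (S.map Term.exps).Nodup ∧ S.length ≤ T ∧
      ∀ s ∈ isolated (residue p d) g.support, ∃ u ∈ S, expVec n u.exps = s ∧ u.coeff = g.coeff s)
      (T * (n + 1)) (2 + 8 * (m * opCost B) + n * (2 + 6 * (m' * opCost B)) +
        15 * (n * (T * opCost B))) 0 := by
  have hW := one_le_opCost B
  have hDp := h.Dp_le
  have hwl : w.length = n := hw ▸ length_weights n d p
  have hwp : ∀ x ∈ w, x < p := fun x hx => lt_of_mem_weights h.p_pos (hw ▸ hx)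
  have hkey : ∀ i, (image (pairing w) g).coeff i ≠ 0 → i < 2 * (D * p) := fun i hi =>
    h.le_of_coeff_image_ne_zero (fun x hx => by have := hwp x hx; omega) hg hi
  have hkey' (k : ℕ) : ∀ i, (image (pairing (w.modify k (· + p))) g).coeff i ≠ 0 →
      i < 2 * (D * p) := fun i hi =>
    h.le_of_coeff_image_ne_zero (fun x hx => le_of_mem_modify hwp hx) hg hi
  have hgn : gs.length = n := by simpa using hgs.length_eq.symm
  refine ((classTable_meets hF (fun i hi => (hkey i hi).le.trans hDp) h.p_le h.p_pos).bind
    (r' := T * (n + 1)) (q' := 0) (b' := 1 + 2 * (m * opCost B) +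
      n * (2 + 6 * (m' * opCost B)) + 15 * (n * (T * opCost B))) ?_).bound (by simp)
      (by ring_nf; rfl) (by simp)
  intro C₀ hC₀
  refine ((mapRun_meets_forall₂ (P := fun k C => IsClassTable p
    (image (pairing (w.modify k (· + p))) g) C) (r := 0) (q := 0) hgs fun k G hG =>
    classTable_meets hG (fun i hi => (hkey' k i hi).le.trans hDp) h.p_le h.p_pos).bind
    (r' := T * (n + 1)) (q' := 0) (b' := 1 + 2 * (m * opCost B) +
      15 * (n * (T * opCost B))) ?_).bound (by simp) (by rw [hgn]; ring_nf; rfl) (by simp)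
  intro Cs hCs
  refine ((Trie.entries_meets M.tree []).bind (r' := T * (n + 1)) (q' := 0)
    (b' := 15 * (n * (T * opCost B))) ?_).bound (by simp)
    (by have := hM.size_le; nlinarith) (by simp)
  rintro _ rfl
  rw [List.append_nil]
  set l := M.tree.toList with hl
  have hlT : l.length ≤ T :=
    hM.length_toList.trans ((card_support_image_le _ _).trans hgT)
  let Ps := (List.range n).map fun k => image (pairing (w.modify k (· + p))) g
  have hCs' : List.Forall₂ (IsClassTable p) Ps Cs := by simpa [Ps] using hCs
  have hPs : ∀ P ∈ Ps, ∀ i, P.coeff i ≠ 0 → i < 2 * (D * p) := by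
    intro P hP
    obtain ⟨k, -, rfl⟩ := List.mem_map.1 hP
    exact hkey' k
  have hcand (t : ℕ × R) (u : Term R) (hu : IsCandidate p D (image (pairing w) g) Ps w t u) :
      u.coeff ≠ 0 ∧ IsTerm n D u ∧ dot u.exps w % p = t.1 := by
    refine ⟨hu.1 ▸ hu.2.1.2.1, ⟨?_, hu.2.2.2⟩, hu.2.1.1⟩
    simpa [Ps] using hu.2.2.1.length_eq.symm
  have hiso (s : Fin n →₀ ℕ) (hs : s ∈ isolated (residue p d) g.support) :
      IsCandidate p D (image (pairing w) g) Ps w (residue p d s, g.coeff s)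
        ⟨g.coeff s, List.ofFn s⟩ := by
    have hdot : dot (List.ofFn s) w = pairing w s := by
      rw [dot_eq_pairing (n := n) (by simp) hwl, expVec_ofFn]
    have hres (s : Fin n →₀ ℕ) : pairing w s % p = residue p d s := by rw [residue, hw]
    refine ⟨rfl, ?_, ?_, ?_⟩
    · rw [hdot]
      exact isSingle_of_mem_isolated hres hs
    · simp only [hdot]
      rw [List.forall₂_iff_get]
      refine ⟨by simp [Ps], fun i h1 h2 => ?_⟩
      have hi : i < n := by simpa [Ps] using h1
      have := isSingle_of_mem_isolated (p := p) (g := g)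
        (φ := pairing (w.modify i (· + p))) (ψ := residue p d) (fun s => by
          rw [pairing_modify hwl ⟨i, hi⟩, Nat.add_mul_mod_self_left, hres]) hs
      rw [pairing_modify hwl ⟨i, hi⟩] at this
      simpa [Ps] using this
    · rw [← sum_expVec (n := n) (by simp), expVec_ofFn]
      exact hg s (Finset.mem_filter.1 hs).1
  have htB : ∀ t ∈ l, t.1 ≤ B := by
    intro t ht
    have h1 := hM.mem_toList.1 ht
    have h2 : (image (residue p d) g).coeff t.1 ≠ 0 := by
      rw [h1.2]
      exact h1.1
    obtain ⟨s, -, hs⟩ := Finset.mem_image.1 (support_image_subset _ _ (mem_support_iff.2 h2))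
    rw [← hs]
    exact (Nat.mod_lt _ h.p_pos).le.trans h.p_le
  -- The invariant remembers that each collected term has the residue of some processed `t`. Since
  -- these residues are pairwise different, no exponent list is collected twice.
  refine (foldRun_meets (r := n + 1) (b := 14 * (n * opCost B)) (q := 0)
    (fun (pre : List (ℕ × R)) (S : List (Term R)) =>
      (∀ u ∈ S, (u.coeff ≠ 0 ∧ IsTerm n D u) ∧ ∃ t ∈ pre, dot u.exps w % p = t.1) ∧
      (S.map Term.exps).Nodup ∧ S.length ≤ pre.length ∧
      ∀ s ∈ isolated (residue p d) g.support, (residue p d s, g.coeff s) ∈ pre →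
        ∃ u ∈ S, expVec n u.exps = s ∧ u.coeff = g.coeff s) (by simp) ?_).mono ?_
    (Nat.mul_le_mul_right _ hlT) ?_ (by simp)
  · intro pre t suf S hpre hS
    refine (candidate_meets h hC₀ hCs' hkey hPs (by simp [Ps]) hwp
      (htB t (by simp [hpre])) S).mono ?_ le_rfl le_rfl le_rfl
    obtain ⟨h1, h2, h3, h4⟩ := hS
    rintro S' (⟨rfl, hno⟩ | ⟨u, hu, rfl⟩)
    · refine ⟨fun u hu => ⟨(h1 u hu).1, ?_⟩, h2, by simp; omega, ?_⟩
      · obtain ⟨t', ht', e⟩ := (h1 u hu).2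
        exact ⟨t', by simp [ht'], e⟩
      · intro s hs hmem
        rcases List.mem_append.1 hmem with hmem | hmem
        · exact h4 s hs hmem
        · rw [List.mem_singleton] at hmem
          exact absurd (hmem ▸ hiso s hs) (hno _)
    · obtain ⟨hu1, hu2, hu3⟩ := hcand t u hu
      refine ⟨?_, ?_, by simpa using h3, ?_⟩
      · intro v hv
        rcases List.mem_cons.1 hv with rfl | hv
        · exact ⟨⟨hu1, hu2⟩, t, by simp, hu3⟩
        · obtain ⟨t', ht', e⟩ := (h1 v hv).2
          exact ⟨(h1 v hv).1, t', by simp [ht'], e⟩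
      · rw [List.map_cons, List.nodup_cons]
        refine ⟨fun hmem => ?_, h2⟩
        obtain ⟨v, hv, hvu⟩ := List.mem_map.1 hmem
        obtain ⟨t', ht', e⟩ := (h1 v hv).2
        rw [hvu, hu3] at e
        have hnd := hM.nodup_toList
        rw [← hl, hpre, List.map_append, List.nodup_append] at hnd
        exact hnd.2.2 t'.1 (List.mem_map_of_mem ht') t.1 (by simp) e.symm
      · intro s hs hmem
        rcases List.mem_append.1 hmem with hmem | hmem
        · obtain ⟨v, hv, e⟩ := h4 s hs hmem
          exact ⟨v, by simp [hv], e⟩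
        · rw [List.mem_singleton] at hmem
          have hu' := hiso s hs
          -- The candidate found at `t` and the isolated term of `g` satisfy the same conditions at
          -- `t`; uniqueness of single terms forces equal inner products and then equal exponents.
          rw [hmem] at hu'
          have hdd := hu.2.1.eq hu'.2.1
          refine ⟨u, by simp, ?_, by rw [hu.1, ← hmem]⟩
          rw [← expVec_ofFn s]
          congr 1
          have h5 := hu.2.2.1
          have h6 := hu'.2.2.1
          rw [hdd] at h5
          refine List.ext_getElem (h5.length_eq.symm.trans h6.length_eq) fun i h7 h8 => ?_
          have hi : i < Ps.length := by rw [h5.length_eq]; exact h7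
          have := (h5.get hi h7).eq (h6.get hi h8)
          exact Nat.eq_of_mul_eq_mul_left h.p_pos (Nat.add_left_cancel this)
  · rintro S ⟨h1, h2, h3, h4⟩
    refine ⟨fun u hu => (h1 u hu).1, h2, h3.trans hlT, fun s hs => h4 s hs ?_⟩
    obtain ⟨h5, h6⟩ := Finset.mem_filter.1 hs
    exact hM.mem_toList.2 ⟨MvPolynomial.mem_support_iff.1 h5, coeff_image_of_forall_ne h6⟩
  · have h1 := Nat.mul_le_mul hlT (le_refl (14 * (n * opCost B) + 1))
    have h2 := Nat.mul_le_mul_left T (Nat.mul_le_mul h.n_pos hW)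
    nlinarith

end TSTerms

end SparseInterp

namespace SparseInterp

open Run Polynomial

variable {Q : Query → Prop} {n T D p B : ℕ} {R : Type*} [CommRing R] [DecidableEq R]

/-! ### The list of bases -/

omit [CommRing R] [DecidableEq R] in
theorem bestBase_meets {bs : List (Base R)} (hB : ∀ b ∈ bs, b.M.count ≤ B) (hne : bs ≠ []) :
    (bestBase bs).Meets Q (fun o => ∃ b ∈ bs, o = some b ∧ ∀ b' ∈ bs, b'.M.count ≤ b.M.count)
      0 (bs.length * (opCost B + 1)) 0 := by
  refine (foldRun_meets (r := 0) (q := 0) (b := opCost B)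
    (fun (pre : List (Base R)) (o : Option (Base R)) => (pre = [] ∧ o = none) ∨
      ∃ b ∈ pre, o = some b ∧ ∀ b' ∈ pre, b'.M.count ≤ b.M.count) (by simp) ?_).mono ?_
    (by simp) le_rfl (by simp)
  · rintro pre a suf o hl (⟨rfl, rfl⟩ | ⟨b, hb, rfl, hmax⟩)
    · exact .pure (.inr ⟨a, by simp, rfl, by simp⟩) _ _ _
    · refine ((natLe_meets (hB a (by simp [hl])) (hB b (by simp [hl, hb]))).bind (r' := 0)
        (q' := 0) (b' := 0) ?_)
      rintro _ rfl
      by_cases hle : a.M.count ≤ b.M.count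
      · simp only [hle, decide_true, if_true]
        refine .pure (.inr ⟨b, by simp [hb], rfl, fun b' hb' => ?_⟩) _ _ _
        rcases List.mem_append.1 hb' with hb' | hb'
        · exact hmax b' hb'
        · rw [List.mem_singleton.1 hb']
          exact hle
      · simp only [hle, decide_false, Bool.false_eq_true, if_false]
        refine .pure (.inr ⟨a, by simp, rfl, fun b' hb' => ?_⟩) _ _ _
        rcases List.mem_append.1 hb' with hb' | hb'
        · exact (hmax b' hb').trans (not_le.1 hle).le
        · rw [List.mem_singleton.1 hb']
  · rintro o (⟨rfl, -⟩ | h)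
    · exact absurd rfl hne
    · exact h

/-- `bs` holds the images of `g` for the bases `1, …, N`. -/
def AreBases (p B N : ℕ) (g : MvPolynomial (Fin n) R) (m : ℕ) (bs : List (Base R)) : Prop :=
  bs.map Base.d = List.range' 1 N ∧ ∀ b ∈ bs, IsBase p B g m b

variable {g : MvPolynomial (Fin n) R} {N m : ℕ} {bs : List (Base R)}

omit [DecidableEq R] in
theorem AreBases.length_eq (h : AreBases p B N g m bs) : bs.length = N := by
  simpa using congrArg List.length h.1

omit [DecidableEq R] in
theorem AreBases.d_mem (h : AreBases p B N g m bs) {b : Base R} (hb : b ∈ bs) :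
    b.d ∈ Finset.Icc 1 N := by
  have : b.d ∈ List.range' 1 N := h.1 ▸ List.mem_map_of_mem hb
  rw [List.mem_range'_1] at this
  rw [Finset.mem_Icc]
  omega

omit [DecidableEq R] in
theorem AreBases.exists_base (h : AreBases p B N g m bs) {d : ℕ} (hd : d ∈ Finset.Icc 1 N) :
    ∃ b ∈ bs, b.d = d := by
  have : d ∈ bs.map Base.d := by
    rw [h.1, List.mem_range'_1]
    rw [Finset.mem_Icc] at hd
    omega
  simpa using this

theorem countP_range' (N : ℕ) (q : ℕ → Prop) [DecidablePred q] :
    (List.range' 1 N).countP (fun d => q d) = ((Finset.Icc 1 N).filter q).card := by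
  rw [List.countP_eq_length_filter, ← List.toFinset_card_of_nodup
    (List.Nodup.filter _ List.nodup_range')]
  congr 1
  ext d
  simp only [List.mem_toFinset, List.mem_filter, List.mem_range'_1, decide_eq_true_eq,
    Finset.mem_filter, Finset.mem_Icc]
  refine and_congr_left fun _ => ?_
  omega

/-- The counter is the cardinality of `goodBases`, so the decision agrees with the true coefficient
of `g`, whether or not `u` is a term of `g`. -/
theorem accepts_meets (h : Sizes n T D p B) (hbs : AreBases p B (numBases n T) g m bs)
    (hm : m < B) (hg : ∀ s ∈ g.support, ∑ i, s i < D) (hgT : g.support.card ≤ T)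
    (hp : numBases n T ≤ p) {u : Term R} (hu : IsTerm n D u) (hu0 : u.coeff ≠ 0) :
    (accepts p (delta₂ n T + 1) (delta₁ n T + delta₂ n T + 1) bs u).Meets Q
      (· = decide (g.coeff (expVec n u.exps) = u.coeff)) (numBases n T * 3)
      (12 * (numBases n T * (n * opCost B))) 0 := by
  classical
  have hNB := h.numBases_le
  have hW := one_le_opCost B
  have hnW := Nat.mul_le_mul h.n_pos hW
  have hnW' := Nat.mul_le_mul_right (opCost B) h.n_pos
  have hlast : delta₁ n T + delta₂ n T + 1 ≤ numBases n T := le_max_right _ _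
  have h2B : delta₂ n T + 1 ≤ B := by omega
  let q (d : ℕ) : Prop := d ≤ delta₁ n T + delta₂ n T + 1 ∧
    (image (residue p d) g - monomial (residue p d (expVec n u.exps)) u.coeff).support.card <
      (image (residue p d) g).support.card
  refine ((foldRun_meets (r := 3) (q := 0) (b := 10 * (n * opCost B))
    (fun (pre : List (Base R)) (c : ℕ) => c = pre.countP fun b => q b.d) (by simp) ?_).bind
    (r' := 0) (q' := 0) (b' := opCost B) ?_).bound (by simp [hbs.length_eq]) ?_ (by simp)
  · rintro pre b suf c hl rfl
    have hb : b ∈ bs := by simp [hl]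
    have hbase := hbs.2 b hb
    have hd := Finset.mem_Icc.1 (hbs.d_mem hb)
    have hpre : pre.countP (fun b => decide (q b.d)) ≤ B := by
      refine List.countP_le_length.trans ?_
      have := hbs.length_eq
      rw [hl, List.length_append] at this
      omega
    have hcount : (pre ++ [b]).countP (fun b => decide (q b.d)) =
        pre.countP (fun b => decide (q b.d)) + if q b.d then 1 else 0 := by
      simp [List.countP_append, List.countP_singleton]
    refine ((natLe_meets (B := B) (a := b.d) (b := delta₁ n T + delta₂ n T + 1) (by omega)
      (by omega)).bind (r' := 3) (q' := 0) (b' := 9 * (n * opCost B)) ?_).bound (by simp)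
      (by omega) (by simp)
    rintro _ rfl
    rw [hcount]
    by_cases hle : b.d ≤ delta₁ n T + delta₂ n T + 1
    swap
    · simp only [hle, decide_false, Bool.false_eq_true, if_false]
      exact .pure (by simp [q, hle]) _ _ _
    simp only [hle, decide_true, if_true]
    have hwl : b.weights.length = n := hbase.weights ▸ length_weights n b.d p
    have hwp : ∀ x ∈ b.weights, x ≤ 2 * p := fun x hx => by
      have := lt_of_mem_weights h.p_pos (hbase.weights ▸ hx)
      omega
    refine ((minusImageMod_meets h hwl hwp hu hbase.M hm).bind (r' := 0) (q' := 0)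
      (b' := 2 * (n * opCost B)) ?_).bound (by simp) (by rw [mul_assoc]; omega) (by simp)
    intro G hG
    have hGc : G.count = (image (residue p b.d) g -
        monomial (residue p b.d (expVec n u.exps)) u.coeff).support.card := by
      rw [hG.count, image_monomial, hbase.weights]
      rfl
    refine ((natLt_meets (B := B) (a := G.count) (b := b.M.count)
      (by have := hG.card_le; rw [hG.count]; omega)
      (by have := hbase.M.card_le; rw [hbase.M.count]; omega)).bind (r' := 0) (q' := 0)
      (b' := n * opCost B) ?_).bound (by simp) (by omega) (by simp)
    rintro _ rfl
    by_cases hlt : G.count < b.M.count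
    · simp only [hlt, decide_true, if_true]
      have hq : q b.d := ⟨hle, by rwa [← hGc, ← hbase.M.count]⟩
      rw [if_pos hq]
      exact (natAdd_meets hpre (by omega)).bound le_rfl (by omega) le_rfl
    · simp only [hlt, decide_false, Bool.false_eq_true, if_false]
      have hq : ¬ q b.d := fun hq => hlt (by rw [hGc, hbase.M.count]; exact hq.2)
      rw [if_neg hq, add_zero]
      exact (Meets.pure_eq _).bound le_rfl (Nat.zero_le _) le_rfl
  · intro c hc
    have hcard : c = (goodBases p (delta₁ n T + delta₂ n T + 1) g (expVec n u.exps)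
        u.coeff).card := by
      rw [hc, show bs.countP (fun b => decide (q b.d)) =
        (bs.map Base.d).countP (fun d => decide (q d)) by simp [List.countP_map, Function.comp_def],
        hbs.1, countP_range', goodBases]
      congr 1
      -- The list runs over all of `1, …, N`; the condition `d ≤ δ₁ + δ₂ + 1` inside `q` cuts it
      -- down to the range of `goodBases`.
      ext d
      simp only [Finset.mem_filter, Finset.mem_Icc, q]
      constructor
      · rintro ⟨h1, h2, h3⟩
        exact ⟨⟨h1.1, h2⟩, h3⟩
      · rintro ⟨h1, h3⟩
        exact ⟨⟨h1.1, h1.2.trans hlast⟩, h1.2, h3⟩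
    have hcB : c ≤ B := by
      rw [hc]
      exact List.countP_le_length.trans (hbs.length_eq.trans_le hNB)
    refine (natLe_meets h2B hcB).mono ?_ le_rfl le_rfl le_rfl
    rintro _ rfl
    rw [hcard, decide_eq_decide]
    refine delta₂_lt_card_goodBases_iff h.prime hgT (hlast.trans hp)
      (fun s hs => h.apply_lt (hg s hs)) (h.apply_lt ?_) hu0
    rw [sum_expVec hu.1]
    exact hu.2
  · rw [hbs.length_eq]
    have : 1 ≤ numBases n T := by unfold numBases; omega
    have := Nat.mul_le_mul this hnW'
    have := Nat.mul_le_mul_left (numBases n T) hnW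
    nlinarith

theorem select_meets (h : Sizes n T D p B) (hbs : AreBases p B (numBases n T) g m bs)
    (hm : m < B) (hg : ∀ s ∈ g.support, ∑ i, s i < D) (hgT : g.support.card ≤ T)
    (hp : numBases n T ≤ p) {ts : List (Term R)}
    (hts : ∀ u ∈ ts, u.coeff ≠ 0 ∧ IsTerm n D u) :
    (select p (delta₂ n T + 1) (delta₁ n T + delta₂ n T + 1) bs ts).Meets Q
      (· = (ts.filter fun u => g.coeff (expVec n u.exps) = u.coeff).reverse)
      (ts.length * (numBases n T * 3))
      (ts.length * (12 * (numBases n T * (n * opCost B)) + 1)) 0 := by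
  refine (foldRun_meets (q := 0) (fun (pre s : List (Term R)) =>
    s = (pre.filter fun u => g.coeff (expVec n u.exps) = u.coeff).reverse) (by simp) ?_).bound
    le_rfl le_rfl (by simp)
  rintro pre u suf s hl rfl
  have hu := hts u (by simp [hl])
  refine ((accepts_meets h hbs hm hg hgT hp hu.2 hu.1).bind (r' := 0) (q' := 0)
    (b' := 0) ?_)
  rintro _ rfl
  refine .pure ?_ _ _ _
  by_cases hc : g.coeff (expVec n u.exps) = u.coeff <;> simp [List.filter_append, hc]

theorem update_meets (h : Sizes n T D p B) (hbs : ∀ b ∈ bs, IsBase p B g m b)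
    (hN : N ≤ B) (hd : ∀ b ∈ bs, b.d ≤ B) {s : List (Term R)} (hs : ∀ u ∈ s, IsTerm n D u)
    (hm : m + s.length ≤ B) :
    (update p N s bs).Meets Q (fun bs' => bs'.map Base.d = (bs.map Base.d).filter (· ≤ N) ∧
      ∀ b ∈ bs', IsBase p B (g - sumTerms n s) (m + s.length) b)
      (bs.length * (6 * s.length)) (bs.length * (opCost B + 15 * (s.length * (n * opCost B)))) 0 := by
  have hW := one_le_opCost B
  have hnW := Nat.mul_le_mul_left s.length (Nat.mul_le_mul h.n_pos hW)
  induction bs with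
  | nil => exact .pure (by simp) _ _ _
  | cons b bs ih =>
    have ih := ih (fun b' hb' => hbs b' (by simp [hb'])) (fun b' hb' => hd b' (by simp [hb']))
    have hb := hbs b (by simp)
    refine ((natLe_meets (hd b (by simp)) hN).bind (r' := (bs.length + 1) * (6 * s.length))
      (q' := 0) (b' := bs.length * (opCost B + 15 * (s.length * (n * opCost B))) +
        15 * (s.length * (n * opCost B))) ?_).bound (by simp)
      (by simp only [List.length_cons]; ring_nf; rfl) (by simp)
    rintro _ rfl
    by_cases hle : b.d ≤ N
    · simp only [hle, decide_true, if_true]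
      have hwl : b.weights.length = n := hb.weights ▸ length_weights n b.d p
      have hwp : ∀ x ∈ b.weights, x ≤ 2 * p := fun x hx => by
        have := lt_of_mem_weights h.p_pos (hb.weights ▸ hx)
        omega
      have hres : (fun s : Fin n →₀ ℕ => pairing b.weights s % p) = residue p b.d := by
        rw [hb.weights]
        rfl
      refine ((fold_minusImage_meets h hwl hwp hs hb.F hm).bind
        (r' := s.length * 3 + bs.length * (6 * s.length)) (q' := 0)
        (b' := bs.length * (opCost B + 15 * (s.length * (n * opCost B))) +
          s.length * (7 * n * opCost B + 1)) ?_).bound (by ring_nf; rfl) (by nlinarith) (by simp)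
      intro F hF
      refine ((fold_minusImageMod_meets h hwl hwp hs hb.M hm).bind
        (r' := bs.length * (6 * s.length)) (q' := 0)
        (b' := bs.length * (opCost B + 15 * (s.length * (n * opCost B)))) ?_).bound le_rfl
        (by omega) (by simp)
      intro M hM
      refine ih.bind (r' := 0) (q' := 0) (b' := 0) ?_
      rintro bs' ⟨h1, h2⟩
      refine .pure ⟨by simp [h1, hle], ?_⟩ _ _ _
      intro b' hb'
      rcases List.mem_cons.1 hb' with rfl | hb'
      · refine ⟨hb.weights, ?_, ?_⟩
        · simpa using hF
        · rw [hres] at hM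
          simpa using hM
      · exact h2 b' hb'
    · simp only [hle, decide_false, Bool.false_eq_true, if_false]
      refine ih.mono ?_ (Nat.mul_le_mul_right _ (Nat.le_succ _)) (by omega) le_rfl
      rintro bs' ⟨h1, h2⟩
      exact ⟨by simp [h1, hle], h2⟩

end SparseInterp

namespace SparseInterp

open Run Polynomial

variable {Q : Query → Prop} {n T D p B : ℕ} {R : Type*} [CommRing R]

/-! ### Lists of terms -/

section Terms

variable {g : MvPolynomial (Fin n) R} {s : List (Term R)}

theorem sumTerms_append_reverse (s h : List (Term R)) :
    sumTerms n (s.reverse ++ h) = sumTerms n h + sumTerms n s := by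
  simp [sumTerms, List.sum_reverse, add_comm]

open Classical in
/-- The exponent vectors of a list of terms. -/
noncomputable def expVecs (n : ℕ) (s : List (Term R)) : Finset (Fin n →₀ ℕ) :=
  (s.map fun u => expVec n u.exps).toFinset

omit [CommRing R] in
theorem mem_expVecs {e : Fin n →₀ ℕ} : e ∈ expVecs n s ↔ ∃ u ∈ s, expVec n u.exps = e := by
  simp [expVecs]

omit [CommRing R] in
theorem nodup_map_expVec (hn : ∀ u ∈ s, u.exps.length = n) (hnd : (s.map Term.exps).Nodup) :
    (s.map fun u => expVec n u.exps).Nodup := by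
  rw [show (s.map fun u => expVec n u.exps) = (s.map Term.exps).map (expVec n) by simp]
  rw [List.nodup_map_iff_inj_on hnd]
  intro x hx y hy hxy
  obtain ⟨u, hu, rfl⟩ := List.mem_map.1 hx
  obtain ⟨v, hv, rfl⟩ := List.mem_map.1 hy
  exact expVec_injOn (hn u hu) (hn v hv) hxy

omit [CommRing R] in
theorem card_expVecs (hn : ∀ u ∈ s, u.exps.length = n) (hnd : (s.map Term.exps).Nodup) :
    (expVecs n s).card = s.length := by
  classical
  rw [expVecs, List.toFinset_card_of_nodup (nodup_map_expVec hn hnd), List.length_map]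

theorem coeff_sumTerms_of_notMem {e : Fin n →₀ ℕ} (he : e ∉ expVecs n s) :
    (sumTerms n s).coeff e = 0 := by
  classical
  rw [mem_expVecs] at he
  induction s with
  | nil => simp [sumTerms]
  | cons u s ih =>
    have h1 : ¬ expVec n u.exps = e := fun h => he ⟨u, by simp, h⟩
    have h2 := ih fun ⟨v, hv, h⟩ => he ⟨v, by simp [hv], h⟩
    simp only [sumTerms, List.map_cons, List.sum_cons, MvPolynomial.coeff_add,
      MvPolynomial.coeff_monomial, if_neg h1, zero_add] at h2 ⊢
    exact h2

theorem coeff_sumTerms_of_mem (hnd : (s.map fun u => expVec n u.exps).Nodup) {u : Term R}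
    (hu : u ∈ s) : (sumTerms n s).coeff (expVec n u.exps) = u.coeff := by
  classical
  induction s with
  | nil => simp at hu
  | cons v s ih =>
    simp only [List.map_cons, List.nodup_cons, List.mem_map, not_exists, not_and] at hnd
    have hsplit : sumTerms n (v :: s) =
        MvPolynomial.monomial (expVec n v.exps) v.coeff + sumTerms n s := by simp [sumTerms]
    rw [hsplit, MvPolynomial.coeff_add, MvPolynomial.coeff_monomial]
    rcases List.mem_cons.1 hu with rfl | hu
    · rw [if_pos rfl, coeff_sumTerms_of_notMem, add_zero]
      rw [mem_expVecs]
      rintro ⟨w, hw, e⟩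
      exact hnd.1 w hw e
    · rw [if_neg fun e => hnd.1 u hu e.symm, zero_add, ih hnd.2 hu]

open Classical in
-- Selected terms carry the coefficients of `g`, so subtracting them cancels completely and creates
-- nothing new.
theorem support_sub_sumTerms (hnd : (s.map fun u => expVec n u.exps).Nodup)
    (hs : ∀ u ∈ s, g.coeff (expVec n u.exps) = u.coeff) :
    (g - sumTerms n s).support = g.support \ expVecs n s := by
  ext e
  rw [MvPolynomial.mem_support_iff, MvPolynomial.coeff_sub, Finset.mem_sdiff,
    MvPolynomial.mem_support_iff]
  by_cases he : e ∈ expVecs n s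
  · obtain ⟨u, hu, rfl⟩ := mem_expVecs.1 he
    simp [he, coeff_sumTerms_of_mem hnd hu, hs u hu]
  · simp [he, coeff_sumTerms_of_notMem he]

theorem expVecs_subset_support (hs : ∀ u ∈ s, u.coeff ≠ 0 ∧ g.coeff (expVec n u.exps) = u.coeff) :
    expVecs n s ⊆ g.support := by
  intro e he
  obtain ⟨u, hu, rfl⟩ := mem_expVecs.1 he
  rw [MvPolynomial.mem_support_iff, (hs u hu).2]
  exact (hs u hu).1

end Terms

/-! ### The main loop -/

theorem numBases_mono {T' : ℕ} (h : T' ≤ T) : numBases n T' ≤ numBases n T := by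
  unfold numBases delta₁ delta₂
  gcongr

theorem numBases_pos : 1 ≤ numBases n T := by
  unfold numBases
  omega

/-- A bound for the number of ring operations in one pass through the loop. -/
def roundRing (n T N : ℕ) : ℕ := 7 * (n * T) + 9 * (N * T)

/-- A bound for the number of bit operations in one pass through the loop, if an arithmetic
operation takes at most `W`. -/
def roundBits (n T N W : ℕ) : ℕ :=
  N * (W + 1) + W + (4 * (n * (n * W)) + 11 * (n * (n * (T * W)))) +
  (2 + 8 * (2 * T * W) + n * (2 + 6 * (2 * T * W)) + 15 * (n * (T * W))) + 9 * W +
  T * (12 * (N * (n * W)) + 1) + T * 1 + T * (W + 1) + W + 9 * W +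
  N * (W + 15 * (T * (n * W)))

section Loop

variable [DecidableEq R] {Δ τ : ℕ} {ask : List ℕ → ℕ → ℕ → List (ℕ × R)}
  {f : MvPolynomial (Fin n) R}

set_option maxHeartbeats 1000000 in
-- Induction on `j`, where `2 ^ j` exceeds the number of terms of the remainder `g = f - h`. The
-- bound `T'` decreases by the number of terms found, while `hs.length` and the count `m` of
-- additions increase by it; this keeps `hs.length + T'` and `m + T'` bounded throughout. The found
-- terms have left the support of `g`, so no exponent vector is returned twice.
theorem mainLoop_meets (h : Sizes n T D p B) (hask : Answers Q p Δ τ ask f)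
    (hf : ∀ s ∈ f.support, ∑ i, s i < D) (hfT : f.support.card ≤ T) (hp : numBases n T ≤ p)
    (j T' m : ℕ) (hs : List (Term R)) (bs : List (Base R)) (g : MvPolynomial (Fin n) R)
    (hT' : hs.length + T' ≤ T) (hm : m + T' ≤ 2 * T) (hg : g = f - sumTerms n hs)
    (hgD : ∀ s ∈ g.support, ∑ i, s i < D) (hgT : g.support.card ≤ T')
    (hgj : g.support.card < 2 ^ j)
    (hhs : ∀ u ∈ hs, u.coeff ≠ 0 ∧ IsTerm n D u) (hnd : (hs.map Term.exps).Nodup)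
    (hdis : ∀ u ∈ hs, expVec n u.exps ∉ g.support)
    (hbs : AreBases p B (numBases n T') g m bs) :
    (mainLoop ask n p D Δ τ (j + 1) T' hs bs).Meets Q
      (fun o => ∃ out, o = some out ∧ ListsMvTerms out f)
      ((j + 1) * roundRing n T (numBases n T))
      ((j + 1) * roundBits n T (numBases n T) (opCost B)) (j * n) := by
  classical
  induction j generalizing T' m hs bs g with
  -- Fewer than `2 ^ 0` terms means `g = 0`; the one remaining test of the loop condition ends the
  -- computation.
  | zero =>
    have hg0 : g = 0 := by
      rw [← MvPolynomial.support_eq_empty, ← Finset.card_eq_zero]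
      simpa using hgj
    have hne : bs ≠ [] := by
      rintro rfl
      have h0 := hbs.length_eq
      have := numBases_pos (n := n) (T := T')
      rw [List.length_nil] at h0
      omega
    have hzero : ∀ b ∈ bs, b.M.count = 0 := by
      intro b hb
      rw [(hbs.2 b hb).M.count, hg0]
      simp
    have hN : numBases n T' ≤ numBases n T := numBases_mono (by omega)
    refine ((bestBase_meets (B := B) (fun b hb => by rw [hzero b hb]; exact Nat.zero_le _)
      hne).bind (r' := 0) (q' := 0) (b' := opCost B) ?_).bound (by simp) ?_ (by simp)
    swap
    · rw [hbs.length_eq]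
      have := Nat.mul_le_mul_right (opCost B + 1) hN
      unfold roundBits
      omega
    rintro _ ⟨b, hb, rfl, -⟩
    refine (natEq_meets (B := B) (a := b.M.count) (b := 0) (by rw [hzero b hb]; omega)
      (by omega)).bind (r' := 0) (q' := 0) (b' := 0) ?_
    rintro _ rfl
    simp only [hzero b hb, decide_true, if_true]
    refine .pure ⟨hs, rfl, hnd, fun u hu => ⟨(hhs u hu).2.1, (hhs u hu).1⟩, ?_⟩ _ _ _
    rw [hg0, eq_comm, sub_eq_zero] at hg
    exact hg.symm
  | succ j ih =>
    have hTT : T' ≤ T := by omega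
    have hN : numBases n T' ≤ numBases n T := numBases_mono hTT
    have hT8 := h.T_le
    have hNB := h.numBases_le
    have hne : bs ≠ [] := by
      rintro rfl
      have h0 := hbs.length_eq
      have := numBases_pos (n := n) (T := T')
      rw [List.length_nil] at h0
      omega
    have hcountB : ∀ b ∈ bs, b.M.count ≤ B := by
      intro b hb
      rw [(hbs.2 b hb).M.count]
      have := (hbs.2 b hb).M.card_le
      omega
    -- The larger expressions are made opaque so that the bookkeeping of costs below is linear
    -- arithmetic.
    generalize hNN : numBases n T = N at *
    generalize hrest : (j + 1) * roundBits n T N (opCost B) = rest at *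
    generalize hrestR : (j + 1) * roundRing n T N = restR at *
    have e1 : (j + 1 + 1) * roundBits n T N (opCost B) = rest + roundBits n T N (opCost B) := by
      rw [← hrest]
      ring
    have e2 : (j + 1 + 1) * roundRing n T N = restR + roundRing n T N := by
      rw [← hrestR]
      ring
    have e3 : (j + 1) * n = n + j * n := by ring
    rw [e1, e2, e3]
    have hnT : T * (n + 1) ≤ 2 * (n * T) := by
      have := Nat.mul_le_mul_right T h.n_pos
      nlinarith
    generalize hb9 : N * (opCost B + 15 * (T * (n * opCost B))) = b9
    refine ((bestBase_meets (B := B) hcountB hne).bind (r' := restR + roundRing n T N)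
      (q' := n + j * n) (b' := rest + (opCost B +
        (4 * (n * (n * opCost B)) + 11 * (n * (n * (T * opCost B)))) +
        (2 + 8 * (2 * T * opCost B) + n * (2 + 6 * (2 * T * opCost B)) +
          15 * (n * (T * opCost B))) + 9 * opCost B + T * (12 * (N * (n * opCost B)) + 1) + T * 1 +
        T * (opCost B + 1) + opCost B + 9 * opCost B + b9)) ?_).bound (by simp) ?_ (by simp)
    swap
    · rw [hbs.length_eq]
      have := Nat.mul_le_mul_right (opCost B + 1) hN
      unfold roundBits
      omega
    rintro _ ⟨b, hb, rfl, hmax⟩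
    have hbase := hbs.2 b hb
    refine ((natEq_meets (B := B) (a := b.M.count) (b := 0) (hcountB b hb)
      (by omega)).bind (r' := restR + roundRing n T N) (q' := n + j * n)
      (b' := rest + (
        (4 * (n * (n * opCost B)) + 11 * (n * (n * (T * opCost B)))) +
        (2 + 8 * (2 * T * opCost B) + n * (2 + 6 * (2 * T * opCost B)) +
          15 * (n * (T * opCost B))) + 9 * opCost B + T * (12 * (N * (n * opCost B)) + 1) + T * 1 +
        T * (opCost B + 1) + opCost B + 9 * opCost B + b9)) ?_).bound (by simp) (by omega)
        (by simp)
    rintro _ rfl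
    have hgp : ∀ s ∈ g.support, ∀ i, s i < p := fun s hs => h.apply_lt (hgD s hs)
    have hiso : g.support.card ≤ 2 * (isolated (residue p b.d) g.support).card := by
      refine card_support_le_two_mul_card_isolated h.prime hgT (hN.trans hp) hgp ?_
      intro d' hd'
      obtain ⟨b', hb', rfl⟩ := hbs.exists_base hd'
      have := hmax b' hb'
      rwa [(hbs.2 b' hb').M.count, hbase.M.count] at this
    by_cases hzero : b.M.count = 0
    · simp only [hzero, decide_true, if_true]
      refine .pure ⟨hs, rfl, hnd, fun u hu => ⟨(hhs u hu).2.1, (hhs u hu).1⟩, ?_⟩ _ _ _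
      -- If the maximal count is zero, no term is isolated; as half of the terms are, `g` has none.
      -- Cancellation modulo `x ^ p - 1` cannot stop the loop too early.
      have h1 := card_isolated_le_card_support_image (residue p b.d) g
      rw [← hbase.M.count, hzero] at h1
      have hg0 : g = 0 := by
        rw [← MvPolynomial.support_eq_empty, ← Finset.card_eq_zero]
        omega
      rw [hg0, eq_comm, sub_eq_zero] at hg
      exact hg.symm
    simp only [hzero, decide_false, Bool.false_eq_true, if_false]
    have hwl : b.weights.length = n := hbase.weights ▸ length_weights n b.d p
    have hwp : ∀ x ∈ b.weights, x < p := fun x hx => lt_of_mem_weights h.p_pos (hbase.weights ▸ hx)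
    refine ((shifted_meets h hask hf hfT hwl hwp (fun u hu => (hhs u hu).2) (by omega)).bind
      (r' := restR + (2 * (n * T) + 9 * (N * T))) (q' := j * n) (b' := rest + (
        (2 + 8 * (2 * T * opCost B) + n * (2 + 6 * (2 * T * opCost B)) +
          15 * (n * (T * opCost B))) + 9 * opCost B + T * (12 * (N * (n * opCost B)) + 1) + T * 1 +
        T * (opCost B + 1) + opCost B + 9 * opCost B + b9)) ?_).bound
        (by unfold roundRing; omega) (by omega) le_rfl
    intro gs hgs
    rw [← hg] at hgs
    have hm2 : m ≤ 2 * T := by omega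
    refine ((tsTerms_meets h hgD (hgT.trans hTT) hbase.weights (hbase.M.mono hm2)
      (hbase.F.mono hm2) hgs).bind (r' := restR + 9 * (N * T)) (q' := j * n)
      (b' := rest + (9 * opCost B + T * (12 * (N * (n * opCost B)) + 1) + T * 1 +
        T * (opCost B + 1) + opCost B + 9 * opCost B + b9)) ?_).bound (by omega) (by omega)
        (by omega)
    rintro ts ⟨hts1, hts2, hts3, hts4⟩
    refine ((bounds_meets (h.of_le hTT)).bind (r' := restR + 9 * (N * T)) (q' := j * n)
      (b' := rest + (T * (12 * (N * (n * opCost B)) + 1) + T * 1 +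
        T * (opCost B + 1) + opCost B + 9 * opCost B + b9)) ?_).bound (by omega) (by omega)
        (by omega)
    rintro _ rfl
    have hselR : ts.length * (numBases n T' * 3) ≤ 3 * (N * T) := by
      have := Nat.mul_le_mul hts3 hN
      nlinarith
    have hselB : ts.length * (12 * (numBases n T' * (n * opCost B)) + 1) ≤
        T * (12 * (N * (n * opCost B)) + 1) := by
      gcongr
    refine ((select_meets (h.of_le hTT) hbs (by omega) hgD hgT (hN.trans hp) hts1).bind
      (r' := restR + 6 * (N * T)) (q' := j * n)
      (b' := rest + (T * 1 + T * (opCost B + 1) + opCost B + 9 * opCost B + b9)) ?_).bound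
      (by omega) (by omega) (by omega)
    intro s hsel
    have hmem (u : Term R) : u ∈ s ↔ u ∈ ts ∧ g.coeff (expVec n u.exps) = u.coeff := by
      simp [hsel]
    have hs1 : ∀ u ∈ s, u.coeff ≠ 0 ∧ IsTerm n D u := fun u hu => hts1 u ((hmem u).1 hu).1
    have hs2 : ∀ u ∈ s, g.coeff (expVec n u.exps) = u.coeff := fun u hu => ((hmem u).1 hu).2
    have hs3 : (s.map Term.exps).Nodup := by
      rw [hsel, List.map_reverse, List.nodup_reverse]
      exact hts2.sublist (List.Sublist.map _ List.filter_sublist)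
    have hs4 : (s.map fun u => expVec n u.exps).Nodup :=
      nodup_map_expVec (fun u hu => (hs1 u hu).2.1) hs3
    have hE : expVecs n s ⊆ g.support :=
      expVecs_subset_support fun u hu => ⟨(hs1 u hu).1, hs2 u hu⟩
    have hEcard : (expVecs n s).card = s.length :=
      card_expVecs (fun u hu => (hs1 u hu).2.1) hs3
    have hisoE : isolated (residue p b.d) g.support ⊆ expVecs n s := by
      intro e he
      obtain ⟨u, hu, rfl, hc⟩ := hts4 e he
      exact mem_expVecs.2 ⟨u, (hmem u).2 ⟨hu, hc.symm⟩, rfl⟩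
    have hsup := support_sub_sumTerms hs4 hs2
    -- Since `s` contains every isolated term, its length is at least half of the support; the
    -- remainder is thereby halved, and `T' - s.length` still bounds its number of terms.
    have hcard : (g - sumTerms n s).support.card + s.length = g.support.card := by
      rw [hsup, ← hEcard, Finset.card_sdiff_add_card_eq_card hE]
    have hisoc := Finset.card_le_card hisoE
    have hsT : s.length ≤ T := by omega
    have hsTW := Nat.mul_le_mul_right (opCost B + 1) hsT
    refine ((foldRun_meets (r := 0) (b := 0) (q := 0) (Q := Q) (l := s) (x := hs)
      (g := fun h' u => Run.pure (u :: h')) (fun (pre h' : List (Term R)) =>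
        h' = pre.reverse ++ hs) (by simp) ?_).bind
      (r' := restR + 6 * (N * T)) (q' := j * n)
      (b' := rest + (T * (opCost B + 1) + opCost B + 9 * opCost B + b9)) ?_).bound
      (by omega) (by omega) (by omega)
    · rintro pre u suf _ - rfl
      exact .pure (by simp) _ _ _
    rintro _ rfl
    refine ((lengthRun_meets (B := B) (l := s) (by omega) (by omega)).bind
      (r' := restR + 6 * (N * T)) (q' := j * n)
      (b' := rest + (opCost B + 9 * opCost B + b9)) ?_).bound (by omega) (by omega) (by omega)
    rintro _ rfl
    refine ((natSub_meets (B := B) (a := T') (b := s.length) (by omega) (by omega)).bind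
      (r' := restR + 6 * (N * T)) (q' := j * n)
      (b' := rest + (9 * opCost B + b9)) ?_).bound (by omega) (by omega) (by omega)
    rintro _ rfl
    have hTT2 : T' - s.length ≤ T' := Nat.sub_le _ _
    refine ((bounds_meets (h.of_le (hTT2.trans hTT))).bind
      (r' := restR + 6 * (N * T)) (q' := j * n)
      (b' := rest + b9) ?_).bound (by omega) (by omega) (by omega)
    rintro _ rfl
    have hN2 : numBases n (T' - s.length) ≤ numBases n T' := numBases_mono hTT2
    have hbN : ∀ b' ∈ bs, b'.d ≤ B := fun b' hb' => by
      have := Finset.mem_Icc.1 (hbs.d_mem hb')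
      omega
    have hupR : bs.length * (6 * s.length) ≤ 6 * (N * T) := by
      rw [hbs.length_eq]
      have := Nat.mul_le_mul hN hsT
      nlinarith
    have hupB : bs.length * (opCost B + 15 * (s.length * (n * opCost B))) ≤ b9 := by
      rw [hbs.length_eq, ← hb9]
      gcongr
    refine ((update_meets h hbs.2 (N := numBases n (T' - s.length)) (by omega) hbN
      (fun u hu => (hs1 u hu).2) (by omega)).bind
      (r' := restR) (q' := j * n) (b' := rest) ?_).bound (by omega) (by omega) (by omega)
    rintro bs' ⟨hbs1, hbs2⟩
    refine ih (T' - s.length) (m + s.length) (s.reverse ++ hs) bs' (g - sumTerms n s) ?_ ?_ ?_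
      ?_ ?_ ?_ ?_ ?_ ?_ ⟨?_, hbs2⟩
    · simp
      omega
    · omega
    · rw [sumTerms_append_reverse, hg, sub_sub]
    · intro e he
      rw [hsup] at he
      exact hgD e (Finset.mem_sdiff.1 he).1
    · omega
    · rw [pow_succ] at hgj
      omega
    · intro u hu
      rcases List.mem_append.1 hu with hu | hu
      · exact hs1 u (List.mem_reverse.1 hu)
      · exact hhs u hu
    · rw [List.map_append, List.map_reverse, List.nodup_append, List.nodup_reverse]
      refine ⟨hs3, hnd, ?_⟩
      intro x hx y hy hxy
      obtain ⟨u, hu, rfl⟩ := List.mem_map.1 (List.mem_reverse.1 hx)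
      obtain ⟨v, hv, rfl⟩ := List.mem_map.1 hy
      exact hdis v hv (hxy ▸ hE (mem_expVecs.2 ⟨u, hu, rfl⟩))
    · intro u hu hmem'
      rw [hsup, Finset.mem_sdiff] at hmem'
      rcases List.mem_append.1 hu with hu | hu
      · exact hmem'.2 (mem_expVecs.2 ⟨u, List.mem_reverse.1 hu, rfl⟩)
      · exact hdis u hu hmem'.1
    · rw [hbs1, hbs.1]
      -- Both lists are increasing and have the same members, because the new number of bases is at
      -- most the old one.
      refine List.Perm.eq_of_pairwise' (List.Pairwise.filter _ List.pairwise_lt_range') List.pairwise_lt_range' ?_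
      rw [List.perm_ext_iff_of_nodup (List.Nodup.filter _ List.nodup_range') List.nodup_range']
      intro d
      simp only [List.mem_filter, List.mem_range'_1, decide_eq_true_eq]
      omega

theorem miPolyBase_meets {A : Type*} [CommRing A] (h : Sizes n T D p B)
    (box : (Fin n → A) → A) (interp : (A → A) → ℕ → ℕ → List (ℕ × R))
    (hask : Answers Q p (2 * (D * p)) T (fun w => interp fun x => box fun i => x ^ w.getD i 0) f)
    (hf : ∀ s ∈ f.support, ∑ i, s i < D) (hfT : f.support.card ≤ T) (hp : numBases n T ≤ p)
    {j : ℕ} (hj : T < 2 ^ j) :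
    (miPolyBase n T D p box interp (j + 1)).Meets Q
      (fun o => ∃ out, o = some out ∧ ListsMvTerms out f)
      (4 * (numBases n T * T) + (j + 1) * roundRing n T (numBases n T))
      (11 * opCost B + numBases n T * opCost B +
        numBases n T * ((2 * n + 1) * opCost B + 9 * (T * opCost B) + 1) +
        (j + 1) * roundBits n T (numBases n T) (opCost B)) (numBases n T + j * n) := by
  have hNB : 1 + numBases n T ≤ B := by
    have h1 := h.delta₁_le
    have h2 := h.delta₂_le
    have h3 := h.T_le
    unfold numBases
    omega
  have hDp := h.Dp_le
  have hT8 := h.T_le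
  have hDB : D ≤ B := h.D_le.trans h.p_le
  generalize hrest : (j + 1) * roundBits n T (numBases n T) (opCost B) = rest
  generalize hrestR : (j + 1) * roundRing n T (numBases n T) = restR
  unfold miPolyBase
  simp only
  generalize hini : numBases n T * ((2 * n + 1) * opCost B + 9 * (T * opCost B) + 1) = ini
  refine ((natMul_meets (B := B) hDB h.p_le).bind (r' := 4 * (numBases n T * T) + restR)
    (q' := numBases n T + j * n)
    (b' := 10 * opCost B + numBases n T * opCost B + ini + rest) ?_).bound (by omega) (by omega)
    (by omega)
  rintro _ rfl
  refine ((natMul_meets (B := B) (a := 2) (b := D * p) (by omega) (by omega)).bind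
    (r' := 4 * (numBases n T * T) + restR) (q' := numBases n T + j * n)
    (b' := 9 * opCost B + numBases n T * opCost B + ini + rest) ?_).bound (by omega) (by omega)
    (by omega)
  rintro _ rfl
  refine ((bounds_meets h).bind
    (r' := 4 * (numBases n T * T) + restR) (q' := numBases n T + j * n)
    (b' := numBases n T * opCost B + ini + rest) ?_).bound (by omega) (by omega)
    (by omega)
  rintro _ rfl
  refine ((rangeRun_meets (B := B) (numBases n T) 1 hNB (by omega)).bind
    (r' := 4 * (numBases n T * T) + restR) (q' := numBases n T + j * n)
    (b' := ini + rest) ?_).bound (by omega) (by omega) (by omega)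
  rintro _ rfl
  refine ((mapRun_meets (P := fun d b => b.d = d ∧ IsBase p B f T b) (r := 4 * T) (q := 1)
    (b := (2 * n + 1) * opCost B + 9 * (T * opCost B)) fun d hd =>
    initBase_meets h hask hf hfT (d := d) ?_).bind (r' := restR) (q' := j * n)
    (b' := rest) ?_).bound (by simp; ring_nf; rfl) (by simp [hini]) (by simp)
  · rw [List.mem_range'_1] at hd
    omega
  intro bs hbs
  rw [← hrest, ← hrestR]
  refine mainLoop_meets h hask hf hfT hp j T T [] bs f (by simp) (by omega)
    (by simp [sumTerms]) hf hfT (by omega) (by simp) (by simp) (by simp) ?_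
  unfold AreBases
  generalize List.range' 1 (numBases n T) = ds at hbs ⊢
  clear * - hbs
  induction hbs with
  | nil => simp
  | cons h _ ih => exact ⟨by simp [ih.1, h.1], by simpa [h.2] using ih.2⟩

end Loop

end SparseInterp

namespace SparseInterp

open Run Polynomial

/-! ### Asymptotic bounds -/

theorem size_le_logb_add_one {m : ℕ} {x : ℝ} (hm : 1 ≤ m) (hx : (m : ℝ) ≤ x) :
    (m.size : ℝ) ≤ Real.logb 2 x + 1 := by
  obtain ⟨s, hs⟩ : ∃ s, m.size = s + 1 :=
    Nat.exists_eq_succ_of_ne_zero (by rw [Ne, Nat.size_eq_zero]; omega)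
  have h1 : 2 ^ s ≤ m := Nat.lt_size.1 (by omega)
  have h2 : ((2 : ℝ) ^ s) ≤ x := le_trans (by exact_mod_cast h1) hx
  have h3 : (s : ℝ) ≤ Real.logb 2 x := by
    rw [Real.le_logb_iff_rpow_le one_lt_two (lt_of_lt_of_le (by positivity) h2)]
    simpa using h2
  rw [hs]
  push_cast
  linarith

/-- From `log y ≤ y - 1` at `y = x / 2`, together with `1/2 < log 2 < 1`. -/
theorem logb_two_le_self {x : ℝ} (hx : 0 < x) : Real.logb 2 x ≤ x := by
  rw [Real.logb, div_le_iff₀ (Real.log_pos one_lt_two)]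
  have h1 := Real.log_le_sub_one_of_pos (x := x / 2) (by positivity)
  rw [Real.log_div hx.ne' two_ne_zero] at h1
  have h2 := Real.log_two_gt_d9
  have h3 := Real.log_two_lt_d9
  nlinarith [mul_pos hx (show (0 : ℝ) < Real.log 2 - 1 / 2 by linarith)]

theorem one_le_logb {G : ℝ} (hG : 0 ≤ G) : 1 ≤ Real.logb 2 (3 + G) := by
  rw [Real.le_logb_iff_rpow_le one_lt_two (by linarith), Real.rpow_one]
  linarith

/-- As `B` is polynomial in `x * D`, its length is `O(log x + log D)`. With `Λ` the logarithm on the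
right, `log x` is absorbed by `Λ` and the length is `O(Λ log D)`; the logarithm of the length is
`O(Λ)` and enters squared. The condition `D ≥ 2` keeps `log D` away from zero, so that constants can
be absorbed. -/
theorem opCost_le {B κ x D : ℕ} (hx : 1 ≤ x) (hD : 2 ≤ D)
    (hB1 : 1 ≤ B) (hB : B ≤ 16 * (κ + 1) ^ 2 * (x * D) ^ 2) :
    (opCost B : ℝ) ≤ (48 + 8 * κ) * (51 + 8 * κ) ^ 2 * Real.log D *
      Real.logb 2 (3 + x ^ 2 * Real.log D) ^ 3 := by
  have hx1 : (1 : ℝ) ≤ x := by exact_mod_cast hx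
  have hD2 : (2 : ℝ) ≤ D := by exact_mod_cast hD
  set ℓ := Real.log D with hℓ
  have hlog2 := Real.log_two_gt_d9
  have hℓ2 : 1 / 2 ≤ ℓ := by
    have := Real.log_le_log two_pos hD2
    linarith
  set Λ := Real.logb 2 (3 + x ^ 2 * ℓ) with hΛ
  have hG0 : 0 ≤ (x : ℝ) ^ 2 * ℓ := by positivity
  have hΛ1 : 1 ≤ Λ := one_le_logb hG0
  have hxΛ : Real.logb 2 x ≤ Λ := by
    refine Real.logb_le_logb_of_le one_lt_two (by linarith) ?_
    nlinarith [sq_nonneg ((x : ℝ) - 1)]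
  have hℓΛ : Real.logb 2 ℓ ≤ Λ := by
    refine Real.logb_le_logb_of_le one_lt_two (by linarith) ?_
    have := le_mul_of_one_le_left (by linarith : 0 ≤ ℓ) (one_le_pow₀ hx1 : (1 : ℝ) ≤ x ^ 2)
    linarith
  have hDℓ : Real.logb 2 D ≤ 2 * ℓ := by
    rw [Real.logb, ← hℓ, div_le_iff₀ (by linarith)]
    nlinarith
  have hκ : Real.logb 2 ((κ : ℝ) + 1) ≤ κ + 1 := logb_two_le_self (by positivity)
  -- The length is at most `4 + 2 (κ + 1) + 2 Λ + 4 ℓ + 1`. By `1 ≤ 2 Λ ℓ`, `Λ ≤ 2 Λ ℓ` and `ℓ ≤ Λ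
  -- ℓ`, this plus one is at most `(16 + 4 κ + 4 + 4) Λ ℓ`.
  have hL : (B.size : ℝ) ≤ (24 + 4 * κ) * (Λ * ℓ) - 1 := by
    have h1 := size_le_logb_add_one (x := 16 * ((κ : ℝ) + 1) ^ 2 * (x * D) ^ 2) hB1
      (by exact_mod_cast hB)
    rw [Real.logb_mul (by positivity) (by positivity), Real.logb_mul (by positivity)
      (by positivity), Real.logb_pow, Real.logb_pow, Real.logb_mul (by positivity)
      (by positivity), show (16 : ℝ) = 2 ^ 4 by norm_num, Real.logb_pow,
      Real.logb_self_eq_one one_lt_two] at h1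
    push_cast at h1
    have h2 : 1 ≤ 2 * (Λ * ℓ) := by nlinarith
    have h3 : Λ ≤ 2 * (Λ * ℓ) := by nlinarith
    have h4 : ℓ ≤ Λ * ℓ := by nlinarith
    have h5 : (κ : ℝ) ≤ κ * (2 * (Λ * ℓ)) := le_mul_of_one_le_right (by positivity) h2
    nlinarith
  set L : ℕ := 2 * B.size + 1 with hLdef
  have hL' : (L : ℝ) ≤ (48 + 8 * κ) * (Λ * ℓ) := by
    rw [hLdef]
    push_cast
    have h2 : 1 ≤ 2 * (Λ * ℓ) := by nlinarith
    nlinarith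
  have hlog : ((Nat.log 2 L : ℕ) : ℝ) + 1 ≤ (51 + 8 * κ) * Λ := by
    have h1 : ((Nat.log 2 L : ℕ) : ℝ) ≤ Real.logb 2 L := Real.natLog_le_logb L 2
    have h2 : Real.logb 2 L ≤ Real.logb 2 ((48 + 8 * κ) * (Λ * ℓ)) :=
      Real.logb_le_logb_of_le one_lt_two (by rw [hLdef]; positivity) hL'
    rw [Real.logb_mul (by positivity) (by positivity), Real.logb_mul (by positivity)
      (by positivity)] at h2
    have h3 : Real.logb 2 (48 + 8 * (κ : ℝ)) ≤ 48 + 8 * κ := logb_two_le_self (by positivity)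
    have h4 : Real.logb 2 Λ ≤ Λ := logb_two_le_self (by linarith)
    have h5 : 48 + 8 * (κ : ℝ) ≤ (48 + 8 * κ) * Λ := le_mul_of_one_le_right (by positivity) hΛ1
    linarith
  have hcost : (opCost B : ℝ) = L * ((Nat.log 2 L : ℕ) + 1 : ℝ) ^ 2 := by
    rw [opCost, mulCost, ← hLdef]
    push_cast
    ring
  rw [hcost]
  calc (L : ℝ) * ((Nat.log 2 L : ℕ) + 1 : ℝ) ^ 2
      ≤ ((48 + 8 * κ) * (Λ * ℓ)) * ((51 + 8 * κ) * Λ) ^ 2 := by gcongr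
    _ = _ := by ring

theorem numBases_le_four_mul {n T : ℕ} (hn : 1 ≤ n) (hT : 1 ≤ T) : numBases n T ≤ 4 * (n * T) := by
  obtain ⟨n, rfl⟩ := Nat.exists_eq_add_of_le hn
  obtain ⟨T, rfl⟩ := Nat.exists_eq_add_of_le hT
  simp only [numBases, delta₁, delta₂, Nat.add_sub_cancel_left]
  refine max_le ?_ ?_ <;> nlinarith [Nat.zero_le (n * T)]

/-- Initialisation gives `4 * 4 = 16` and a pass `7 + 9 * 4 = 43` times `n * T ^ 2`. -/
theorem ringOps_le {n T N j : ℕ} (hN : N ≤ 4 * (n * T)) :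
    4 * (N * T) + (j + 1) * roundRing n T N ≤ 59 * ((j + 1) * (n * T ^ 2)) := by
  have h1 : N * T ≤ 4 * (n * T ^ 2) := by
    have := Nat.mul_le_mul_right T hN
    nlinarith
  have h2 : n * T ≤ n * T ^ 2 := Nat.mul_le_mul_left n (Nat.le_self_pow two_ne_zero T)
  have h3 : roundRing n T N ≤ 43 * (n * T ^ 2) := by
    unfold roundRing
    omega
  have h4 := Nat.mul_le_mul_left (j + 1) h3
  have h5 : n * T ^ 2 ≤ (j + 1) * (n * T ^ 2) := Nat.le_mul_of_pos_left _ (Nat.succ_pos j)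
  have h6 : (j + 1) * (43 * (n * T ^ 2)) = 43 * ((j + 1) * (n * T ^ 2)) := by ring
  omega

theorem bitOps_le {n T N j W : ℕ} (hn : 1 ≤ n) (hT : 1 ≤ T) (hW : 1 ≤ W) (hN : N ≤ 4 * (n * T)) :
    11 * W + N * W + N * ((2 * n + 1) * W + 9 * (T * W) + 1) + (j + 1) * roundBits n T N W ≤
      300 * ((j + 1) * ((n * T) ^ 2 * W)) := by
  obtain ⟨n, rfl⟩ := Nat.exists_eq_add_of_le hn
  obtain ⟨T, rfl⟩ := Nat.exists_eq_add_of_le hT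
  obtain ⟨W, rfl⟩ := Nat.exists_eq_add_of_le hW
  have h1 : 11 * (1 + W) + N * (1 + W) +
      N * ((2 * (1 + n) + 1) * (1 + W) + 9 * ((1 + T) * (1 + W)) + 1) ≤
      70 * (((1 + n) * (1 + T)) ^ 2 * (1 + W)) := by
    refine le_trans (b := 11 * (1 + W) + 4 * ((1 + n) * (1 + T)) * (1 + W) +
      4 * ((1 + n) * (1 + T)) * ((2 * (1 + n) + 1) * (1 + W) + 9 * ((1 + T) * (1 + W)) + 1))
      (by gcongr) ?_
    -- After the shift of all variables by one, both sides are polynomials with nonnegative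
    -- coefficients. Written as one difference they are expanded together, and `omega` compares them
    -- with the monomials as atoms.
    rw [← Nat.sub_eq_zero_iff_le]
    ring_nf
    omega
  have h2 : roundBits (1 + n) (1 + T) N (1 + W) ≤
      230 * (((1 + n) * (1 + T)) ^ 2 * (1 + W)) := by
    refine le_trans (b := roundBits (1 + n) (1 + T) (4 * ((1 + n) * (1 + T))) (1 + W))
      (by unfold roundBits; gcongr) ?_
    unfold roundBits
    rw [← Nat.sub_eq_zero_iff_le]
    ring_nf
    omega
  have h3 := Nat.mul_le_mul_left (j + 1) h2
  generalize ((1 + n) * (1 + T)) ^ 2 * (1 + W) = y at *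
  have h5 : y ≤ (j + 1) * y := Nat.le_mul_of_pos_left _ (Nat.succ_pos j)
  have h6 : (j + 1) * (230 * y) = 230 * ((j + 1) * y) := by ring
  omega

theorem size_add_one_le {T : ℕ} (hT : 1 ≤ T) {G : ℝ} (hG0 : 0 ≤ G) (hG : (T : ℝ) ≤ 3 + G) :
    (T.size : ℝ) + 1 ≤ 3 * Real.logb 2 (3 + G) := by
  have h1 := size_le_logb_add_one hT hG
  have h2 := one_le_logb hG0
  linarith

/-- The number of passes costs a single logarithm, with `177 = 59 * 3`; the exponent is raised to
`4` to share it with the bit bound. -/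
theorem softLe_of_le_mul_size {n T C r : ℕ} (hn : 1 ≤ n) (hT : 1 ≤ T) (hC : 177 ≤ C)
    (h : r ≤ 59 * ((T.size + 1) * (n * T ^ 2))) : SoftLe C 4 r (n * T ^ 2) := by
  have hT1 : (1 : ℝ) ≤ T := by exact_mod_cast hT
  have hn1 : (1 : ℝ) ≤ n := by exact_mod_cast hn
  have h1 : (r : ℝ) ≤ 59 * (((T.size : ℝ) + 1) * (n * T ^ 2)) := by exact_mod_cast h
  have hTG : (T : ℝ) ≤ 3 + n * T ^ 2 := by
    have : (T : ℝ) ^ 2 ≤ n * T ^ 2 := le_mul_of_one_le_left (by positivity) hn1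
    nlinarith
  unfold SoftLe
  have hG0 : (0 : ℝ) ≤ n * T ^ 2 := by positivity
  generalize (n : ℝ) * T ^ 2 = G at *
  have h2 := size_add_one_le hT hG0 hTG
  have h3 := one_le_logb hG0
  generalize Real.logb 2 (3 + G) = Λ at *
  have h4 : (177 : ℝ) ≤ C := by exact_mod_cast hC
  calc (r : ℝ) ≤ 59 * (((T.size : ℝ) + 1) * G) := h1
    _ ≤ 59 * (3 * Λ * G) := by gcongr
    _ = 177 * G * Λ := by ring
    _ ≤ C * G * Λ ^ 4 := by
      gcongr
      exact le_self_pow₀ h3 (by norm_num)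

theorem sizes_bound_le {n T D p κ N : ℕ} (hn : 1 ≤ n) (hT : 1 ≤ T) (hD : 1 ≤ D)
    (hN : N ≤ 4 * (n * T)) (hp : p ≤ κ * max n (max N D)) :
    8 * (n * (T + 1)) + p * p + n * (2 * (D * p)) ≤ 16 * (κ + 1) ^ 2 * (n * T * D) ^ 2 := by
  have hx : 1 ≤ n * T := Nat.mul_pos hn hT
  have hnnT : n ≤ n * T := Nat.le_mul_of_pos_right n hT
  have e1 : n * T ≤ n * T * D := Nat.le_mul_of_pos_right _ hD
  have e2 : D ≤ n * T * D := Nat.le_mul_of_pos_left _ hx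
  have e3 : n * D ≤ n * T * D := Nat.mul_le_mul_right D hnnT
  have e4 := Nat.le_self_pow two_ne_zero (n * T * D)
  have hpZ : p ≤ 4 * κ * (n * T * D) := by
    have : max n (max N D) ≤ 4 * (n * T * D) := by omega
    refine hp.trans ((Nat.mul_le_mul_left κ this).trans (le_of_eq ?_))
    ring
  generalize n * T * D = Z at *
  calc 8 * (n * (T + 1)) + p * p + n * (2 * (D * p))
      = 8 * (n * T + n) + p * p + 2 * (n * D) * p := by ring
    _ ≤ 8 * (Z ^ 2 + Z ^ 2) + 4 * κ * Z * (4 * κ * Z) + 2 * Z * (4 * κ * Z) := by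
      gcongr <;> omega
    -- The summand `24 κ Z²` completes `16 + 8 κ + 16 κ²` to `16 (κ + 1)²`.
    _ ≤ 8 * (Z ^ 2 + Z ^ 2) + 4 * κ * Z * (4 * κ * Z) + 2 * Z * (4 * κ * Z) +
        24 * (κ * Z ^ 2) := Nat.le_add_right _ _
    _ = 16 * (κ + 1) ^ 2 * Z ^ 2 := by ring

/-- The exponent `4` is one logarithm for the number of passes and three from `opCost_le`; the
constant is `900 = 300 * 3` times the one there. -/
theorem softLe_of_le_mul_opCost {n T D B κ b : ℕ} (hn : 1 ≤ n) (hT : 1 ≤ T) (hD : 2 ≤ D)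
    (hB1 : 1 ≤ B) (hB : B ≤ 16 * (κ + 1) ^ 2 * (n * T * D) ^ 2)
    (h : b ≤ 300 * ((T.size + 1) * ((n * T) ^ 2 * opCost B))) :
    SoftLe (900 * ((48 + 8 * κ) * (51 + 8 * κ) ^ 2)) 4 b (n ^ 2 * T ^ 2 * Real.log D) := by
  have hT1 : (1 : ℝ) ≤ T := by exact_mod_cast hT
  have hn1 : (1 : ℝ) ≤ n := by exact_mod_cast hn
  have h1 : (b : ℝ) ≤ 300 * (((T.size : ℝ) + 1) * ((n ^ 2 * T ^ 2) * opCost B)) := by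
    rw [← mul_pow]
    exact_mod_cast h
  have hcost := opCost_le (Nat.mul_pos hn hT) hD hB1 hB
  rw [Nat.cast_mul, mul_pow] at hcost
  have hlog : 1 / 2 ≤ Real.log D := by
    have e1 : (2 : ℝ) ≤ D := by exact_mod_cast hD
    have e2 := Real.log_le_log two_pos e1
    have := Real.log_two_gt_d9
    linarith
  unfold SoftLe
  have hx : (T : ℝ) ^ 2 ≤ n ^ 2 * T ^ 2 :=
    le_mul_of_one_le_left (by positivity) (one_le_pow₀ hn1)
  have hx0 : (0 : ℝ) ≤ n ^ 2 * T ^ 2 := by positivity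
  generalize (n : ℝ) ^ 2 * T ^ 2 = x at *
  generalize Real.log D = ℓ at *
  have hG0 : 0 ≤ x * ℓ := mul_nonneg hx0 (by linarith)
  have hTG : (T : ℝ) ≤ 3 + x * ℓ := by
    have := mul_le_mul hx hlog (by norm_num) hx0
    nlinarith [sq_nonneg ((T : ℝ) - 1)]
  have h2 := size_add_one_le hT hG0 hTG
  have h3 := one_le_logb hG0
  generalize Real.logb 2 (3 + x * ℓ) = Λ at *
  calc (b : ℝ) ≤ 300 * (((T.size : ℝ) + 1) * (x * opCost B)) := h1
    _ ≤ 300 * (3 * Λ * (x * ((48 + 8 * κ) * (51 + 8 * κ) ^ 2 * ℓ * Λ ^ 3))) := by gcongr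
    _ = _ := by
      push_cast
      ring

/-! ### Substitutions as inputs of the univariate interpolation -/

section Substitution

variable {n T D p B : ℕ} {R : Type*} [CommRing R]

theorem natDegree_powerSubst_lt (h : Sizes n T D p B) {f : MvPolynomial (Fin n) R}
    (hf : ∀ s ∈ f.support, ∑ i, s i < D) {w : List ℕ} (hw : ∀ x ∈ w, x ≤ 2 * p) :
    (powerSubst w f).natDegree < 2 * (D * p) := by
  rw [powerSubst_eq_image]
  by_cases h0 : image (pairing w) f = 0
  · rw [h0, natDegree_zero]
    have := h.D_pos
    have := h.p_pos
    positivity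
  · exact h.le_of_coeff_image_ne_zero hw hf (leadingCoeff_ne_zero.2 h0)

theorem aeval_powerSubst {A : Type*} [CommRing A] [Algebra R A] (w : List ℕ)
    (f : MvPolynomial (Fin n) R) (x : A) :
    aeval x (powerSubst w f) = MvPolynomial.aeval (fun i : Fin n => x ^ w.getD i 0) f := by
  rw [powerSubst, MvPolynomial.comp_aeval_apply]
  simp

end Substitution

end SparseInterp

theorem theorem3p5 (κ : ℕ) :
    ∃ C k : ℕ, ∀ (R : Type*) [CommRing R] [IsDomain R] [DecidableEq R]
      (A : Type*) [CommRing A] [Algebra R A]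
      (n T D p : ℕ) (f : MvPolynomial (Fin n) R) (box : (Fin n → A) → A)
      (interp : (A → A) → ℕ → ℕ → List (ℕ × R)),
      1 ≤ n → f.support.card ≤ T → f.totalDegree < D →
      p.Prime → max n (max (SparseInterp.numBases n T) D) ≤ p →
      p ≤ κ * max n (max (SparseInterp.numBases n T) D) →
      SparseInterp.IsBlackBox box f →
      SparseInterp.IsUnivariateInterpolation interp (2 * (D * p)) T →
      ∃ (fuel : ℕ) (out : List (SparseInterp.Term R)),
        let run := SparseInterp.miPolyBase n T D p box interp fuel
        run.val = some out ∧ SparseInterp.ListsMvTerms out f ∧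
        (∀ q ∈ run.queries,
          (SparseInterp.powerSubst q.weights f).natDegree < q.degBound ∧
          (SparseInterp.powerSubst q.weights f).support.card ≤ q.termBound ∧
          q.termBound ≤ T) ∧
        (1 ≤ T →
          run.queries.length ≤ C * (n * T) ∧
          (∀ q ∈ run.queries, q.degBound ≤ C * (D * max (n * T) D)) ∧
          SparseInterp.SoftLe C k run.ringOps (n * T ^ 2) ∧
          (2 ≤ D → SparseInterp.SoftLe C k run.bitOps (n ^ 2 * T ^ 2 * Real.log D))) := by
  -- The constant of the bit bound, which also dominates `177` for the ring operations, `5` for the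
  -- number of queries and `8 * κ` for their degree bounds.
  refine ⟨900 * ((48 + 8 * κ) * (51 + 8 * κ) ^ 2), 4, ?_⟩
  intro R _ _ _ A _ _ n T D p f box interp hn hfT hfD hp hpM hpκ hbox hinterp
  open SparseInterp in
  have hf : ∀ s ∈ f.support, ∑ i, s i < D := by
    intro s hs
    have h1 := MvPolynomial.le_totalDegree hs
    rw [Finsupp.sum_fintype _ _ fun _ => rfl] at h1
    exact h1.trans_lt hfD
  have hDp : D ≤ p := le_trans (le_trans (le_max_right _ _) (le_max_right _ _)) hpM
  have hNp : numBases n T ≤ p := le_trans (le_trans (le_max_left _ _) (le_max_right _ _)) hpM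
  set B := 8 * (n * (T + 1)) + p * p + n * (2 * (D * p)) with hBdef
  have hsz : Sizes n T D p B :=
    ⟨hn, hp, by omega, hDp, by omega, by omega, by omega⟩
  -- The last conjunct fixes the degree bound exactly, so that its asymptotic form can be derived
  -- afterwards.
  set Q : Query → Prop := fun q => ((powerSubst q.weights f).natDegree < q.degBound ∧
    (powerSubst q.weights f).support.card ≤ q.termBound ∧ q.termBound ≤ T) ∧
    q.degBound = 2 * (D * p) with hQ
  have hask : Answers Q p (2 * (D * p)) T
      (fun w => interp fun x => box fun i => x ^ w.getD i 0) f := by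
    intro w _ hw
    have h1 := natDegree_powerSubst_lt hsz hf hw
    have h2 : (powerSubst w f).support.card ≤ T := by
      rw [powerSubst_eq_image]
      exact (card_support_image_le _ _).trans hfT
    refine ⟨?_, ⟨h1, h2, le_rfl⟩, rfl⟩
    have h3 := hinterp _ h1 h2
    have h4 : (fun x : A => box fun i => x ^ w.getD i 0) =
        fun x => Polynomial.aeval x (powerSubst w f) := by
      funext x
      rw [hbox, aeval_powerSubst]
    simp only [h4]
    exact h3
  -- Since `T < 2 ^ T.size`, the support is exhausted after `T.size` halvings; one further test of
  -- the loop condition makes the fuel `T.size + 1`.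
  have H := miPolyBase_meets hsz box interp hask hf hfT hNp (Nat.lt_size_self T)
  obtain ⟨out, hout, hlist⟩ := H.val
  refine ⟨T.size + 1, out, hout, hlist, fun q hq => (H.qry q hq).1, fun hT => ?_⟩
  have hN := numBases_le_four_mul hn hT
  have hC : 8 * κ + 177 ≤ 900 * ((48 + 8 * κ) * (51 + 8 * κ) ^ 2) := by
    have : 1 ≤ (51 + 8 * κ) ^ 2 := Nat.one_le_pow _ _ (by omega)
    nlinarith
  have hnnT : n ≤ n * T := Nat.le_mul_of_pos_right n hT
  refine ⟨?_, ?_, ?_, fun hD => ?_⟩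
  -- There are at most `4 n T` queries for the bases and `n * T.size ≤ n T` in the loop.
  · refine H.len.trans (le_trans (b := 5 * (n * T)) ?_ (Nat.mul_le_mul_right _ (by omega)))
    have h1 : T.size ≤ T := Nat.size_le.2 T.lt_two_pow_self
    have := Nat.mul_le_mul_right n h1
    rw [mul_comm T n] at this
    omega
  · intro q hq
    rw [(H.qry q hq).2]
    have h1 : max n (max (numBases n T) D) ≤ 4 * max (n * T) D := by omega
    calc 2 * (D * p) ≤ 2 * (D * (κ * (4 * max (n * T) D))) := by gcongr; exact hpκ.trans (by gcongr)
      _ = 8 * κ * (D * max (n * T) D) := by ring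
      _ ≤ _ := Nat.mul_le_mul_right _ (by omega)
  · exact softLe_of_le_mul_size hn hT (by omega) (H.ring.trans (ringOps_le hN))
  · exact softLe_of_le_mul_opCost hn hT hD (by have := hsz.n_le; omega)
      (sizes_bound_le hn hT (by omega) hN hpκ) (H.bit.trans (bitOps_le hn hT (one_le_opCost B) hN))
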